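/- Let $M$ be a smooth (Hausdorff, $\sigma$-compact) manifold of dimension $m$, let $E\to M$ be a smooth real vector bundle of rank $n$ with dual $\pi:E^*\to M$, and let $E$ carry a skew algebroid structure, i.e. a smooth bivector field $\Pi$ on $E^*$ that is linear: with $\{\varphi,\psi\}=\Pi(d\varphi,d\psi)$ and $\iota(X)$ the fibrewise linear function on $E^*$ given by a section $X$ of $E$, the function $\{\iota(X),\iota(Y)\}$ is fibrewise linear, $\{\iota(X),\pi^*f\}$ is the pull-back of a function on $M$, and $\{\pi^*f,\pi^*g\}=0$. The bracket of sections and the anchor $\rho:E\to TM$ are defined by $\iota([X,Y])=\{\iota(X),\iota(Y)\}$ and $\pi^*(\rho(X)(f))=\{\iota(X),\pi^*f\}$; put $\langle X,d_\Pi f\rangle=\rho(X)(f)$ for $f\in C^\infty(M)$. The Hamiltonian vector field of $H\in C^\infty(E^*)$ is $\mathcal X_H=i_{dH}\Pi$, so that $\mathcal X_H(\psi)=\{H,\psi\}$. On the line bundle $L^E=\wedge^nE\otimes\wedge^mT^*M$ put $$\nabla_X(Y_1\wedge\dots\wedge Y_n\otimes\mu)=\sum_iY_1\wedge\dots\wedge[X,Y_i]\wedge\dots\wedge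 Y_n\otimes\mu+Y_1\wedge\dots\wedge Y_n\otimes\mathcal L_{\rho(X)}\mu .$$ For a smooth nowhere-vanishing section $|\sigma|$ of $|L^E|=L^E/\mathbb Z_2$, the modular form $\varphi_{|\sigma|}$ is the section of $E^*$ with $\nabla_X\sigma_0=\langle X,\varphi_{|\sigma|}\rangle\sigma_0$ for every local section $\sigma_0$ of $L^E$ representing $|\sigma|$ and every section $X$ of $E$. The modular class $\mathrm{mod}(E)$ is the class of $\varphi_{|\sigma|}$ in $\mathrm{Sec}(E^*)/d_\Pi C^\infty(M)$; it does not depend on $|\sigma|$. The algebroid is unimodular if $\mathrm{mod}(E)=0$. A density on $E^*$ means a smooth nowhere-vanishing $1$-density $\Omega$, locally a volume form up to sign; it is homogeneous if $\mathcal L_\Delta\Omega=n\,\Omega$, where $\Delta$ is the Euler vector field of $E^*$, and invariant with respect to a vector field $\mathcal X$ if $\mathcal L_{\mathcal X}\Omega=0$. A Hamiltonian is of mechanical type if $H(\xi)=\tfrac12\,g_x(\xi,\xi)+V(x)$ for $\xi\in E^*_x$, with a smooth bundle metric $g$ on $E^*$ (a positive definite scalar product on each fibre) and a smooth function $V$ on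 $M$. Then the following are equivalent: (a) $E$ is unimodular; (b) there is a homogeneous density on $E^*$ that is invariant with respect to the Hamiltonian vector fields $\mathcal X_H$ of all $H\in C^\infty(E^*)$; (c) there are a homogeneous density on $E^*$ and a Hamiltonian $H$ of mechanical type such that the density is invariant with respect to $\mathcal X_H$. -/

import Mathlib

open Bundle Set VectorField
open scoped Manifold ContDiff Topology TensorProduct

noncomputable section

namespace SkewAlgebroids

/-! ### Elements up to sign -/

/-- The equivalence relation `v ∼ ±v` on an additive group. -/
def signSetoid (A : Type*) [AddCommGroup A] : Setoid A where
  r a b := a = b ∨ a = -b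
  iseqv :=
    { refl := fun _ => Or.inl rfl
      symm := by
        rintro a b (h | h)
        · exact Or.inl h.symm
        · exact Or.inr (by rw [h, neg_neg])
      trans := by
        rintro a b c (h | h) (h' | h')
        · exact Or.inl (h.trans h')
        · exact Or.inr (h.trans h')
        · exact Or.inr (by rw [h, h'])
        · exact Or.inl (by rw [h, h', neg_neg]) }

/-- The "absolute value" `|A| = A / ℤ₂` of a (one-dimensional) vector space. -/
def Abs (A : Type*) [AddCommGroup A] : Type _ := Quotient (signSetoid A)

/-- The class `|a|` of `a`, i.e. `a` up to sign. -/
def toAbs {A : Type*} [AddCommGroup A] (a : A) : Abs A := Quotient.mk (signSetoid A) a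

/-! ### Forms and densities on a manifold -/

section Manifold

variable {V : Type*} [NormedAddCommGroup V] [NormedSpace ℝ V] {H : Type*} [TopologicalSpace H]
  (I : ModelWithCorners ℝ V H) {N : Type*} [TopologicalSpace N] [ChartedSpace H N] [IsManifold I 1 N]

/-- The vector field `v` is smooth at `p`. -/
def SmoothFieldAt (v : ∀ p : N, TangentSpace I p) (p : N) : Prop :=
  ContMDiffAt I I.tangent ∞ (fun q => (⟨q, v q⟩ : TangentBundle I N)) p

/-- The differential `df_p`, a covector at `p`. -/
def differential (f : N → ℝ) (p : N) : TangentSpace I p →L[ℝ] ℝ :=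
  mfderiv I 𝓘(ℝ, ℝ) f p

/-- The derivative `X(f)(p)` of the function `f` in the direction of the tangent vector `X` at `p`. -/
def dirDeriv (f : N → ℝ) (p : N) (X : TangentSpace I p) : ℝ :=
  differential I f p X

/-- The differential `k`-form `θ` is smooth on the set `U`: at each point of `U` its values on smooth
vector fields are smooth. -/
def SmoothFormOn {k : ℕ} (θ : ∀ p : N, TangentSpace I p [⋀^Fin k]→ₗ[ℝ] ℝ) (U : Set N) : Prop :=
  ∀ p ∈ U, ∀ v : Fin k → ∀ q : N, TangentSpace I q, (∀ i, SmoothFieldAt I (v i) p) →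
    ContMDiffAt I 𝓘(ℝ, ℝ) ∞ (fun q => θ q (fun i => v i q)) p

/-- `ν` is the value at `p` of the Lie derivative `ℒ_X θ` of the `k`-form `θ`:
`(ℒ_X θ)(v₁,…,v_k) = X(θ(v₁,…,v_k)) - ∑ᵢ θ(v₁,…,[X,vᵢ],…,v_k)` for all vector fields `vᵢ`. -/
def HasLieDerivAt {k : ℕ} (X : ∀ p : N, TangentSpace I p)
    (θ : ∀ p : N, TangentSpace I p [⋀^Fin k]→ₗ[ℝ] ℝ) (p : N)
    (ν : TangentSpace I p [⋀^Fin k]→ₗ[ℝ] ℝ) : Prop :=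
  ∀ v : Fin k → ∀ q : N, TangentSpace I q, (∀ i, SmoothFieldAt I (v i) p) →
    ν (fun i => v i p) =
      dirDeriv I (fun q => θ q (fun i => v i q)) p (X p)
        - ∑ i, θ p (Function.update (fun j => v j p) i (mlieBracket I X (v i) p))

variable (N) in
/-- A smooth nowhere-vanishing density on a `d`-dimensional manifold: a family of nonzero top-degree
forms given up to sign, which is locally represented by smooth forms. -/
structure Density (d : ℕ) where
  /-- the value of the density at a point -/
  val : ∀ p : N, Abs (TangentSpace I p [⋀^Fin d]→ₗ[ℝ] ℝ)
  ne_zero : ∀ p, val p ≠ toAbs 0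
  locally_smooth : ∀ p, ∃ U : Set N, IsOpen U ∧ p ∈ U ∧
    ∃ θ : ∀ q : N, TangentSpace I q [⋀^Fin d]→ₗ[ℝ] ℝ,
      SmoothFormOn I θ U ∧ ∀ q ∈ U, toAbs (θ q) = val q

variable {I}

/-- `ℒ_X Ω = c Ω` for a density `Ω`; this means `ℒ_X θ = c θ` for all local smooth forms `θ` that
represent `Ω`. -/
def Density.LieEq {d : ℕ} (Ω : Density I N d)
    (X : ∀ p : N, TangentSpace I p) (c : ℝ) : Prop :=
  ∀ (U : Set N) (θ : ∀ q : N, TangentSpace I q [⋀^Fin d]→ₗ[ℝ] ℝ),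
    IsOpen U → SmoothFormOn I θ U → (∀ q ∈ U, toAbs (θ q) = Ω.val q) →
    ∀ p ∈ U, HasLieDerivAt I X θ p (c • θ p)

/-- The density `Ω` is invariant with respect to the vector field `X`, i.e. `ℒ_X Ω = 0`. -/
def Density.IsInvariant {d : ℕ} (Ω : Density I N d)
    (X : ∀ p : N, TangentSpace I p) : Prop :=
  Ω.LieEq X 0

end Manifold

/-! ### The dual bundle and skew algebroids

`M` is a manifold of dimension `m` and `E` is a vector bundle of rank `n` over `M`. -/

/-- The typical fibre of a bundle of rank `n`. -/
abbrev Fib (n : ℕ) : Type := EuclideanSpace ℝ (Fin n)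

/-- The typical fibre of the dual of a bundle of rank `n`. -/
abbrev DualFib (n : ℕ) : Type := Fib n →L[ℝ] ℝ

section Bundle

variable {m n : ℕ} {M : Type*} [TopologicalSpace M] [ChartedSpace (EuclideanSpace ℝ (Fin m)) M]
  (E : M → Type*) [∀ x, AddCommGroup (E x)] [∀ x, Module ℝ (E x)]
  [TopologicalSpace (TotalSpace (Fib n) E)] [∀ x, TopologicalSpace (E x)]
  [FiberBundle (Fib n) E] [VectorBundle ℝ (Fib n) E]
  [IsManifold (𝓡 m) ∞ M] [ContMDiffVectorBundle ∞ (Fib n) E (𝓡 m)]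

/-- The fibres of the dual bundle `E*`. -/
abbrev DualBundle (x : M) : Type _ := E x →L[ℝ] Bundle.Trivial M ℝ x

variable (n) in
/-- The total space of the dual bundle `E*`. -/
abbrev DualTotal : Type _ := TotalSpace (DualFib n) (DualBundle E)

variable (m n) in
/-- The model with corners of the manifold `E*`. -/
abbrev dualModel : ModelWithCorners ℝ (EuclideanSpace ℝ (Fin m) × DualFib n)
    (ModelProd (EuclideanSpace ℝ (Fin m)) (DualFib n)) :=
  (𝓡 m).prod 𝓘(ℝ, DualFib n)

variable {E}

variable (m n) in
/-- The section `X` of `E` is smooth at `x`. -/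
def SmoothSectionAt (X : ∀ x, E x) (x : M) : Prop :=
  ContMDiffAt (𝓡 m) ((𝓡 m).prod 𝓘(ℝ, Fib n)) ∞ (fun y => TotalSpace.mk' (Fib n) y (X y)) x

variable (n) in
/-- The fibrewise linear function `ι(X)` on `E*` given by a section `X` of `E`. -/
def iota (X : ∀ x, E x) (p : DualTotal n E) : ℝ := p.2 (X p.1)

variable (n) in
/-- The basic function `π^* f` on `E*` given by a function `f` on `M`. -/
def basic (f : M → ℝ) (p : DualTotal n E) : ℝ := f p.1

variable (m n E) in
/-- A field of contravariant 2-tensors `Π` on `E*`, given by its contractions `α ↦ i_α Π` with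
covectors. -/
abbrev TwoTensor : Type _ :=
  ∀ p : DualTotal n E,
    (TangentSpace (dualModel m n) p →L[ℝ] ℝ) →ₗ[ℝ] TangentSpace (dualModel m n) p

/-- The Hamiltonian vector field `X_H = i_{dH} Π`. -/
def hamiltonianField (P : TwoTensor m n E) (H : DualTotal n E → ℝ) :
    ∀ p : DualTotal n E, TangentSpace (dualModel m n) p :=
  fun p => P p (differential (dualModel m n) H p)

/-- The bracket of functions `{f, g} = Π(df, dg) = X_f(g)`. -/
def poisson (P : TwoTensor m n E) (f g : DualTotal n E → ℝ) (p : DualTotal n E) : ℝ :=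
  differential (dualModel m n) g p (hamiltonianField P f p)

variable (m n E) in
/-- A skew algebroid structure on `E`: a smooth bivector field on `E*` which is linear, that is
`{linear, linear}` is linear, `{linear, basic}` is basic and `{basic, basic} = 0`; in adapted
coordinates, `Π = c^k_{ij}(x) ξ_k ∂_{ξ_i} ⊗ ∂_{ξ_j} + ρ^b_i(x) ∂_{ξ_i} ∧ ∂_{x^b}`. -/
structure SkewAlgebroid where
  /-- the bivector field -/
  bivector : TwoTensor m n E
  skew : ∀ (p : DualTotal n E) (α β : TangentSpace (dualModel m n) p →L[ℝ] ℝ),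
    β (bivector p α) = -α (bivector p β)
  smooth : ∀ (H : DualTotal n E → ℝ) (p : DualTotal n E),
    ContMDiffAt (dualModel m n) 𝓘(ℝ, ℝ) ∞ H p →
      SmoothFieldAt (dualModel m n) (hamiltonianField bivector H) p
  linear_linear : ∀ (X Y : ∀ x, E x) (x : M), SmoothSectionAt m n X x → SmoothSectionAt m n Y x →
    IsLinearMap ℝ (fun ξ : DualBundle E x => poisson bivector (iota n X) (iota n Y) ⟨x, ξ⟩)
  linear_basic : ∀ (X : ∀ x, E x) (f : M → ℝ) (x : M), SmoothSectionAt m n X x →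
    ContMDiffAt (𝓡 m) 𝓘(ℝ, ℝ) ∞ f x → ∀ ξ η : DualBundle E x,
      poisson bivector (iota n X) (basic n f) ⟨x, ξ⟩ =
        poisson bivector (iota n X) (basic n f) ⟨x, η⟩
  basic_basic : ∀ (f g : M → ℝ) (x : M), ContMDiffAt (𝓡 m) 𝓘(ℝ, ℝ) ∞ f x →
    ContMDiffAt (𝓡 m) 𝓘(ℝ, ℝ) ∞ g x → ∀ ξ : DualBundle E x,
      poisson bivector (basic n f) (basic n g) ⟨x, ξ⟩ = 0

namespace SkewAlgebroid

variable (A : SkewAlgebroid m n E)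

/-- `w` is the value at `x` of the bracket `[X, Y]_Π` of sections of `E`, which is determined by
`ι([X, Y]_Π) = {ι(X), ι(Y)}_Π`. -/
def HasBracketAt (X Y : ∀ x, E x) (x : M) (w : E x) : Prop :=
  ∀ ξ : DualBundle E x, ξ w = poisson A.bivector (iota n X) (iota n Y) ⟨x, ξ⟩

/-- The vector field `ρ(X)` on `M`, where `ρ` is the anchor: the projection to `M` of the Hamiltonian
vector field of `ι(X)`, so that `π^*(ρ(X)(f)) = {ι(X), π^* f}`. (By linearity of `Π` the projection
is constant along the fibres of `E*`; it is taken here at the zero covector.) -/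
def anchor (X : ∀ x, E x) (x : M) : TangentSpace (𝓡 m) x :=
  mfderiv (dualModel m n) (𝓡 m) (fun p : DualTotal n E => p.1) (⟨x, 0⟩ : DualTotal n E)
    (hamiltonianField A.bivector (iota n X) ⟨x, 0⟩)

end SkewAlgebroid

/-! ### The modular class -/

variable (m n E) in
/-- The fibre at `x` of the line bundle `L^E = ⋀^top E ⊗ ⋀^top T*M`. -/
abbrev LFiber (x : M) : Type _ :=
  (⋀[ℝ]^n (E x)) ⊗[ℝ] (TangentSpace (𝓡 m) x [⋀^Fin m]→ₗ[ℝ] ℝ)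

/-- The element `Y₁ ∧ … ∧ Yₙ ⊗ μ` of the fibre of `L^E` at `x`. -/
def wedgeTensor {x : M} (Y : Fin n → E x) (μ : TangentSpace (𝓡 m) x [⋀^Fin m]→ₗ[ℝ] ℝ) :
    LFiber m n E x :=
  exteriorPower.ιMulti ℝ n Y ⊗ₜ[ℝ] μ

variable (m n E) in
/-- A smooth nowhere-vanishing section `|σ|` of `|L^E| = L^E / ℤ₂`: locally it is represented by
`Y₁ ∧ … ∧ Yₙ ⊗ μ` with smooth sections `Yᵢ` of `E` and a smooth top-degree form `μ` on `M`. -/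
structure AbsSection where
  /-- the value of the section at a point -/
  val : ∀ x : M, Abs (LFiber m n E x)
  ne_zero : ∀ x, val x ≠ toAbs 0
  locally_smooth : ∀ x, ∃ U : Set M, IsOpen U ∧ x ∈ U ∧
    ∃ (Y : Fin n → ∀ y, E y) (μ : ∀ y : M, TangentSpace (𝓡 m) y [⋀^Fin m]→ₗ[ℝ] ℝ),
      (∀ i, ∀ y ∈ U, SmoothSectionAt m n (Y i) y) ∧ SmoothFormOn (𝓡 m) μ U ∧
        ∀ y ∈ U, toAbs (wedgeTensor (fun i => Y i y) (μ y)) = val y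

namespace SkewAlgebroid

variable (A : SkewAlgebroid m n E)

/-- `τ` is the value at `x` of `∇^Π_X (Y₁ ∧ … ∧ Yₙ ⊗ μ)`, where
`∇^Π_X (Y ⊗ μ) = ℒ_X Y ⊗ μ + Y ⊗ ℒ_{ρ(X)} μ` and
`ℒ_X (Y₁ ∧ … ∧ Yₙ) = ∑ᵢ Y₁ ∧ … ∧ [X, Yᵢ]_Π ∧ … ∧ Yₙ`. -/
def HasNablaAt (X : ∀ x, E x) (Y : Fin n → ∀ x, E x)
    (μ : ∀ y : M, TangentSpace (𝓡 m) y [⋀^Fin m]→ₗ[ℝ] ℝ) (x : M) (τ : LFiber m n E x) : Prop :=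
  ∃ (w : Fin n → E x) (ν : TangentSpace (𝓡 m) x [⋀^Fin m]→ₗ[ℝ] ℝ),
    (∀ i, A.HasBracketAt X (Y i) x (w i)) ∧ HasLieDerivAt (𝓡 m) (A.anchor X) μ x ν ∧
      τ = (∑ i, wedgeTensor (Function.update (fun j => Y j x) i (w i)) (μ x))
        + wedgeTensor (fun j => Y j x) ν

variable (m n E) in
/-- The smooth sections of `E*`. -/
abbrev OneForms : Type _ := ContMDiffSection (𝓡 m) (DualFib n) ∞ (DualBundle E)

/-- `φ` is the modular form `φ^Π_{|σ|}` of the section `|σ|` of `|L^E|`, i.e.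
`∇^Π_X σ₀ = ⟨X, φ⟩ σ₀` for all local sections `σ₀ = Y₁ ∧ … ∧ Yₙ ⊗ μ` of `L^E` that represent `|σ|`
and all (local) sections `X` of `E`. -/
def IsModularForm (σ : AbsSection m n E) (φ : OneForms m n E) : Prop :=
  ∀ (U : Set M) (Y : Fin n → ∀ y, E y) (μ : ∀ y : M, TangentSpace (𝓡 m) y [⋀^Fin m]→ₗ[ℝ] ℝ),
    IsOpen U → (∀ i, ∀ y ∈ U, SmoothSectionAt m n (Y i) y) → SmoothFormOn (𝓡 m) μ U →
    (∀ y ∈ U, toAbs (wedgeTensor (fun i => Y i y) (μ y)) = σ.val y) →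
    ∀ X : ∀ x, E x, (∀ y ∈ U, SmoothSectionAt m n X y) → ∀ x ∈ U,
      A.HasNablaAt X Y μ x ((φ x (X x) : ℝ) • wedgeTensor (fun i => Y i x) (μ x))

/-- The space `d_Π 𝒜⁰(E*)` of exact 1-forms: those `φ` with `⟨X, φ⟩ = ρ(X)(f)` for some smooth
function `f` on `M` and all (local) sections `X`. -/
def exactForms : Submodule ℝ (OneForms m n E) where
  carrier := {φ | ∃ f : M → ℝ, ContMDiff (𝓡 m) 𝓘(ℝ, ℝ) ∞ f ∧
    ∀ (x : M) (X : ∀ x, E x), SmoothSectionAt m n X x →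
      φ x (X x) = dirDeriv (𝓡 m) f x (A.anchor X x)}
  zero_mem' := by
    refine ⟨fun _ => 0, contMDiff_const, fun x X _ => ?_⟩
    have h : differential (𝓡 m) (fun _ : M => (0 : ℝ)) x = 0 := mfderiv_const
    rw [dirDeriv, h]
    rfl
  add_mem' := by
    rintro φ ψ ⟨f, hf, hφ⟩ ⟨g, hg, hψ⟩
    refine ⟨f + g, hf.add hg, fun x X hX => ?_⟩
    have h : differential (𝓡 m) (f + g) x = differential (𝓡 m) f x + differential (𝓡 m) g x :=
      mfderiv_add ((hf x).mdifferentiableAt (by simp)) ((hg x).mdifferentiableAt (by simp))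
    have h1 := hφ x X hX
    have h2 := hψ x X hX
    rw [dirDeriv] at h1 h2 ⊢
    rw [h, _root_.add_apply, ← h1, ← h2]
    rfl
  smul_mem' := by
    rintro c φ ⟨f, hf, hφ⟩
    refine ⟨c • f, (contMDiff_const (c := c)).mul hf, fun x X hX => ?_⟩
    have h : differential (𝓡 m) (c • f) x = c • differential (𝓡 m) f x :=
      const_smul_mfderiv ((hf x).mdifferentiableAt (by simp)) c
    have h1 := hφ x X hX
    rw [dirDeriv] at h1 ⊢
    rw [h, _root_.smul_apply, ← h1]
    rfl

/-- `c` is the modular class `mod(E, Π) ∈ 𝒜¹(E*) / d_Π 𝒜⁰(E*)`, the class of the modular form of a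
nowhere-vanishing section of `|L^E|`. -/
def IsModularClass (c : OneForms m n E ⧸ A.exactForms) : Prop :=
  ∃ (σ : AbsSection m n E) (φ : OneForms m n E), A.IsModularForm σ φ ∧ A.exactForms.mkQ φ = c

/-- The skew algebroid is unimodular: `mod(E, Π) = 0`. -/
def IsUnimodular : Prop := A.IsModularClass 0

end SkewAlgebroid

/-! ### Homogeneous densities and Hamiltonians of mechanical type -/

variable (m n E) in
/-- The Euler (Liouville) vector field on `E*`, whose value at `ξ` is the velocity of `t ↦ t ξ` at
`t = 1`. -/
def eulerField : ∀ p : DualTotal n E, TangentSpace (dualModel m n) p :=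
  fun p => mfderiv 𝓘(ℝ, ℝ) (dualModel m n) (fun t : ℝ => (⟨p.1, t • p.2⟩ : DualTotal n E)) 1 (1 : ℝ)

variable (m n E) in
/-- Smooth nowhere-vanishing densities on the manifold `E*`. -/
abbrev DualDensity : Type _ := Density (dualModel m n) (DualTotal n E) (m + n)

/-- A density on `E*` is homogeneous (of degree `n = rank E`) if `ℒ_Δ Ω = n Ω` for the Euler field
`Δ`. -/
def IsHomogeneous (Ω : DualDensity m n E) : Prop := Ω.LieEq (eulerField m n E) n

variable (m) in
/-- A Hamiltonian of mechanical type, `H(x, ξ) = ½ g_x(ξ, ξ) + V(x)`, for a smooth bundle metric `g`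
on `E*` and a smooth potential `V` on `M`. -/
def IsMechanical (H : DualTotal n E → ℝ) : Prop :=
  ∃ (g : ContMDiffRiemannianMetric (𝓡 m) ∞ (DualFib n) (DualBundle E)) (V : M → ℝ),
    ContMDiff (𝓡 m) 𝓘(ℝ, ℝ) ∞ V ∧
      ∀ p : DualTotal n E, H p = (1 / 2 : ℝ) * g.inner p.1 p.2 p.2 + V p.1

end Bundle

end SkewAlgebroids

end

/-! The modular class is read off from divergences of Hamiltonian vector fields. Take coordinates
`x` on `M` and a frame `Y` of `E`. The section `h Y₁ ∧ … ∧ Yₙ ⊗ dx` of `L^E` corresponds, up to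
sign, to the form `h dx ∧ dι(Y₁) ∧ … ∧ dι(Yₙ)` on `E*`. The correspondence does not depend on the
choices (`Match`). Every section of `|L^E|` gives a homogeneous density
(`exists_density_of_absSection`). Conversely a homogeneous density has a coefficient that is
constant along the fibres (`toAbs_eq_of_isHomogeneous`), so it comes from its restriction to the
zero section (`exists_absSection_of_density`).

Fix such a density. Since `Π` is skew and second derivatives at a critical point are symmetric, the
divergence of `X_H` at `p` depends only on `dH` at `p`, and linearly
(`divergence_eq_zero_of_critical`, `scaledDiv_eq_sum`); no Jacobi identity for `Π` enters. It
vanishes for the basic coordinates (`scaledDiv_basic`). For `ι(X)` it is the trace of the bracket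
with `X` on the frame, plus the divergence of `ρ(X)`, which is the coefficient of `∇_X`
(`scaledDiv_iota`, `exists_nabla_coeff`). Hence the divergence of `X_H` is the derivative of `H`
along the vertical lift of the modular form `φ` (`hasLieDerivAt_of_frame`).

The equivalence follows. If `φ = d_Π f`, multiplying the density by `exp(-f)` makes all divergences
zero. A mechanical Hamiltonian exists because bundle metrics do. If `H` is mechanical, its
derivative at `ξ` along the lift of `φ` is `g(ξ, φ)`; if this vanishes for all `ξ`, the choice `ξ =
φ` gives `φ = 0`. -/

set_option linter.unusedSectionVars false

noncomputable section

namespace SkewAlgebroids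

/-! ### Derivatives of functions along tangent vectors. -/

section Calculus

variable {V : Type*} [NormedAddCommGroup V] [NormedSpace ℝ V] {H : Type*} [TopologicalSpace H]
  {I : ModelWithCorners ℝ V H} {N : Type*} [TopologicalSpace N] [ChartedSpace H N]
  [IsManifold I ∞ N]

lemma dirDeriv_vec_add (f : N → ℝ) (p : N) (X Y : TangentSpace I p) :
    dirDeriv I f p (X + Y) = dirDeriv I f p X + dirDeriv I f p Y :=
  (differential I f p).map_add X Y

lemma dirDeriv_vec_smul (f : N → ℝ) (p : N) (c : ℝ) (X : TangentSpace I p) :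
    dirDeriv I f p (c • X) = c * dirDeriv I f p X :=
  (differential I f p).map_smul c X

lemma dirDeriv_vec_sum {ι : Type*} (s : Finset ι) (f : N → ℝ) (p : N)
    (X : ι → TangentSpace I p) :
    dirDeriv I f p (∑ i ∈ s, X i) = ∑ i ∈ s, dirDeriv I f p (X i) :=
  map_sum (differential I f p) X s

lemma dirDeriv_congr {f g : N → ℝ} {p : N} (h : f =ᶠ[𝓝 p] g) (X : TangentSpace I p) :
    dirDeriv I f p X = dirDeriv I g p X := by
  have : differential I f p = differential I g p := h.mfderiv_eq
  rw [dirDeriv, dirDeriv, this]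

lemma dirDeriv_const (c : ℝ) (p : N) (X : TangentSpace I p) :
    dirDeriv I (fun _ => c) p X = 0 := by
  have : differential I (fun _ : N => c) p = 0 := mfderiv_const
  rw [dirDeriv, this]; rfl

lemma dirDeriv_add {f g : N → ℝ} {p : N} (hf : MDifferentiableAt I 𝓘(ℝ, ℝ) f p)
    (hg : MDifferentiableAt I 𝓘(ℝ, ℝ) g p) (X : TangentSpace I p) :
    dirDeriv I (fun q => f q + g q) p X = dirDeriv I f p X + dirDeriv I g p X := by
  have : differential I (f + g) p = differential I f p + differential I g p := mfderiv_add hf hg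
  exact DFunLike.congr_fun this X

lemma dirDeriv_neg (f : N → ℝ) (p : N) (X : TangentSpace I p) :
    dirDeriv I (fun q => - f q) p X = - dirDeriv I f p X := by
  have : differential I (-f) p = - differential I f p := mfderiv_neg
  exact DFunLike.congr_fun this X

lemma dirDeriv_mul {f g : N → ℝ} {p : N} (hf : MDifferentiableAt I 𝓘(ℝ, ℝ) f p)
    (hg : MDifferentiableAt I 𝓘(ℝ, ℝ) g p) (X : TangentSpace I p) :
    dirDeriv I (fun q => f q * g q) p X
      = f p * dirDeriv I g p X + g p * dirDeriv I f p X := by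
  have := (hf.hasMFDerivAt.mul hg.hasMFDerivAt).mfderiv
  exact DFunLike.congr_fun this X

lemma dirDeriv_const_mul (c : ℝ) {f : N → ℝ} {p : N} (hf : MDifferentiableAt I 𝓘(ℝ, ℝ) f p)
    (X : TangentSpace I p) :
    dirDeriv I (fun q => c * f q) p X = c * dirDeriv I f p X := by
  rw [dirDeriv_mul mdifferentiableAt_const hf, dirDeriv_const, mul_zero, add_zero]

lemma mdifferentiableAt_finsetSum {ι : Type*} (s : Finset ι) {f : ι → N → ℝ} {p : N}
    (hf : ∀ i ∈ s, MDifferentiableAt I 𝓘(ℝ, ℝ) (f i) p) :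
    MDifferentiableAt I 𝓘(ℝ, ℝ) (fun q => ∑ i ∈ s, f i q) p := by
  classical
  induction s using Finset.induction_on with
  | empty => simpa using mdifferentiableAt_const
  | insert i s hi ih =>
    simp only [Finset.sum_insert hi]
    exact (hf i (by simp)).add (ih fun j hj => hf j (by simp [hj]))

lemma dirDeriv_sum {ι : Type*} (s : Finset ι) {f : ι → N → ℝ} {p : N}
    (hf : ∀ i ∈ s, MDifferentiableAt I 𝓘(ℝ, ℝ) (f i) p) (X : TangentSpace I p) :
    dirDeriv I (fun q => ∑ i ∈ s, f i q) p X = ∑ i ∈ s, dirDeriv I (f i) p X := by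
  classical
  induction s using Finset.induction_on with
  | empty => simpa using dirDeriv_const 0 p X
  | insert i s hi ih =>
    simp only [Finset.sum_insert hi]
    rw [dirDeriv_add (hf i (by simp))
      (mdifferentiableAt_finsetSum s fun j hj => hf j (by simp [hj])),
      ih fun j hj => hf j (by simp [hj])]

lemma dirDeriv_add_sum_const_mul {ι : Type*} (s : Finset ι) (c : ι → ℝ) {g : N → ℝ}
    {f : ι → N → ℝ} {p : N} (hg : MDifferentiableAt I 𝓘(ℝ, ℝ) g p)
    (hf : ∀ i ∈ s, MDifferentiableAt I 𝓘(ℝ, ℝ) (f i) p) (X : TangentSpace I p) :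
    dirDeriv I (fun q => g q + ∑ i ∈ s, c i * f i q) p X
      = dirDeriv I g p X + ∑ i ∈ s, c i * dirDeriv I (f i) p X := by
  have h : ∀ i ∈ s, MDifferentiableAt I 𝓘(ℝ, ℝ) (fun q => c i * f i q) p := fun i hi =>
    mdifferentiableAt_const.mul (hf i hi)
  rw [dirDeriv_add hg (mdifferentiableAt_finsetSum s h), dirDeriv_sum s h]
  congr 1
  exact Finset.sum_congr rfl fun i hi => dirDeriv_const_mul _ (hf i hi) _

lemma mdifferentiableAt_finsetProd {ι : Type*} (s : Finset ι) {f : ι → N → ℝ} {p : N}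
    (hf : ∀ i ∈ s, MDifferentiableAt I 𝓘(ℝ, ℝ) (f i) p) :
    MDifferentiableAt I 𝓘(ℝ, ℝ) (fun q => ∏ i ∈ s, f i q) p := by
  classical
  induction s using Finset.induction_on with
  | empty => simpa using mdifferentiableAt_const
  | insert i s hi ih =>
    simp only [Finset.prod_insert hi]
    exact (hf i (by simp)).mul (ih fun j hj => hf j (by simp [hj]))

lemma dirDeriv_prod {ι : Type*} [DecidableEq ι] (s : Finset ι) {f : ι → N → ℝ} {p : N}
    (hf : ∀ i ∈ s, MDifferentiableAt I 𝓘(ℝ, ℝ) (f i) p) (X : TangentSpace I p) :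
    dirDeriv I (fun q => ∏ i ∈ s, f i q) p X
      = ∑ i ∈ s, ∏ j ∈ s, Function.update (fun j => f j p) i (dirDeriv I (f i) p X) j := by
  induction s using Finset.induction_on with
  | empty => simpa using dirDeriv_const 1 p X
  | insert i s hi ih =>
    simp only [Finset.prod_insert hi]
    rw [dirDeriv_mul (hf i (by simp))
      (mdifferentiableAt_finsetProd s fun j hj => hf j (by simp [hj])),
      ih fun j hj => hf j (by simp [hj]), Finset.sum_insert hi, add_comm, Finset.mul_sum]
    congr 1
    · rw [Function.update_self, mul_comm]
      congr 1
      refine Finset.prod_congr rfl fun j hj => ?_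
      rw [Function.update_of_ne (by rintro rfl; exact hi hj)]
    · refine Finset.sum_congr rfl fun j hj => ?_
      rw [Function.update_of_ne (by rintro rfl; exact hi hj)]

/-- The derivative of a determinant is the sum of the determinants in which one row is
differentiated. -/
lemma dirDeriv_det {d : ℕ} {A : Fin d → Fin d → N → ℝ} {p : N}
    (hA : ∀ i j, MDifferentiableAt I 𝓘(ℝ, ℝ) (A i j) p) (X : TangentSpace I p) :
    dirDeriv I (fun q => (Matrix.of fun i j => A i j q).det) p X
      = ∑ i, ((Matrix.of fun i j => A i j p).updateRow i fun j => dirDeriv I (A i j) p X).det := by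
  have h : (fun q => (Matrix.of fun i j => A i j q).det)
      = fun q => ∑ σ : Equiv.Perm (Fin d), ((Equiv.Perm.sign σ : ℤ) : ℝ) * ∏ i, A i (σ i) q := by
    funext q
    -- After transposing, each product runs over the rows, so differentiating one factor replaces
    -- one row.
    rw [← Matrix.det_transpose, Matrix.det_apply']
    rfl
  rw [h, dirDeriv_sum]
  · simp_rw [← Matrix.det_transpose (Matrix.updateRow _ _ _), Matrix.det_apply']
    rw [Finset.sum_comm]
    refine Finset.sum_congr rfl fun σ _ => ?_
    rw [dirDeriv_const_mul _ (mdifferentiableAt_finsetProd _ fun i _ => hA _ _),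
      dirDeriv_prod _ fun i _ => hA _ _, Finset.mul_sum]
    refine Finset.sum_congr rfl fun i _ => ?_
    congr 1
    refine Finset.prod_congr rfl fun j _ => ?_
    rcases eq_or_ne j i with rfl | hj
    · simp
    · simp [hj, Matrix.updateRow_ne]
  · intro σ _
    exact mdifferentiableAt_const.mul (mdifferentiableAt_finsetProd _ fun i _ => hA _ _)

lemma contMDiffAt_det {d : ℕ} {A : Fin d → Fin d → N → ℝ} {p : N}
    (hA : ∀ i j, ContMDiffAt I 𝓘(ℝ, ℝ) ∞ (A i j) p) :
    ContMDiffAt I 𝓘(ℝ, ℝ) ∞ (fun q => (Matrix.of fun i j => A i j q).det) p := by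
  simp_rw [Matrix.det_apply']
  refine ContMDiffAt.sum fun σ _ => contMDiffAt_const.mul (contMDiffAt_finsetProd fun i _ => hA _ _)

lemma contMDiffAt_dirDeriv {f : N → ℝ} {p : N} (hf : ContMDiffAt I 𝓘(ℝ, ℝ) ∞ f p)
    {v : ∀ q : N, TangentSpace I q} (hv : SmoothFieldAt I v p) :
    ContMDiffAt I 𝓘(ℝ, ℝ) ∞ (fun q => dirDeriv I f q (v q)) p := by
  have hϕ : ContMDiffAt I 𝓘(ℝ, V →L[ℝ] ℝ) ∞
      (fun y => ContinuousLinearMap.inCoordinates V (TangentSpace I (M := N)) ℝ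
        (TangentSpace 𝓘(ℝ, ℝ) (M := ℝ)) p y (f p) (f y) (mfderiv I 𝓘(ℝ, ℝ) f y)) p :=
    ContMDiffAt.mfderiv_const hf le_rfl
  have := ContMDiffAt.clm_apply_of_inCoordinates hϕ hv hf
  exact (contMDiff_snd_tangentBundle_modelSpace ℝ 𝓘(ℝ, ℝ)).contMDiffAt.comp p this

end Calculus

/-! ### The Lie bracket as a commutator of derivations. -/

section Bracket

variable {V : Type*} [NormedAddCommGroup V] [NormedSpace ℝ V] [FiniteDimensional ℝ V]
  {H : Type*} [TopologicalSpace H]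
  {I : ModelWithCorners ℝ V H} {N : Type*} [TopologicalSpace N] [ChartedSpace H N]
  [IsManifold I ∞ N]

lemma mlieBracket_smul_right_dirDeriv {f : N → ℝ} {p : N} {X Z : ∀ q : N, TangentSpace I q}
    (hf : MDifferentiableAt I 𝓘(ℝ, ℝ) f p)
    (hZ : MDifferentiableAt I I.tangent (fun q => (⟨q, Z q⟩ : TangentBundle I N)) p) :
    mlieBracket I X (fun q => f q • Z q) p
      = dirDeriv I f p (X p) • Z p + f p • mlieBracket I X Z p := by
  have := FiniteDimensional.complete ℝ V
  exact mlieBracket_smul_right (I := I) (V := X) (W := Z) hf hZ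

lemma smoothFieldAt_eventually {X : ∀ q : N, TangentSpace I q} {p : N}
    (hX : SmoothFieldAt I X p) :
    ∀ᶠ y in 𝓝 p, MDifferentiableAt I I.tangent (fun q => (⟨q, X q⟩ : TangentBundle I N)) y := by
  have h1 : ContMDiffAt I I.tangent 1 (fun q => (⟨q, X q⟩ : TangentBundle I N)) p :=
    ContMDiffAt.of_le hX (by simp)
  exact ((contMDiffAt_iff_contMDiffAt_nhds (by simp)).mp h1).mono
    fun y hy => hy.mdifferentiableAt (by simp)

lemma eventually_mdifferentiableAt {f : N → ℝ} {p : N}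
    (hf : ContMDiffAt I 𝓘(ℝ, ℝ) ∞ f p) :
    ∀ᶠ y in 𝓝 p, MDifferentiableAt I 𝓘(ℝ, ℝ) f y := by
  have h1 : ContMDiffAt I 𝓘(ℝ, ℝ) 1 f p := ContMDiffAt.of_le hf (by simp)
  exact ((contMDiffAt_iff_contMDiffAt_nhds (by simp)).mp h1).mono
    fun y hy => hy.mdifferentiableAt (by simp)

lemma smoothFieldAt_mlieBracket {X Y : ∀ q : N, TangentSpace I q} {p : N}
    (hX : SmoothFieldAt I X p) (hY : SmoothFieldAt I Y p) :
    SmoothFieldAt I (mlieBracket I X Y) p := by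
  have := FiniteDimensional.complete ℝ V
  have : IsManifold I (((⊤ : ℕ∞) : WithTop ℕ∞) + 1) N := by simpa
  have : IsManifold I (minSmoothness ℝ 2) N := by
    rw [minSmoothness_of_isRCLikeNormedField]; infer_instance
  exact ContMDiffAt.mlieBracket_vectorField (m := ⊤) (n := ⊤) hX hY (by simp)

lemma smoothFieldAt_extend {p : N} (v : TangentSpace I p) :
    SmoothFieldAt I (FiberBundle.extend V v) p :=
  FiberBundle.contMDiffAt_extend I V v

/-- The commutator formula `[X, Y](f) = X(Y(f)) - Y(X(f))`. -/
lemma dirDeriv_mlieBracket {f : N → ℝ} {p : N} {X Y : ∀ q : N, TangentSpace I q}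
    (hf : ContMDiffAt I 𝓘(ℝ, ℝ) ∞ f p) (hX : SmoothFieldAt I X p) (hY : SmoothFieldAt I Y p) :
    dirDeriv I f p (mlieBracket I X Y p)
      = dirDeriv I (fun q => dirDeriv I f q (Y q)) p (X p)
        - dirDeriv I (fun q => dirDeriv I f q (X q)) p (Y p) := by
  have := FiniteDimensional.complete ℝ V
  have : IsManifold I (minSmoothness ℝ 3) N := by
    rw [minSmoothness_of_isRCLikeNormedField]; infer_instance
  -- The argument compares coefficients of a nonzero vector `z`, so a trivial tangent space is
  -- treated apart; there both sides are zero.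
  by_cases hV : ∀ v : TangentSpace I p, v = 0
  · have h0 (g : N → ℝ) : dirDeriv I g p 0 = 0 := (differential I g p).map_zero
    rw [hV (mlieBracket I X Y p), hV (X p), hV (Y p), h0, h0, h0, sub_zero]
  push Not at hV
  obtain ⟨z, hz⟩ := hV
  set Z : ∀ q : N, TangentSpace I q := FiberBundle.extend V z with hZdef
  have hZ : SmoothFieldAt I Z p := smoothFieldAt_extend z
  have hZp : Z p = z := by simp [Z]
  have hfZ : SmoothFieldAt I (fun q => f q • Z q) p := ContMDiffAt.smul_section hf hZ
  have hmd {g : N → ℝ} (hg : ContMDiffAt I 𝓘(ℝ, ℝ) ∞ g p) : MDifferentiableAt I 𝓘(ℝ, ℝ) g p :=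
    hg.mdifferentiableAt (by simp)
  have key {U W : ∀ q : N, TangentSpace I q} (hU : SmoothFieldAt I U p)
      (hW : SmoothFieldAt I W p) :
      mlieBracket I U (mlieBracket I W (fun q => f q • Z q)) p
        = dirDeriv I (fun q => dirDeriv I f q (W q)) p (U p) • z
          + dirDeriv I f p (W p) • mlieBracket I U Z p
          + (dirDeriv I f p (U p) • mlieBracket I W Z p
            + f p • mlieBracket I U (mlieBracket I W Z) p) := by
    have h1 : mlieBracket I W (fun q => f q • Z q)
        =ᶠ[𝓝 p] (fun q => dirDeriv I f q (W q) • Z q) + fun q => f q • mlieBracket I W Z q := by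
      filter_upwards [eventually_mdifferentiableAt hf, smoothFieldAt_eventually hZ] with y h1 h2
      exact mlieBracket_smul_right_dirDeriv h1 h2
    have hWf := contMDiffAt_dirDeriv hf hW
    have hWZ := smoothFieldAt_mlieBracket hW hZ
    have a1 : SmoothFieldAt I (fun q => dirDeriv I f q (W q) • Z q) p :=
      ContMDiffAt.smul_section hWf hZ
    have a2 : SmoothFieldAt I (fun q => f q • mlieBracket I W Z q) p :=
      ContMDiffAt.smul_section hf hWZ
    rw [Filter.EventuallyEq.mlieBracket_vectorField_eq (Filter.EventuallyEq.refl _ U) h1,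
      mlieBracket_add_right (a1.mdifferentiableAt (by simp)) (a2.mdifferentiableAt (by simp)),
      mlieBracket_smul_right_dirDeriv (hmd hWf) (hZ.mdifferentiableAt (by simp)),
      mlieBracket_smul_right_dirDeriv (hmd hf) (hWZ.mdifferentiableAt (by simp)), hZp]
  have h2 (W : ∀ q : N, TangentSpace I q) (hW : SmoothFieldAt I W p) :
      ContMDiffAt I I.tangent (minSmoothness ℝ 2) (fun q => (⟨q, W q⟩ : TangentBundle I N)) p :=
    ContMDiffAt.of_le hW (by
      rw [minSmoothness_of_isRCLikeNormedField]; exact ENat.LEInfty.out)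
  -- The Jacobi identity for `X`, `Y`, `f Z` minus `f` times the one for `X`, `Y`, `Z` leaves the
  -- commutator formula multiplied by `Z`.
  have J := leibniz_identity_mlieBracket_apply (h2 X hX) (h2 Y hY) (h2 _ hfZ)
  have J' := leibniz_identity_mlieBracket_apply (h2 X hX) (h2 Y hY) (h2 _ hZ)
  rw [key hX hY, key hY hX, mlieBracket_smul_right_dirDeriv (hmd hf)
    (hZ.mdifferentiableAt (by simp)), hZp, J'] at J
  have J3 : (dirDeriv I f p (mlieBracket I X Y p)
      - (dirDeriv I (fun q => dirDeriv I f q (Y q)) p (X p)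
        - dirDeriv I (fun q => dirDeriv I f q (X q)) p (Y p))) • z = 0 := by
    linear_combination (norm := module) -J
  rcases smul_eq_zero.mp J3 with h | h
  · linarith
  · exact absurd h hz

end Bracket

/-! ### Signs, determinants and top-degree forms. -/

section LinearAlgebra

lemma toAbs_eq_iff {A : Type*} [AddCommGroup A] {a b : A} :
    toAbs a = toAbs b ↔ a = b ∨ a = -b :=
  Quotient.eq (r := signSetoid A)

lemma toAbs_eq_zero_iff {A : Type*} [AddCommGroup A] {a : A} : toAbs a = toAbs 0 ↔ a = 0 := by
  rw [toAbs_eq_iff, neg_zero, or_self]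

lemma exists_toAbs_eq {A : Type*} [AddCommGroup A] (a : Abs A) : ∃ b, toAbs b = a :=
  Quotient.exists_rep a

/-- Cofactor expansion along the replaced rows turns the sum into the trace of `A * (M.adjugate *
M)`, and `M.adjugate * M` is `det M` times the identity. This is where the trace, hence the
divergence, appears in the Lie derivative of a top-degree form. -/
lemma sum_det_updateRow_mulVec {d : ℕ} (A M : Matrix (Fin d) (Fin d) ℝ) :
    ∑ j, (M.updateRow j fun i => ∑ k, A i k * M j k).det = (∑ i, A i i) * M.det := by
  have h (j : Fin d) (b : Fin d → ℝ) : (M.updateRow j b).det = ∑ i, M.adjugate i j * b i := by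
    rw [← Matrix.cramer_transpose_apply, Matrix.cramer_eq_adjugate_mulVec,
      ← Matrix.adjugate_transpose]
    rfl
  simp_rw [h]
  calc ∑ j, ∑ i, M.adjugate i j * ∑ k, A i k * M j k
      = ∑ i, ∑ k, A i k * (M.adjugate * M) i k := by
        simp_rw [Matrix.mul_apply, Finset.mul_sum]
        rw [Finset.sum_comm]
        refine Finset.sum_congr rfl fun i _ => ?_
        rw [Finset.sum_comm]
        refine Finset.sum_congr rfl fun k _ => Finset.sum_congr rfl fun j _ => ?_
        ring
    _ = _ := by
        rw [Matrix.adjugate_mul]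
        simp [Matrix.one_apply, Finset.mul_sum, mul_comm]

/-- Top-degree forms are proportional. -/
lemma exists_eq_smul_of_top_degree {W : Type*} [AddCommGroup W] [Module ℝ W]
    {d : ℕ} (hd : Module.finrank ℝ W = d) [FiniteDimensional ℝ W]
    {τ : W [⋀^Fin d]→ₗ[ℝ] ℝ} (hτ : τ ≠ 0) (θ : W [⋀^Fin d]→ₗ[ℝ] ℝ) :
    ∃ c : ℝ, θ = c • τ := by
  let b := Module.finBasisOfFinrankEq ℝ W hd
  have h1 := τ.eq_smul_basis_det b
  have h2 := θ.eq_smul_basis_det b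
  have h3 : τ b ≠ 0 := fun h => hτ (by rw [h1, h, zero_smul])
  refine ⟨θ b / τ b, ?_⟩
  calc θ = θ b • b.det := h2
    _ = (θ b / τ b) • τ b • b.det := by rw [smul_smul, div_mul_cancel₀ _ h3]
    _ = (θ b / τ b) • τ := by rw [← h1]

lemma eq_of_smul_eq_smul_of_ne_zero {W : Type*} [AddCommGroup W] [Module ℝ W] {w : W}
    (hw : w ≠ 0) {a b : ℝ} (h : a • w = b • w) : a = b :=
  smul_left_injective ℝ hw h

lemma exists_apply_ne_zero {W : Type*} [AddCommGroup W] [Module ℝ W] {d : ℕ}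
    {τ : W [⋀^Fin d]→ₗ[ℝ] ℝ} (hτ : τ ≠ 0) : ∃ v, τ v ≠ 0 := by
  by_contra! h
  exact hτ (AlternatingMap.ext h)

/-- A family of vectors dual to `d` covectors on a `d`-dimensional space is a basis. -/
lemma eq_sum_of_dual {W : Type*} [AddCommGroup W] [Module ℝ W] {d : ℕ}
    (hd : Module.finrank ℝ W = d) [FiniteDimensional ℝ W] {α : Fin d → W →ₗ[ℝ] ℝ} {e : Fin d → W}
    (h : ∀ i k, α i (e k) = if i = k then 1 else 0) (v : W) : v = ∑ k, α k v • e k := by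
  have hli : LinearIndependent ℝ e := by
    rw [Fintype.linearIndependent_iff]
    intro g hg i
    have := congrArg (α i) hg
    simpa [h] using this
  let b := basisOfLinearIndependentOfCardEqFinrank' e hli (by simp [hd])
  have hb : ∀ k, b k = e k := fun k => by simp [b]
  have h2 : ∀ i, α i v = b.repr v i := by
    intro i
    conv_lhs => rw [← b.sum_repr v]
    simp [hb, h]
  conv_lhs => rw [← b.sum_repr v]
  simp [h2, hb]

end LinearAlgebra

/-! ### Top-degree forms, their Lie derivatives, and densities. -/

section Forms

variable {V : Type*} [NormedAddCommGroup V] [NormedSpace ℝ V] [FiniteDimensional ℝ V]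
  {H : Type*} [TopologicalSpace H]
  {I : ModelWithCorners ℝ V H} {N : Type*} [TopologicalSpace N] [ChartedSpace H N]
  [IsManifold I ∞ N] {d : ℕ}

instance finiteDimensional_tangentSpace (p : N) : FiniteDimensional ℝ (TangentSpace I p) :=
  inferInstanceAs (FiniteDimensional ℝ V)

lemma finrank_tangentSpace (hd : Module.finrank ℝ V = d) (p : N) :
    Module.finrank ℝ (TangentSpace I p) = d := hd

variable (I) in
/-- The form `df₁ ∧ … ∧ df_d`. -/
def wedgeDiff (f : Fin d → N → ℝ) (q : N) : TangentSpace I q [⋀^Fin d]→ₗ[ℝ] ℝ :=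
  Matrix.detRowAlternating.compLinearMap
    (LinearMap.pi fun i => (differential I (f i) q).toLinearMap)

lemma wedgeDiff_apply (f : Fin d → N → ℝ) (q : N) (v : Fin d → TangentSpace I q) :
    wedgeDiff I f q v = (Matrix.of fun j i => dirDeriv I (f i) q (v j)).det := rfl

lemma wedgeDiff_apply_dual {f : Fin d → N → ℝ} {q : N} {e : Fin d → TangentSpace I q}
    (h : ∀ i k, dirDeriv I (f i) q (e k) = if i = k then 1 else 0) : wedgeDiff I f q e = 1 := by
  rw [wedgeDiff_apply, ← Matrix.det_one (n := Fin d)]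
  congr 1
  ext j i
  simp [h, Matrix.one_apply, eq_comm]

/-- If the form is nonzero on `v`, the matrix of the derivatives of the `fᵢ` along the `vⱼ` is
invertible, and its inverse recombines `v` into a dual basis. -/
lemma exists_dual_of_wedgeDiff_ne_zero {f : Fin d → N → ℝ} {q : N} (h : wedgeDiff I f q ≠ 0) :
    ∃ e : Fin d → TangentSpace I q,
      ∀ i k, dirDeriv I (f i) q (e k) = if i = k then 1 else 0 := by
  obtain ⟨v, hv⟩ := exists_apply_ne_zero h
  rw [wedgeDiff_apply] at hv
  set A : Matrix (Fin d) (Fin d) ℝ := Matrix.of fun j i => dirDeriv I (f i) q (v j) with hA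
  refine ⟨fun k => ∑ j, A⁻¹ k j • v j, fun i k => ?_⟩
  rw [dirDeriv_vec_sum]
  simp_rw [dirDeriv_vec_smul]
  have := congrFun (congrFun (Matrix.nonsing_inv_mul A (isUnit_iff_ne_zero.mpr hv)) k) i
  rw [Matrix.mul_apply, Matrix.one_apply] at this
  rw [show (if i = k then (1 : ℝ) else 0) = if k = i then 1 else 0 by simp [eq_comm], ← this]
  rfl

lemma vec_eq_sum_dual (hd : Module.finrank ℝ V = d) {f : Fin d → N → ℝ} {q : N}
    {e : Fin d → TangentSpace I q}
    (h : ∀ i k, dirDeriv I (f i) q (e k) = if i = k then 1 else 0) (v : TangentSpace I q) :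
    v = ∑ k, dirDeriv I (f k) q v • e k :=
  eq_sum_of_dual (finrank_tangentSpace (I := I) hd q)
    (α := fun i => (differential I (f i) q).toLinearMap) h v

lemma dirDeriv_eq_sum_dual (hd : Module.finrank ℝ V = d) {f : Fin d → N → ℝ} {q : N}
    {e : Fin d → TangentSpace I q}
    (h : ∀ i k, dirDeriv I (f i) q (e k) = if i = k then 1 else 0) (g : N → ℝ)
    (v : TangentSpace I q) :
    dirDeriv I g q v = ∑ k, dirDeriv I g q (e k) * dirDeriv I (f k) q v := by
  conv_lhs => rw [vec_eq_sum_dual hd h v, dirDeriv_vec_sum]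
  simp_rw [dirDeriv_vec_smul, mul_comm]

lemma contMDiffAt_wedgeDiff {f : Fin d → N → ℝ} {p : N}
    (hf : ∀ i, ContMDiffAt I 𝓘(ℝ, ℝ) ∞ (f i) p) {v : Fin d → ∀ q : N, TangentSpace I q}
    (hv : ∀ i, SmoothFieldAt I (v i) p) :
    ContMDiffAt I 𝓘(ℝ, ℝ) ∞ (fun q => wedgeDiff I f q fun i => v i q) p := by
  simp_rw [wedgeDiff_apply]
  exact contMDiffAt_det fun j i => contMDiffAt_dirDeriv (hf i) (hv j)

lemma smoothFormOn_smul_wedgeDiff {f : Fin d → N → ℝ} {h : N → ℝ} {U : Set N}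
    (hf : ∀ i, ∀ p ∈ U, ContMDiffAt I 𝓘(ℝ, ℝ) ∞ (f i) p)
    (hh : ∀ p ∈ U, ContMDiffAt I 𝓘(ℝ, ℝ) ∞ h p) :
    SmoothFormOn I (fun q => h q • wedgeDiff I f q) U := fun p hp _ hv =>
  (hh p hp).mul (contMDiffAt_wedgeDiff (fun i => hf i p hp) hv)

/-- A smooth top-degree form is a smooth multiple of `df₁ ∧ … ∧ df_d`, where the latter does not
vanish. -/
lemma exists_eq_smul_wedgeDiff (hd : Module.finrank ℝ V = d) {f : Fin d → N → ℝ} {U : Set N}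
    (hU : IsOpen U) (hf : ∀ i, ∀ p ∈ U, ContMDiffAt I 𝓘(ℝ, ℝ) ∞ (f i) p)
    (hf0 : ∀ p ∈ U, wedgeDiff I f p ≠ 0)
    {θ : ∀ p : N, TangentSpace I p [⋀^Fin d]→ₗ[ℝ] ℝ} (hθ : SmoothFormOn I θ U) :
    ∃ h : N → ℝ, (∀ p ∈ U, ContMDiffAt I 𝓘(ℝ, ℝ) ∞ h p) ∧
      ∀ p ∈ U, θ p = h p • wedgeDiff I f p := by
  have h1 (p : N) : ∃ c : ℝ, p ∈ U → θ p = c • wedgeDiff I f p := by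
    by_cases hp : p ∈ U
    · obtain ⟨c, hc⟩ := exists_eq_smul_of_top_degree (finrank_tangentSpace (I := I) hd p)
        (hf0 p hp) (θ p)
      exact ⟨c, fun _ => hc⟩
    · exact ⟨0, fun h => absurd h hp⟩
  choose h hh using h1
  refine ⟨h, fun p hp => ?_, hh⟩
  obtain ⟨v, hv⟩ := exists_apply_ne_zero (hf0 p hp)
  -- The coefficient `h` was chosen point by point. It is smooth because near `p` it is the quotient
  -- of the values of both forms on fixed smooth fields.
  let v' : Fin d → ∀ q : N, TangentSpace I q := fun i => FiberBundle.extend V (v i)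
  have hv' : ∀ i, SmoothFieldAt I (v' i) p := fun i => smoothFieldAt_extend (v i)
  have hw := contMDiffAt_wedgeDiff (fun i => hf i p hp) hv'
  have hwp : (fun q => wedgeDiff I f q fun i => v' i q) p ≠ 0 := by simpa [v'] using hv
  refine ((hθ p hp v' hv').div₀ hw hwp).congr_of_eventuallyEq ?_
  filter_upwards [hU.mem_nhds hp, hw.continuousAt.eventually_ne hwp] with q hq hq0
  simp [Pi.div_apply, hh q hq, hq0]

/-- The Lie derivative of `h df₁ ∧ … ∧ df_d`. -/
lemma hasLieDerivAt_of_eq_smul_wedgeDiff {X : ∀ q : N, TangentSpace I q} {p : N}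
    (hX : SmoothFieldAt I X p) {f : Fin d → N → ℝ}
    (hf : ∀ i, ContMDiffAt I 𝓘(ℝ, ℝ) ∞ (f i) p) {h : N → ℝ}
    (hh : MDifferentiableAt I 𝓘(ℝ, ℝ) h p)
    {θ : ∀ q : N, TangentSpace I q [⋀^Fin d]→ₗ[ℝ] ℝ}
    (hθ : ∀ᶠ q in 𝓝 p, θ q = h q • wedgeDiff I f q) {A : Matrix (Fin d) (Fin d) ℝ}
    (hA : ∀ i v, dirDeriv I (fun q => dirDeriv I (f i) q (X q)) p v
      = ∑ k, A i k * dirDeriv I (f k) p v) :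
    HasLieDerivAt I X θ p ((dirDeriv I h p (X p) + h p * ∑ i, A i i) • wedgeDiff I f p) := by
  intro v hv
  let M : Fin d → Fin d → N → ℝ := fun j i q => dirDeriv I (f i) q (v j q)
  have hM : ∀ j i, MDifferentiableAt I 𝓘(ℝ, ℝ) (M j i) p := fun j i =>
    (contMDiffAt_dirDeriv (hf i) (hv j)).mdifferentiableAt (by simp)
  have hw : MDifferentiableAt I 𝓘(ℝ, ℝ) (fun q => (Matrix.of fun j i => M j i q).det) p :=
    (contMDiffAt_wedgeDiff hf hv).mdifferentiableAt (by simp)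
  have h1 : dirDeriv I (fun q => θ q fun i => v i q) p (X p)
      = h p * (∑ j, ((Matrix.of fun j i => M j i p).updateRow j
          fun i => dirDeriv I (M j i) p (X p)).det)
        + (Matrix.of fun j i => M j i p).det * dirDeriv I h p (X p) := by
    rw [← dirDeriv_det hM, ← dirDeriv_mul hh hw]
    apply dirDeriv_congr
    filter_upwards [hθ] with q hq
    rw [hq]
    rfl
  -- By `[X, v](f) = X(v(f)) - v(X(f))`, the first term cancels against the differentiated row of
  -- the determinant. The second contributes the rows built from `A`, the Jacobian of `X` in the
  -- functions `f`, and these sum to its trace.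
  have h2 (j : Fin d) :
      θ p (Function.update (fun j => v j p) j (mlieBracket I X (v j) p))
        = h p * ((Matrix.of fun j i => M j i p).updateRow j
            fun i => dirDeriv I (M j i) p (X p)).det
          - h p * ((Matrix.of fun j i => M j i p).updateRow j
            fun i => ∑ k, A i k * M j k p).det := by
    rw [hθ.self_of_nhds, AlternatingMap.smul_apply, wedgeDiff_apply, smul_eq_mul]
    have h3 : (Matrix.of fun k i => dirDeriv I (f i) p
          (Function.update (fun j => v j p) j (mlieBracket I X (v j) p) k))
        = (Matrix.of fun j i => M j i p).updateRow j
          ((fun i => dirDeriv I (M j i) p (X p)) + (-1 : ℝ) • fun i => ∑ k, A i k * M j k p) := by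
      ext k i
      rcases eq_or_ne k j with rfl | hk
      · simp only [Matrix.of_apply, Function.update_self, Matrix.updateRow_self, Pi.add_apply,
          Pi.smul_apply, smul_eq_mul]
        rw [dirDeriv_mlieBracket (hf i) hX (hv k), hA]
        simp only [M]
        ring
      · simp [hk, M, Matrix.updateRow_ne]
    rw [h3, Matrix.det_updateRow_add, Matrix.det_updateRow_smul]
    ring
  have h4 := sum_det_updateRow_mulVec A (Matrix.of fun j i => M j i p)
  simp only [Matrix.of_apply] at h4
  rw [h1, Finset.sum_congr rfl fun j _ => h2 j, Finset.sum_sub_distrib, ← Finset.mul_sum,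
    ← Finset.mul_sum, h4, AlternatingMap.smul_apply, wedgeDiff_apply, smul_eq_mul]
  simp only [M]
  ring

/-- Every tangent vector extends to a smooth field, so the defining formula fixes all values.
Coefficients are compared below by computing one Lie derivative in two ways. -/
lemma HasLieDerivAt.unique {X : ∀ q : N, TangentSpace I q} {p : N}
    {θ : ∀ q : N, TangentSpace I q [⋀^Fin d]→ₗ[ℝ] ℝ}
    {ν ν' : TangentSpace I p [⋀^Fin d]→ₗ[ℝ] ℝ} (h : HasLieDerivAt I X θ p ν)
    (h' : HasLieDerivAt I X θ p ν') : ν = ν' := by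
  ext v
  have hv : ∀ i, SmoothFieldAt I (FiberBundle.extend V (v i)) p := fun i =>
    smoothFieldAt_extend (v i)
  simpa using (h _ hv).trans (h' _ hv).symm

lemma HasLieDerivAt.const_smul {X : ∀ q : N, TangentSpace I q} {p : N}
    {θ θ' : ∀ q : N, TangentSpace I q [⋀^Fin d]→ₗ[ℝ] ℝ} {c : ℝ} {U : Set N} (hp : p ∈ U)
    (hθ : SmoothFormOn I θ U) (hc : ∀ᶠ q in 𝓝 p, θ' q = c • θ q)
    {ν : TangentSpace I p [⋀^Fin d]→ₗ[ℝ] ℝ} (h : HasLieDerivAt I X θ p ν) :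
    HasLieDerivAt I X θ' p (c • ν) := by
  intro v hv
  have h1 : dirDeriv I (fun q => θ' q fun i => v i q) p (X p)
      = c * dirDeriv I (fun q => θ q fun i => v i q) p (X p) := by
    rw [← dirDeriv_const_mul c ((hθ p hp v hv).mdifferentiableAt (by simp))]
    apply dirDeriv_congr
    filter_upwards [hc] with q hq
    rw [hq]
    rfl
  rw [h1, hc.self_of_nhds]
  simp only [AlternatingMap.smul_apply, smul_eq_mul, h v hv, ← Finset.mul_sum, mul_sub]

/-- Two smooth forms which represent the same density agree locally up to a constant sign. -/
lemma eventually_eq_sign_smul {θ θ' : ∀ q : N, TangentSpace I q [⋀^Fin d]→ₗ[ℝ] ℝ} {p : N}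
    {U U' : Set N} (hp : p ∈ U) (hp' : p ∈ U')
    (hθ : SmoothFormOn I θ U) (hθ' : SmoothFormOn I θ' U') (h0 : θ p ≠ 0)
    (h : ∀ᶠ q in 𝓝 p, toAbs (θ' q) = toAbs (θ q)) :
    ∃ c : ℝ, c ≠ 0 ∧ ∀ᶠ q in 𝓝 p, θ' q = c • θ q := by
  obtain ⟨v, hv⟩ := exists_apply_ne_zero h0
  let v' : Fin d → ∀ q : N, TangentSpace I q := fun i => FiberBundle.extend V (v i)
  have hv' : ∀ i, SmoothFieldAt I (v' i) p := fun i => smoothFieldAt_extend (v i)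
  have k1 := (hθ p hp v' hv').continuousAt
  have k2 := (hθ' p hp' v' hv').continuousAt
  have hvp : (fun i => v' i p) = v := by funext i; simp [v']
  rcases toAbs_eq_iff.mp h.self_of_nhds with h1 | h1
  · refine ⟨1, one_ne_zero, ?_⟩
    -- If the forms agree at `p`, their sum does not vanish on `v'` at `p`, nor nearby by
    -- continuity, which rules out the opposite sign. The other case uses the difference.
    have h2 : (fun q => θ' q (fun i => v' i q) + θ q fun i => v' i q) p ≠ 0 := by
      simp only [hvp, h1]
      intro h; apply hv; linarith
    filter_upwards [h, (k2.add k1).eventually_ne h2] with q hq hq2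
    rcases toAbs_eq_iff.mp hq with h3 | h3
    · rw [h3, one_smul]
    · exact absurd (by simp [h3]) hq2
  · refine ⟨-1, by simp, ?_⟩
    have h2 : (fun q => θ' q (fun i => v' i q) - θ q fun i => v' i q) p ≠ 0 := by
      simp only [hvp, h1, AlternatingMap.neg_apply]
      intro h; apply hv; linarith
    filter_upwards [h, (k2.sub k1).eventually_ne h2] with q hq hq2
    rcases toAbs_eq_iff.mp hq with h3 | h3
    · exact absurd (by simp [h3]) hq2
    · rw [h3]; module

/-- It suffices to check `ℒ_X Ω = c Ω` near each point for one local form representing `Ω`. -/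
lemma Density.lieEq_of_local {Ω : Density I N d} {X : ∀ q : N, TangentSpace I q} {c : ℝ}
    (h : ∀ p, ∃ (U : Set N) (θ : ∀ q : N, TangentSpace I q [⋀^Fin d]→ₗ[ℝ] ℝ), IsOpen U ∧ p ∈ U ∧
      SmoothFormOn I θ U ∧ (∀ q ∈ U, toAbs (θ q) = Ω.val q) ∧
        HasLieDerivAt I X θ p (c • θ p)) : Ω.LieEq X c := by
  intro U' θ' hU' hθ' hΩ' p hp'
  obtain ⟨U, θ, hU, hp, hθ, hΩ, hL⟩ := h p
  have h0 : θ p ≠ 0 := fun h0 => Ω.ne_zero p (by rw [← hΩ p hp, h0])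
  have hev : ∀ᶠ q in 𝓝 p, toAbs (θ' q) = toAbs (θ q) := by
    filter_upwards [hU.mem_nhds hp, hU'.mem_nhds hp'] with q h1 h2
    rw [hΩ q h1, hΩ' q h2]
  obtain ⟨e, -, he⟩ := eventually_eq_sign_smul hp hp' hθ hθ' h0 hev
  have := hL.const_smul hp hθ he
  rwa [smul_comm, ← he.self_of_nhds] at this

end Forms

/-! ### Basic and linear functions, vertical vectors and fibres of the dual bundle. -/

section DualBundle

variable {m n : ℕ} {M : Type*} [TopologicalSpace M] [ChartedSpace (EuclideanSpace ℝ (Fin m)) M]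
  {E : M → Type*} [∀ x, AddCommGroup (E x)] [∀ x, Module ℝ (E x)]
  [TopologicalSpace (TotalSpace (Fib n) E)] [∀ x, TopologicalSpace (E x)]
  [FiberBundle (Fib n) E] [VectorBundle ℝ (Fib n) E]
  [IsManifold (𝓡 m) ∞ M] [ContMDiffVectorBundle ∞ (Fib n) E (𝓡 m)]

lemma contMDiff_dualProj :
    ContMDiff (dualModel m n) (𝓡 m) ∞ (fun p : DualTotal n E => p.1) :=
  Bundle.contMDiff_proj (DualBundle E)

lemma contMDiffAt_basic {f : M → ℝ} {p : DualTotal n E}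
    (hf : ContMDiffAt (𝓡 m) 𝓘(ℝ, ℝ) ∞ f p.1) :
    ContMDiffAt (dualModel m n) 𝓘(ℝ, ℝ) ∞ (basic n f) p :=
  ContMDiffAt.comp p hf contMDiff_dualProj.contMDiffAt

lemma contMDiffAt_of_trivial {B : Type*} {V : Type*} [NormedAddCommGroup V] [NormedSpace ℝ V]
    {H : Type*} [TopologicalSpace H] {I : ModelWithCorners ℝ V H} [TopologicalSpace B]
    [ChartedSpace H B] {b : B → M} {f : B → ℝ} {p : B}
    (h : ContMDiffAt I ((𝓡 m).prod 𝓘(ℝ, ℝ)) ∞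
      (fun q => TotalSpace.mk' ℝ (E := Bundle.Trivial M ℝ) (b q) (f q)) p) :
    ContMDiffAt I 𝓘(ℝ, ℝ) ∞ f p :=
  (contMDiffAt_totalSpace.mp h).2

lemma contMDiffAt_iota {X : ∀ x, E x} {p : DualTotal n E} (hX : SmoothSectionAt m n X p.1) :
    ContMDiffAt (dualModel m n) 𝓘(ℝ, ℝ) ∞ (iota n X) p := by
  have h1 : ContMDiffAt (dualModel m n) ((𝓡 m).prod 𝓘(ℝ, Fib n)) ∞
      (fun q : DualTotal n E => TotalSpace.mk' (Fib n) q.1 (X q.1)) p :=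
    ContMDiffAt.comp p hX contMDiff_dualProj.contMDiffAt
  have h2 : ContMDiffAt (dualModel m n) (dualModel m n) ∞
      (fun q : DualTotal n E => TotalSpace.mk' (DualFib n) (E := DualBundle E) q.1 q.2) p :=
    contMDiffAt_id
  exact contMDiffAt_of_trivial (h2.clm_bundle_apply h1)

/-! #### Tangent vectors -/

/-- The projection of a tangent vector of `E*` to `M`. -/
def projT (p : DualTotal n E) (v : TangentSpace (dualModel m n) p) : TangentSpace (𝓡 m) p.1 :=
  mfderiv (dualModel m n) (𝓡 m) (fun q : DualTotal n E => q.1) p v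

lemma dirDeriv_basic {f : M → ℝ} {p : DualTotal n E}
    (hf : MDifferentiableAt (𝓡 m) 𝓘(ℝ, ℝ) f p.1) (v : TangentSpace (dualModel m n) p) :
    dirDeriv (dualModel m n) (basic n f) p v = dirDeriv (𝓡 m) f p.1 (projT p v) :=
  mfderiv_comp_apply (I' := 𝓡 m) p hf
    (contMDiff_dualProj.contMDiffAt.mdifferentiableAt (by simp)) v

lemma contMDiff_fibreLine (x : M) (ξ η : DualBundle E x) :
    ContMDiff 𝓘(ℝ, ℝ) (dualModel m n) ∞
      (fun t : ℝ => (⟨x, ξ + t • η⟩ : DualTotal n E)) := by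
  intro t
  rw [contMDiffAt_totalSpace]
  refine ⟨contMDiffAt_const, ?_⟩
  let e := trivializationAt (DualFib n) (DualBundle E) x
  have hx : x ∈ e.baseSet := FiberBundle.mem_baseSet_trivializationAt' x
  have h (t : ℝ) : (e ⟨x, ξ + t • η⟩).2
      = e.linearEquivAt ℝ x hx ξ + t • e.linearEquivAt ℝ x hx η := by
    rw [← map_smul, ← map_add]
    rfl
  change ContMDiffAt 𝓘(ℝ, ℝ) 𝓘(ℝ, DualFib n) ∞ (fun t : ℝ => (e ⟨x, ξ + t • η⟩).2) t
  simp_rw [h]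
  exact (contMDiff_const.add (contMDiff_id.smul contMDiff_const)).contMDiffAt

/-- The vertical lift of `η` to a tangent vector of `E*` at `p`. -/
def vlift (p : DualTotal n E) (η : DualBundle E p.1) : TangentSpace (dualModel m n) p :=
  mfderiv 𝓘(ℝ, ℝ) (dualModel m n) (fun t : ℝ => (⟨p.1, p.2 + t • η⟩ : DualTotal n E)) 0 (1 : ℝ)

lemma dirDeriv_vlift {F : DualTotal n E → ℝ} {p : DualTotal n E}
    (hF : MDifferentiableAt (dualModel m n) 𝓘(ℝ, ℝ) F p) (η : DualBundle E p.1) :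
    dirDeriv (dualModel m n) F p (vlift p η)
      = deriv (fun t : ℝ => F ⟨p.1, p.2 + t • η⟩) 0 := by
  have h := mfderiv_comp_apply_of_eq (I := 𝓘(ℝ, ℝ)) (I' := dualModel m n) (I'' := 𝓘(ℝ, ℝ))
    (f := fun t : ℝ => (⟨p.1, p.2 + t • η⟩ : DualTotal n E)) (x := (0 : ℝ)) (y := p) (g := F) hF
    ((contMDiff_fibreLine p.1 p.2 η).contMDiffAt.mdifferentiableAt (by simp)) (by simp) (1 : ℝ)
  rw [mfderiv_eq_fderiv] at h
  exact h.symm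

lemma dirDeriv_eulerField {F : DualTotal n E → ℝ} {p : DualTotal n E}
    (hF : MDifferentiableAt (dualModel m n) 𝓘(ℝ, ℝ) F p) :
    dirDeriv (dualModel m n) F p (eulerField m n E p)
      = deriv (fun t : ℝ => F ⟨p.1, t • p.2⟩) 1 := by
  have h0 := contMDiff_fibreLine (m := m) (n := n) p.1 0 p.2
  simp only [zero_add] at h0
  have h := mfderiv_comp_apply_of_eq (I := 𝓘(ℝ, ℝ)) (I' := dualModel m n) (I'' := 𝓘(ℝ, ℝ))
    (f := fun t : ℝ => (⟨p.1, t • p.2⟩ : DualTotal n E)) (x := (1 : ℝ)) (y := p) (g := F) hF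
    (h0.contMDiffAt.mdifferentiableAt (by simp)) (by simp) (1 : ℝ)
  rw [mfderiv_eq_fderiv] at h
  exact h.symm

lemma dirDeriv_vlift_iota {Y : ∀ x, E x} {p : DualTotal n E} (hY : SmoothSectionAt m n Y p.1)
    (η : DualBundle E p.1) :
    dirDeriv (dualModel m n) (iota n Y) p (vlift p η) = η (Y p.1) := by
  rw [dirDeriv_vlift ((contMDiffAt_iota hY).mdifferentiableAt (by simp))]
  have h : HasDerivAt (fun t : ℝ => (p.2 (Y p.1) : ℝ) + t * (η (Y p.1) : ℝ))
      (1 * (η (Y p.1) : ℝ)) 0 := ((hasDerivAt_id 0).mul_const _).const_add _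
  rw [one_mul] at h
  exact h.deriv

lemma dirDeriv_vlift_of_isLinearMap {F : DualTotal n E → ℝ} {p : DualTotal n E}
    (hF : MDifferentiableAt (dualModel m n) 𝓘(ℝ, ℝ) F p)
    (hl : IsLinearMap ℝ fun ξ : DualBundle E p.1 => F ⟨p.1, ξ⟩) (η : DualBundle E p.1) :
    dirDeriv (dualModel m n) F p (vlift p η) = F ⟨p.1, η⟩ := by
  rw [dirDeriv_vlift hF]
  have h : HasDerivAt (fun t : ℝ => F p + t * F ⟨p.1, η⟩) (1 * F ⟨p.1, η⟩) 0 :=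
    ((hasDerivAt_id 0).mul_const _).const_add _
  rw [one_mul] at h
  have h2 : (fun t : ℝ => F ⟨p.1, p.2 + t • η⟩) = fun t : ℝ => F p + t * F ⟨p.1, η⟩ := by
    funext t
    rw [hl.map_add, hl.map_smul, smul_eq_mul]
  rw [h2, h.deriv]

lemma dirDeriv_vlift_of_const {F : DualTotal n E → ℝ} {p : DualTotal n E}
    (hF : MDifferentiableAt (dualModel m n) 𝓘(ℝ, ℝ) F p)
    (hc : ∀ ξ : DualBundle E p.1, F ⟨p.1, ξ⟩ = F p) (η : DualBundle E p.1) :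
    dirDeriv (dualModel m n) F p (vlift p η) = 0 := by
  rw [dirDeriv_vlift hF]
  simp_rw [hc]
  exact deriv_const _ _

lemma projT_vlift (p : DualTotal n E) (η : DualBundle E p.1) :
    projT (m := m) p (vlift p η) = 0 := by
  have h := mfderiv_comp_apply_of_eq (I := 𝓘(ℝ, ℝ)) (I' := dualModel m n) (I'' := 𝓡 m)
    (f := fun t : ℝ => (⟨p.1, p.2 + t • η⟩ : DualTotal n E)) (x := (0 : ℝ)) (y := p)
    (g := fun q : DualTotal n E => q.1) (contMDiff_dualProj.contMDiffAt.mdifferentiableAt (by simp))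
    ((contMDiff_fibreLine p.1 p.2 η).contMDiffAt.mdifferentiableAt (by simp)) (by simp) (1 : ℝ)
  have h2 : mfderiv 𝓘(ℝ, ℝ) (𝓡 m) ((fun q : DualTotal n E => q.1) ∘
      fun t : ℝ => (⟨p.1, p.2 + t • η⟩ : DualTotal n E)) 0 = 0 := mfderiv_const
  rw [h2] at h
  exact h.symm

/-- Every tangent vector of `M` lifts to a tangent vector of `E*`. -/
lemma exists_projT_eq (p : DualTotal n E) (u : TangentSpace (𝓡 m) p.1) :
    ∃ w : TangentSpace (dualModel m n) p, projT p w = u := by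
  have hs : ContMDiffAt (𝓡 m) (dualModel m n) ∞ (fun y => TotalSpace.mk' (DualFib n) y
      (FiberBundle.extend (DualFib n) p.2 y)) p.1 :=
    FiberBundle.contMDiffAt_extend (𝓡 m) (DualFib n) p.2
  have hp : TotalSpace.mk' (DualFib n) p.1 (FiberBundle.extend (DualFib n) p.2 p.1) = p := by simp
  have h := mfderiv_comp_apply_of_eq (I := 𝓡 m) (I' := dualModel m n) (I'' := 𝓡 m)
    (f := fun y => TotalSpace.mk' (DualFib n) y (FiberBundle.extend (DualFib n) p.2 y))
    (x := p.1) (y := p) (g := fun q : DualTotal n E => q.1)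
    (contMDiff_dualProj.contMDiffAt.mdifferentiableAt (by simp))
    (hs.mdifferentiableAt (by simp)) hp u
  have h2 : mfderiv (𝓡 m) (𝓡 m) ((fun q : DualTotal n E => q.1) ∘
      fun y => TotalSpace.mk' (DualFib n) y (FiberBundle.extend (DualFib n) p.2 y)) p.1
        = ContinuousLinearMap.id ℝ _ := mfderiv_id
  rw [h2] at h
  exact ⟨_, h.symm⟩

/-! #### Linear algebra of the fibres -/

/-- A linear identification of the fibre of `E` with the typical fibre. -/
def fibreEquiv (x : M) : E x ≃L[ℝ] Fib n :=
  (trivializationAt (Fib n) E x).continuousLinearEquivAt ℝ x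
    (FiberBundle.mem_baseSet_trivializationAt' x)

lemma finiteDimensional_fibre (n : ℕ) [TopologicalSpace (TotalSpace (Fib n) E)]
    [FiberBundle (Fib n) E] [VectorBundle ℝ (Fib n) E] (x : M) : FiniteDimensional ℝ (E x) :=
  (fibreEquiv (n := n) x).symm.toLinearEquiv.finiteDimensional

lemma finrank_fibre (n : ℕ) [TopologicalSpace (TotalSpace (Fib n) E)]
    [FiberBundle (Fib n) E] [VectorBundle ℝ (Fib n) E] (x : M) : Module.finrank ℝ (E x) = n := by
  rw [(fibreEquiv (n := n) (E := E) x).toLinearEquiv.finrank_eq]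
  simp

lemma exists_dual_eq (n : ℕ) [TopologicalSpace (TotalSpace (Fib n) E)]
    [FiberBundle (Fib n) E] [VectorBundle ℝ (Fib n) E] {x : M} (l : E x →ₗ[ℝ] ℝ) :
    ∃ ξ : DualBundle E x, ∀ v, ξ v = l v := by
  let e := fibreEquiv (n := n) (E := E) x
  let l' : Fib n →L[ℝ] ℝ := (l ∘ₗ e.symm.toLinearEquiv.toLinearMap).toContinuousLinearMap
  refine ⟨l'.comp (e : E x →L[ℝ] Fib n), fun v => ?_⟩
  simp [l']

/-- Covectors separate the points of a fibre. -/
lemma eq_of_forall_dual (n : ℕ) [TopologicalSpace (TotalSpace (Fib n) E)]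
    [FiberBundle (Fib n) E] [VectorBundle ℝ (Fib n) E] {x : M} {v w : E x}
    (h : ∀ ξ : DualBundle E x, ξ v = ξ w) : v = w := by
  have := finiteDimensional_fibre n (E := E) x
  rw [← sub_eq_zero, ← Module.forall_dual_apply_eq_zero_iff ℝ]
  intro l
  obtain ⟨ξ, hξ⟩ := exists_dual_eq n l
  rw [map_sub, ← hξ, ← hξ, h, sub_self]

/-- Linear functions on the dual fibre are evaluations. -/
lemma exists_fibre_eq {x : M} {F : DualBundle E x → ℝ} (hF : IsLinearMap ℝ F)
    {Y : Fin n → E x} {η : Fin n → DualBundle E x}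
    (hη : ∀ ξ : DualBundle E x, ξ = ∑ i, (ξ (Y i) : ℝ) • η i) :
    ∃ w : E x, ∀ ξ : DualBundle E x, ξ w = F ξ := by
  refine ⟨∑ i, F (η i) • Y i, fun ξ => ?_⟩
  have h1 : F ξ = hF.mk' F ξ := rfl
  conv_rhs => rw [h1, hη ξ, map_sum]
  rw [map_sum]
  refine Finset.sum_congr rfl fun i _ => ?_
  rw [map_smul, map_smul]
  exact mul_comm _ _

/-- The rank of `E` is `n`, so `Y` is a basis of the fibre and `η` consists of its coordinate
functionals, made continuous by `exists_dual_eq`. -/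
lemma exists_dual_frame {x : M} {Y : Fin n → E x} (hY : LinearIndependent ℝ Y) :
    ∃ η : Fin n → DualBundle E x, (∀ i j, (η i (Y j) : ℝ) = if i = j then 1 else 0) ∧
      (∀ v : E x, v = ∑ i, (η i v : ℝ) • Y i) ∧
        ∀ ξ : DualBundle E x, ξ = ∑ i, (ξ (Y i) : ℝ) • η i := by
  have := finiteDimensional_fibre n (E := E) x
  let b := basisOfLinearIndependentOfCardEqFinrank' Y hY (by simp [finrank_fibre n])
  have hb : ∀ k, b k = Y k := fun k => by simp [b]
  choose η hη using fun i => exists_dual_eq n (b.coord i)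
  have h2 : ∀ v : E x, v = ∑ i, (η i v : ℝ) • Y i := by
    intro v
    conv_lhs => rw [← b.sum_repr v]
    refine Finset.sum_congr rfl fun i _ => ?_
    rw [hη, hb]
    rfl
  refine ⟨η, fun i j => ?_, h2, fun ξ => ?_⟩
  · rw [hη, ← hb, b.coord_apply, b.repr_self, Finsupp.single_apply]
    simp [eq_comm]
  · ext v
    conv_lhs => rw [h2 v, map_sum]
    rw [sum_apply]
    refine Finset.sum_congr rfl fun i _ => ?_
    rw [map_smul]
    exact mul_comm _ _

end DualBundle

lemma finrank_dualModel (m n : ℕ) :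
    Module.finrank ℝ (EuclideanSpace ℝ (Fin m) × DualFib n) = m + n := by
  have e : DualFib n ≃ₗ[ℝ] Fib n →ₗ[ℝ] ℝ := LinearMap.toContinuousLinearMap.symm
  rw [Module.finrank_prod, e.finrank_eq, Module.finrank_linearMap]
  simp

/-! ### Adapted coordinates on the dual bundle. -/

section Adapted

variable {m n : ℕ} {M : Type*} [TopologicalSpace M] [ChartedSpace (EuclideanSpace ℝ (Fin m)) M]
  {E : M → Type*} [∀ x, AddCommGroup (E x)] [∀ x, Module ℝ (E x)]
  [TopologicalSpace (TotalSpace (Fib n) E)] [∀ x, TopologicalSpace (E x)]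
  [FiberBundle (Fib n) E] [VectorBundle ℝ (Fib n) E]
  [IsManifold (𝓡 m) ∞ M] [ContMDiffVectorBundle ∞ (Fib n) E (𝓡 m)]

/-- Coordinate functions `x` on the open set `U ⊆ M` together with a frame `Y` of `E` over `U`. -/
structure AdaptedFrame (U : Set M) (x : Fin m → M → ℝ) (Y : Fin n → ∀ y, E y) : Prop where
  isOpen : IsOpen U
  coord_smooth : ∀ b, ∀ y ∈ U, ContMDiffAt (𝓡 m) 𝓘(ℝ, ℝ) ∞ (x b) y
  coord_indep : ∀ y ∈ U, wedgeDiff (𝓡 m) x y ≠ 0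
  frame_smooth : ∀ i, ∀ y ∈ U, SmoothSectionAt m n (Y i) y
  frame_indep : ∀ y ∈ U, LinearIndependent ℝ fun i => Y i y

lemma exists_coordinates (x₀ : M) : ∃ (U : Set M) (x : Fin m → M → ℝ), IsOpen U ∧ x₀ ∈ U ∧
    (∀ b, ∀ y ∈ U, ContMDiffAt (𝓡 m) 𝓘(ℝ, ℝ) ∞ (x b) y) ∧
      ∀ y ∈ U, wedgeDiff (𝓡 m) x y ≠ 0 := by
  have hsm : ∀ y ∈ (extChartAt (𝓡 m) x₀).source,
      ContMDiffAt (𝓡 m) 𝓘(ℝ, EuclideanSpace ℝ (Fin m)) ∞ (extChartAt (𝓡 m) x₀) y :=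
    fun y hy => contMDiffAt_extChartAt' (by simpa using hy)
  let pr (b : Fin m) : EuclideanSpace ℝ (Fin m) →L[ℝ] ℝ := EuclideanSpace.proj b
  refine ⟨(extChartAt (𝓡 m) x₀).source, fun b y => pr b (extChartAt (𝓡 m) x₀ y),
    isOpen_extChartAt_source x₀, mem_extChartAt_source x₀, fun b y hy => ?_, fun y hy h0 => ?_⟩
  · exact (pr b).contMDiff.contMDiffAt.comp y (hsm y hy)
  -- The chart has invertible differential `Φ`, so the preimages of the standard basis vectors are
  -- dual to the differentials of the coordinates.
  · obtain ⟨Φ, hΦ⟩ := isInvertible_mfderiv_extChartAt (I := 𝓡 m) hy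
    have hd (b : Fin m) (v : TangentSpace (𝓡 m) y) :
        dirDeriv (𝓡 m) (fun y => pr b (extChartAt (𝓡 m) x₀ y)) y v = pr b (Φ v) := by
      have := mfderiv_comp_apply (I := 𝓡 m) (I' := 𝓘(ℝ, EuclideanSpace ℝ (Fin m)))
        (I'' := 𝓘(ℝ, ℝ)) y (g := pr b) (pr b).mdifferentiableAt
        ((hsm y hy).mdifferentiableAt (by simp)) v
      have h2 : mfderiv 𝓘(ℝ, EuclideanSpace ℝ (Fin m)) 𝓘(ℝ, ℝ) (pr b)
          (extChartAt (𝓡 m) x₀ y) = pr b := by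
        rw [mfderiv_eq_fderiv]
        exact (pr b).fderiv
      rw [h2, ← hΦ] at this
      exact this
    have := wedgeDiff_apply_dual (I := 𝓡 m) (q := y)
      (f := fun b y => pr b (extChartAt (𝓡 m) x₀ y))
      (e := fun b => Φ.symm (EuclideanSpace.single b (1 : ℝ))) (by
        intro i k
        refine (hd i _).trans ((congrArg (pr i) (Φ.apply_symm_apply _)).trans ?_)
        simp [pr])
    rw [h0] at this
    exact zero_ne_one this

variable (m n E) in
lemma exists_adaptedFrame (x₀ : M) : ∃ (U : Set M) (x : Fin m → M → ℝ) (Y : Fin n → ∀ y, E y),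
    AdaptedFrame U x Y ∧ x₀ ∈ U := by
  obtain ⟨U, x, hU, h0, hx, hx'⟩ := exists_coordinates (m := m) x₀
  let e := trivializationAt (Fib n) E x₀
  let b := (EuclideanSpace.basisFun (Fin n) ℝ).toBasis
  have he := e.isLocalFrameOn_localFrame_baseSet (𝓡 m) ∞ b
  exact ⟨U ∩ e.baseSet, x, e.localFrame b,
    ⟨hU.inter e.open_baseSet, fun b y hy => hx b y hy.1, fun y hy => hx' y hy.1,
      fun i y hy => he.contMDiffAt e.open_baseSet hy.2 i, fun y hy => he.linearIndependent hy.2⟩,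
    h0, FiberBundle.mem_baseSet_trivializationAt' x₀⟩

/-- The functions `π^* x^b` and `ι(Yᵢ)` on `E*`. -/
def adapted (x : Fin m → M → ℝ) (Y : Fin n → ∀ y, E y) : Fin (m + n) → DualTotal n E → ℝ :=
  Fin.append (fun b => basic n (x b)) fun i => iota n (Y i)

@[simp]
lemma adapted_castAdd (x : Fin m → M → ℝ) (Y : Fin n → ∀ y, E y) (b : Fin m) :
    adapted x Y (Fin.castAdd n b) = basic n (x b) := Fin.append_left _ _ _

@[simp]
lemma adapted_natAdd (x : Fin m → M → ℝ) (Y : Fin n → ∀ y, E y) (i : Fin n) :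
    adapted x Y (Fin.natAdd m i) = iota n (Y i) := Fin.append_right _ _ _

lemma AdaptedFrame.contMDiffAt_adapted {U : Set M} {x : Fin m → M → ℝ} {Y : Fin n → ∀ y, E y}
    (h : AdaptedFrame U x Y) {p : DualTotal n E} (hp : p.1 ∈ U) (k : Fin (m + n)) :
    ContMDiffAt (dualModel m n) 𝓘(ℝ, ℝ) ∞ (adapted x Y k) p := by
  refine Fin.addCases (fun b => ?_) (fun i => ?_) k
  · rw [adapted_castAdd]
    exact contMDiffAt_basic (h.coord_smooth b _ hp)
  · rw [adapted_natAdd]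
    exact contMDiffAt_iota (h.frame_smooth i _ hp)

/-- An arbitrary lift of `u` is corrected by vertical vectors until all `dι(Yᵢ)` vanish on it; this
leaves its projection unchanged. With the vertical lifts of `η`, such vectors form the basis dual to
the adapted differentials. -/
lemma exists_horizontal {p : DualTotal n E} {Y : Fin n → ∀ y, E y}
    (hY : ∀ i, SmoothSectionAt m n (Y i) p.1) {η : Fin n → DualBundle E p.1}
    (hη : ∀ i j, (η i (Y j p.1) : ℝ) = if i = j then 1 else 0) (u : TangentSpace (𝓡 m) p.1) :
    ∃ w : TangentSpace (dualModel m n) p, projT p w = u ∧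
      ∀ i, dirDeriv (dualModel m n) (iota n (Y i)) p w = 0 := by
  obtain ⟨w, hw⟩ := exists_projT_eq p u
  refine ⟨w + ∑ i, (-dirDeriv (dualModel m n) (iota n (Y i)) p w) • vlift p (η i), ?_, ?_⟩
  · have h1 := (mfderiv (dualModel m n) (𝓡 m) (fun q : DualTotal n E => q.1) p).map_add w
      (∑ i, (-dirDeriv (dualModel m n) (iota n (Y i)) p w) • vlift p (η i))
    have h2 : mfderiv (dualModel m n) (𝓡 m) (fun q : DualTotal n E => q.1) p
        (∑ i, (-dirDeriv (dualModel m n) (iota n (Y i)) p w) • vlift p (η i)) = 0 := by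
      refine Submodule.sum_mem (LinearMap.ker (mfderiv (dualModel m n) (𝓡 m)
        (fun q : DualTotal n E => q.1) p).toLinearMap) fun i _ => Submodule.smul_mem _ _ ?_
      exact projT_vlift p (η i)
    rw [h2, add_zero] at h1
    exact h1.trans hw
  · intro i
    rw [dirDeriv_vec_add, dirDeriv_vec_sum]
    simp_rw [dirDeriv_vec_smul, dirDeriv_vlift_iota (hY i), hη]
    simp

lemma adapted_dual {p : DualTotal n E} {x : Fin m → M → ℝ}
    {Y : Fin n → ∀ y, E y} (hx : ∀ b, ContMDiffAt (𝓡 m) 𝓘(ℝ, ℝ) ∞ (x b) p.1)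
    (hY : ∀ i, SmoothSectionAt m n (Y i) p.1)
    {D : Fin m → TangentSpace (𝓡 m) p.1} {η : Fin n → DualBundle E p.1}
    (hD : ∀ b c, dirDeriv (𝓡 m) (x b) p.1 (D c) = if b = c then 1 else 0)
    (hη : ∀ i j, (η i (Y j p.1) : ℝ) = if i = j then 1 else 0)
    {u : Fin m → TangentSpace (dualModel m n) p} (hu : ∀ b, projT p (u b) = D b)
    (hu' : ∀ b i, dirDeriv (dualModel m n) (iota n (Y i)) p (u b) = 0) (k l : Fin (m + n)) :
    dirDeriv (dualModel m n) (adapted x Y k) p (Fin.append u (fun i => vlift p (η i)) l)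
      = if k = l then 1 else 0 := by
  have hmd b : MDifferentiableAt (𝓡 m) 𝓘(ℝ, ℝ) (x b) p.1 := (hx b).mdifferentiableAt (by simp)
  have h0 (f : M → ℝ) : dirDeriv (𝓡 m) f p.1 0 = 0 := (differential (𝓡 m) f p.1).map_zero
  refine Fin.addCases (fun b => ?_) (fun i => ?_) k <;>
    refine Fin.addCases (fun c => ?_) (fun j => ?_) l
  · simp [dirDeriv_basic (hmd b), hu, hD]
  · have : Fin.castAdd n b ≠ Fin.natAdd m j := by
      intro h; have := congrArg Fin.val h; simp at this; omega
    simp [dirDeriv_basic (hmd b), projT_vlift, h0, this]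
  · have : Fin.natAdd m i ≠ Fin.castAdd n c := by
      intro h; have := congrArg Fin.val h; simp at this; omega
    simp [hu', this]
  · simp [dirDeriv_vlift_iota (hY i), hη, eq_comm]

/-- The value of `π^* dx¹ ∧ … ∧ dι(Yₙ)` on arguments the last `n` of which are vertical. -/
lemma wedgeDiff_adapted_apply {p : DualTotal n E} {x : Fin m → M → ℝ}
    {Y : Fin n → ∀ y, E y} (hx : ∀ b, ContMDiffAt (𝓡 m) 𝓘(ℝ, ℝ) ∞ (x b) p.1)
    (hY : ∀ i, SmoothSectionAt m n (Y i) p.1)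
    (u : Fin m → TangentSpace (dualModel m n) p) (η : Fin n → DualBundle E p.1) :
    wedgeDiff (dualModel m n) (adapted x Y) p (Fin.append u fun i => vlift p (η i))
      = wedgeDiff (𝓡 m) x p.1 (fun b => projT p (u b))
        * (Matrix.of fun j i => (η i (Y j p.1) : ℝ)).det := by
  have hmd b : MDifferentiableAt (𝓡 m) 𝓘(ℝ, ℝ) (x b) p.1 := (hx b).mdifferentiableAt (by simp)
  have h0 (f : M → ℝ) : dirDeriv (𝓡 m) f p.1 0 = 0 := (differential (𝓡 m) f p.1).map_zero
  -- Basic functions have zero derivative along vertical vectors, so the matrix is block triangular.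
  rw [wedgeDiff_apply, wedgeDiff_apply, ← Matrix.det_submatrix_equiv_self finSumFinEquiv,
    ← Matrix.det_transpose (Matrix.of fun j i => (η i (Y j p.1) : ℝ)),
    ← Matrix.det_fromBlocks_zero₂₁ _
      (Matrix.of fun b i => dirDeriv (dualModel m n) (iota n (Y i)) p (u b))]
  congr 1
  ext (b | i) (c | j)
  · simp [dirDeriv_basic (hmd c)]
  · simp
  · simp [dirDeriv_basic (hmd c), projT_vlift, h0]
  · simp [dirDeriv_vlift_iota (hY j)]

lemma wedgeDiff_adapted_ne_zero {p : DualTotal n E} {x : Fin m → M → ℝ}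
    {Y : Fin n → ∀ y, E y} (hx : ∀ b, ContMDiffAt (𝓡 m) 𝓘(ℝ, ℝ) ∞ (x b) p.1)
    (hx' : wedgeDiff (𝓡 m) x p.1 ≠ 0)
    (hY : ∀ i, SmoothSectionAt m n (Y i) p.1) (hY' : LinearIndependent ℝ fun i => Y i p.1) :
    wedgeDiff (dualModel m n) (adapted x Y) p ≠ 0 := by
  obtain ⟨η, hη, -⟩ := exists_dual_frame hY'
  obtain ⟨D, hD⟩ := exists_dual_of_wedgeDiff_ne_zero hx'
  choose u hu hu' using fun b => exists_horizontal hY hη (D b)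
  intro h
  have := wedgeDiff_apply_dual (adapted_dual hx hY hD hη hu hu')
  rw [h] at this
  exact zero_ne_one this

end Adapted

/-! ### The line bundle `L^E` and its correspondence with top-degree forms on `E*`. -/

section LineBundle

variable {m n : ℕ} {M : Type*} [TopologicalSpace M] [ChartedSpace (EuclideanSpace ℝ (Fin m)) M]
  {E : M → Type*} [∀ x, AddCommGroup (E x)] [∀ x, Module ℝ (E x)]
  [TopologicalSpace (TotalSpace (Fib n) E)] [∀ x, TopologicalSpace (E x)]
  [FiberBundle (Fib n) E] [VectorBundle ℝ (Fib n) E]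
  [IsManifold (𝓡 m) ∞ M] [ContMDiffVectorBundle ∞ (Fib n) E (𝓡 m)]

/-- The alternating form `η₁ ∧ … ∧ ηₙ` on a fibre of `E`. -/
def covectorWedge {x : M} (η : Fin n → DualBundle E x) : E x [⋀^Fin n]→ₗ[ℝ] ℝ :=
  Matrix.detRowAlternating.compLinearMap
    (LinearMap.pi fun i => (show E x →L[ℝ] ℝ from η i).toLinearMap)

lemma covectorWedge_apply {x : M} (η : Fin n → DualBundle E x) (Y : Fin n → E x) :
    covectorWedge η Y = (Matrix.of fun j i => (η i (Y j) : ℝ)).det := rfl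

lemma covectorWedge_dual {x : M} {η : Fin n → DualBundle E x} {Y : Fin n → E x}
    (hη : ∀ i j, (η i (Y j) : ℝ) = if i = j then 1 else 0) : covectorWedge η Y = 1 := by
  rw [covectorWedge_apply, ← Matrix.det_one (n := Fin n)]
  congr 1
  ext j i
  simp [hη, Matrix.one_apply, eq_comm]

/-- The pairing of `L^E` with tangent vectors of `M` and covectors in `E*`, determined by
`Y₁ ∧ … ∧ Yₙ ⊗ μ ↦ det(ηᵢ(Yⱼ)) μ(u)`. -/
def pairing {x : M} (u : Fin m → TangentSpace (𝓡 m) x) (η : Fin n → DualBundle E x) :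
    LFiber m n E x →ₗ[ℝ] ℝ :=
  TensorProduct.lift ((LinearMap.mul ℝ ℝ).compl₁₂
    (exteriorPower.alternatingMapLinearEquiv (covectorWedge η))
    { toFun := fun μ => μ u
      map_add' := fun _ _ => rfl
      map_smul' := fun _ _ => rfl })

lemma pairing_wedgeTensor {x : M} (u : Fin m → TangentSpace (𝓡 m) x)
    (η : Fin n → DualBundle E x) (Y : Fin n → E x)
    (μ : TangentSpace (𝓡 m) x [⋀^Fin m]→ₗ[ℝ] ℝ) :
    pairing u η (wedgeTensor Y μ) = covectorWedge η Y * μ u := by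
  simp [pairing, wedgeTensor]

lemma wedgeTensor_smul {x : M} (Y : Fin n → E x) (c : ℝ)
    (μ : TangentSpace (𝓡 m) x [⋀^Fin m]→ₗ[ℝ] ℝ) :
    wedgeTensor Y (c • μ) = c • wedgeTensor Y μ :=
  TensorProduct.tmul_smul _ _ _

/-- Both sides are alternating in `Z`, so they may be compared on permutations of the basis `Y`,
where each acquires the sign of the permutation. -/
lemma ιMulti_eq_smul {x : M} {Y : Fin n → E x} {η : Fin n → DualBundle E x}
    (hη : ∀ i j, (η i (Y j) : ℝ) = if i = j then 1 else 0)
    (hv : ∀ v : E x, v = ∑ i, (η i v : ℝ) • Y i) (Z : Fin n → E x) :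
    exteriorPower.ιMulti ℝ n Z = covectorWedge η Z • exteriorPower.ιMulti ℝ n Y := by
  have hsp : ⊤ ≤ Submodule.span ℝ (Set.range Y) := by
    intro v _
    rw [hv v]
    exact Submodule.sum_mem _ fun i _ => Submodule.smul_mem _ _ (Submodule.subset_span ⟨i, rfl⟩)
  have hli : LinearIndependent ℝ Y := by
    rw [Fintype.linearIndependent_iff]
    intro g hg i
    have := congrArg (fun v => (η i v : ℝ)) hg
    simpa [hη] using this
  let b := Module.Basis.mk hli hsp
  have hb : ⇑b = Y := Module.Basis.coe_mk _ _
  have key : exteriorPower.ιMulti ℝ n (M := E x)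
      = (LinearMap.toSpanSingleton ℝ _ (exteriorPower.ιMulti ℝ n Y)).compAlternatingMap
        (covectorWedge η) := by
    refine Module.Basis.ext_alternating b fun v hv => ?_
    obtain ⟨σ, rfl⟩ : ∃ σ : Equiv.Perm (Fin n), ⇑σ = v :=
      ⟨Equiv.ofBijective v (Finite.injective_iff_bijective.mp hv), rfl⟩
    have h1 : (fun i => b (σ i)) = Y ∘ σ := by rw [hb]; rfl
    rw [h1, AlternatingMap.map_perm, AlternatingMap.map_perm]
    simp [covectorWedge_dual hη]
  exact DFunLike.congr_fun key Z

/-- The fibres of `L^E` are one-dimensional. -/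
lemma exists_eq_smul_wedgeTensor {x : M} {Y : Fin n → E x} (hY : LinearIndependent ℝ Y)
    {μ : TangentSpace (𝓡 m) x [⋀^Fin m]→ₗ[ℝ] ℝ} (hμ : μ ≠ 0) (s : LFiber m n E x) :
    ∃ c : ℝ, s = c • wedgeTensor Y μ := by
  obtain ⟨η, hη, hv, -⟩ := exists_dual_frame hY
  induction s using TensorProduct.induction_on with
  | zero => exact ⟨0, by rw [zero_smul]⟩
  | add a b ha hb =>
    obtain ⟨c, rfl⟩ := ha
    obtain ⟨d, rfl⟩ := hb
    exact ⟨c + d, by rw [add_smul]⟩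
  | tmul a ν =>
    obtain ⟨d, rfl⟩ := exists_eq_smul_of_top_degree
      (finrank_tangentSpace (I := 𝓡 m) (by simp) x) hμ ν
    have ha : a ∈ Submodule.span ℝ (Set.range (exteriorPower.ιMulti ℝ n (M := E x))) := by
      rw [exteriorPower.ιMulti_span]; trivial
    obtain ⟨c, rfl⟩ : ∃ c : ℝ, a = c • exteriorPower.ιMulti ℝ n Y := by
      induction ha using Submodule.span_induction with
      | mem a h =>
        obtain ⟨Z, rfl⟩ := h
        exact ⟨_, ιMulti_eq_smul hη hv Z⟩
      | zero => exact ⟨0, by rw [zero_smul]⟩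
      | add a b _ _ ha hb =>
        obtain ⟨c, rfl⟩ := ha
        obtain ⟨d, rfl⟩ := hb
        exact ⟨c + d, by rw [add_smul]⟩
      | smul c a _ ha =>
        obtain ⟨d, rfl⟩ := ha
        exact ⟨c * d, by rw [mul_smul]⟩
    exact ⟨c * d, by rw [wedgeTensor, TensorProduct.smul_tmul_smul]⟩

lemma linearIndependent_of_wedgeTensor_ne_zero {x : M} {Y : Fin n → E x}
    {μ : TangentSpace (𝓡 m) x [⋀^Fin m]→ₗ[ℝ] ℝ} (h : wedgeTensor Y μ ≠ 0) :
    LinearIndependent ℝ Y := by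
  by_contra hY
  exact h (by rw [wedgeTensor, AlternatingMap.map_linearDependent _ _ hY, TensorProduct.zero_tmul])

lemma ne_zero_of_wedgeTensor_ne_zero {x : M} {Y : Fin n → E x}
    {μ : TangentSpace (𝓡 m) x [⋀^Fin m]→ₗ[ℝ] ℝ} (h : wedgeTensor Y μ ≠ 0) : μ ≠ 0 := by
  rintro rfl
  exact h (by rw [wedgeTensor, TensorProduct.tmul_zero])

/-- Only the `Yᵢ`-component of `wᵢ` survives in the `i`-th slot, since any other component repeats a
factor. Applied to brackets, this gives the trace term of `∇_X`. -/
lemma sum_wedgeTensor_update {x : M} {Y : Fin n → E x} {η : Fin n → DualBundle E x}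
    (hv : ∀ v : E x, v = ∑ i, (η i v : ℝ) • Y i) (w : Fin n → E x)
    (μ : TangentSpace (𝓡 m) x [⋀^Fin m]→ₗ[ℝ] ℝ) :
    ∑ i, wedgeTensor (Function.update Y i (w i)) μ
      = (∑ i, (η i (w i) : ℝ)) • wedgeTensor Y μ := by
  rw [Finset.sum_smul]
  refine Finset.sum_congr rfl fun i _ => ?_
  have h : exteriorPower.ιMulti ℝ n (Function.update Y i (w i))
      = (η i (w i) : ℝ) • exteriorPower.ιMulti ℝ n Y := by
    conv_lhs => rw [hv (w i), AlternatingMap.map_update_sum]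
    rw [Finset.sum_eq_single i]
    · rw [AlternatingMap.map_update_smul, Function.update_eq_self]
    · intro j _ hj
      rw [AlternatingMap.map_update_smul, AlternatingMap.map_update_self _ _ hj.symm, smul_zero]
    · simp
  rw [wedgeTensor, h]
  exact (TensorProduct.smul_tmul' (R := ℝ) _ _ _).symm

/-- The top-degree form `θ` on the tangent space of `E*` at `p` corresponds to the element `s` of the
line `L^E` at `π(p)`: if `s = Y₁ ∧ … ∧ Yₙ ⊗ μ`, then `θ = ± dι(Y₁) ∧ … ∧ dι(Yₙ) ∧ π^* μ`. -/
def Match (p : DualTotal n E) (s : LFiber m n E p.1)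
    (θ : TangentSpace (dualModel m n) p [⋀^Fin (m + n)]→ₗ[ℝ] ℝ) : Prop :=
  ∀ (u : Fin m → TangentSpace (dualModel m n) p) (η : Fin n → DualBundle E p.1),
    θ (Fin.append u fun i => vlift p (η i)) = pairing (fun b => projT p (u b)) η s

lemma Match.smul {p : DualTotal n E} {s : LFiber m n E p.1}
    {θ : TangentSpace (dualModel m n) p [⋀^Fin (m + n)]→ₗ[ℝ] ℝ} (h : Match p s θ) (c : ℝ) :
    Match p (c • s) (c • θ) := by
  intro u η
  rw [AlternatingMap.smul_apply, h u η, map_smul]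

lemma match_adapted {p : DualTotal n E} {x : Fin m → M → ℝ}
    {Y : Fin n → ∀ y, E y} (hx : ∀ b, ContMDiffAt (𝓡 m) 𝓘(ℝ, ℝ) ∞ (x b) p.1)
    (hY : ∀ i, SmoothSectionAt m n (Y i) p.1) (c : ℝ) :
    Match p (wedgeTensor (fun i => Y i p.1) (c • wedgeDiff (𝓡 m) x p.1))
      (c • wedgeDiff (dualModel m n) (adapted x Y) p) := by
  rw [wedgeTensor_smul]
  refine Match.smul (fun u η => ?_) c
  rw [wedgeDiff_adapted_apply hx hY, pairing_wedgeTensor, covectorWedge_apply, mul_comm]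

/-- Some tuple of the kind tested by `Match` is a basis, namely horizontal lifts followed by
vertical lifts, and a top-degree form is determined by its value on a basis. -/
lemma Match.eq_form {p : DualTotal n E} {s : LFiber m n E p.1}
    {θ θ' : TangentSpace (dualModel m n) p [⋀^Fin (m + n)]→ₗ[ℝ] ℝ} (h : Match p s θ)
    (h' : Match p s θ') : θ = θ' := by
  obtain ⟨U, x, Y, hA, hp⟩ := exists_adaptedFrame m n E p.1
  have hx b := hA.coord_smooth b _ hp
  have hY i := hA.frame_smooth i _ hp
  obtain ⟨η, hη, -⟩ := exists_dual_frame (hA.frame_indep _ hp)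
  obtain ⟨D, hD⟩ := exists_dual_of_wedgeDiff_ne_zero (hA.coord_indep _ hp)
  choose u hu hu' using fun b => exists_horizontal hY hη (D b)
  have hw := wedgeDiff_apply_dual (adapted_dual hx hY hD hη hu hu')
  have h0 := wedgeDiff_adapted_ne_zero hx (hA.coord_indep _ hp) hY (hA.frame_indep _ hp)
  obtain ⟨c, hc⟩ := exists_eq_smul_of_top_degree
    (finrank_tangentSpace (I := dualModel m n) (finrank_dualModel m n) p) h0 θ
  obtain ⟨c', hc'⟩ := exists_eq_smul_of_top_degree
    (finrank_tangentSpace (I := dualModel m n) (finrank_dualModel m n) p) h0 θ'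
  have := (h u η).trans (h' u η).symm
  rw [hc, hc', AlternatingMap.smul_apply, AlternatingMap.smul_apply, hw] at this
  rw [hc, hc', show c = c' by simpa using this]

lemma Match.eq_section {p : DualTotal n E} {s s' : LFiber m n E p.1}
    {θ : TangentSpace (dualModel m n) p [⋀^Fin (m + n)]→ₗ[ℝ] ℝ} (h : Match p s θ)
    (h' : Match p s' θ) : s = s' := by
  obtain ⟨U, x, Y, hA, hp⟩ := exists_adaptedFrame m n E p.1
  have hx b := hA.coord_smooth b _ hp
  have hY i := hA.frame_smooth i _ hp
  obtain ⟨η, hη, -⟩ := exists_dual_frame (hA.frame_indep _ hp)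
  obtain ⟨D, hD⟩ := exists_dual_of_wedgeDiff_ne_zero (hA.coord_indep _ hp)
  choose u hu hu' using fun b => exists_horizontal hY hη (D b)
  obtain ⟨c, hc⟩ := exists_eq_smul_wedgeTensor (hA.frame_indep _ hp) (hA.coord_indep _ hp) s
  obtain ⟨c', hc'⟩ := exists_eq_smul_wedgeTensor (hA.frame_indep _ hp) (hA.coord_indep _ hp) s'
  have := (h u η).symm.trans (h' u η)
  rw [hc, hc', map_smul, map_smul, pairing_wedgeTensor, covectorWedge_dual hη, funext hu,
    wedgeDiff_apply_dual hD] at this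
  rw [hc, hc', show c = c' by simpa using this]

lemma exists_match_form (p : DualTotal n E) (s : LFiber m n E p.1) : ∃ θ, Match p s θ := by
  obtain ⟨U, x, Y, hA, hp⟩ := exists_adaptedFrame m n E p.1
  obtain ⟨c, hc⟩ := exists_eq_smul_wedgeTensor (hA.frame_indep _ hp) (hA.coord_indep _ hp) s
  rw [← wedgeTensor_smul] at hc
  exact ⟨_, hc ▸ match_adapted (fun b => hA.coord_smooth b _ hp)
    (fun i => hA.frame_smooth i _ hp) c⟩

lemma exists_match_section (p : DualTotal n E)
    (θ : TangentSpace (dualModel m n) p [⋀^Fin (m + n)]→ₗ[ℝ] ℝ) : ∃ s, Match p s θ := by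
  obtain ⟨U, x, Y, hA, hp⟩ := exists_adaptedFrame m n E p.1
  have hx b := hA.coord_smooth b _ hp
  have hY i := hA.frame_smooth i _ hp
  obtain ⟨c, hc⟩ := exists_eq_smul_of_top_degree
    (finrank_tangentSpace (I := dualModel m n) (finrank_dualModel m n) p)
    (wedgeDiff_adapted_ne_zero hx (hA.coord_indep _ hp) hY (hA.frame_indep _ hp)) θ
  exact ⟨_, hc ▸ match_adapted hx hY c⟩

/-- The correspondence is one-to-one and compatible with scalars, in particular with `-1`, so it
descends to elements up to sign. -/
lemma Match.toAbs_eq {p : DualTotal n E} {s s' : LFiber m n E p.1}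
    {θ θ' : TangentSpace (dualModel m n) p [⋀^Fin (m + n)]→ₗ[ℝ] ℝ} (h : Match p s θ)
    (h' : Match p s' θ') : toAbs s = toAbs s' ↔ toAbs θ = toAbs θ' := by
  have hneg : Match p (-s') (-θ') := by
    have h1 : (-1 : ℝ) • s' = -s' := by module
    have h2 : (-1 : ℝ) • θ' = -θ' := by module
    rw [← h1, ← h2]
    exact h'.smul (-1)
  rw [toAbs_eq_iff, toAbs_eq_iff]
  constructor
  · rintro (rfl | rfl)
    · exact Or.inl (h.eq_form h')
    · exact Or.inr (h.eq_form hneg)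
  · rintro (rfl | rfl)
    · exact Or.inl (h.eq_section h')
    · exact Or.inr (h.eq_section hneg)

lemma Match.eq_zero_iff {p : DualTotal n E} {s : LFiber m n E p.1}
    {θ : TangentSpace (dualModel m n) p [⋀^Fin (m + n)]→ₗ[ℝ] ℝ} (h : Match p s θ) :
    s = 0 ↔ θ = 0 := by
  have h0 : Match p (0 : LFiber m n E p.1) 0 := by simpa using h.smul 0
  exact ⟨by rintro rfl; exact h.eq_form h0, by rintro rfl; exact h.eq_section h0⟩

end LineBundle

/-! ### Divergence of Hamiltonian vector fields. -/

section Divergence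

variable {m n : ℕ} {M : Type*} [TopologicalSpace M] [ChartedSpace (EuclideanSpace ℝ (Fin m)) M]
  {E : M → Type*} [∀ x, AddCommGroup (E x)] [∀ x, Module ℝ (E x)]
  [TopologicalSpace (TotalSpace (Fib n) E)] [∀ x, TopologicalSpace (E x)]
  [FiberBundle (Fib n) E] [VectorBundle ℝ (Fib n) E]
  [IsManifold (𝓡 m) ∞ M] [ContMDiffVectorBundle ∞ (Fib n) E (𝓡 m)]
  (A : SkewAlgebroid m n E)

namespace SkewAlgebroid

lemma poisson_skew (f g : DualTotal n E → ℝ) (p : DualTotal n E) :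
    poisson A.bivector f g p = -poisson A.bivector g f p :=
  A.skew p (differential (dualModel m n) f p) (differential (dualModel m n) g p)

lemma poisson_eq_neg_dirDeriv (f g : DualTotal n E → ℝ) (p : DualTotal n E) :
    poisson A.bivector f g p
      = -dirDeriv (dualModel m n) f p (hamiltonianField A.bivector g p) :=
  A.poisson_skew f g p

lemma contMDiffAt_poisson {f g : DualTotal n E → ℝ} {p : DualTotal n E}
    (hf : ContMDiffAt (dualModel m n) 𝓘(ℝ, ℝ) ∞ f p)
    (hg : ContMDiffAt (dualModel m n) 𝓘(ℝ, ℝ) ∞ g p) :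
    ContMDiffAt (dualModel m n) 𝓘(ℝ, ℝ) ∞ (poisson A.bivector f g) p :=
  contMDiffAt_dirDeriv hg (A.smooth f p hf)

/-- The divergence of a Hamiltonian vector field `X_R` vanishes at the critical points of `R`. -/
lemma divergence_eq_zero_of_critical {p : DualTotal n E} {f : Fin (m + n) → DualTotal n E → ℝ}
    (hf : ∀ i, ContMDiffAt (dualModel m n) 𝓘(ℝ, ℝ) ∞ (f i) p)
    {e : Fin (m + n) → TangentSpace (dualModel m n) p}
    (he : ∀ i k, dirDeriv (dualModel m n) (f i) p (e k) = if i = k then 1 else 0)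
    {R : DualTotal n E → ℝ} (hR : ContMDiffAt (dualModel m n) 𝓘(ℝ, ℝ) ∞ R p)
    (hR0 : ∀ v, dirDeriv (dualModel m n) R p v = 0) :
    ∑ i, dirDeriv (dualModel m n) (poisson A.bivector R (f i)) p (e i) = 0 := by
  let e' (i : Fin (m + n)) : ∀ q : DualTotal n E, TangentSpace (dualModel m n) q :=
    FiberBundle.extend (EuclideanSpace ℝ (Fin m) × DualFib n) (e i)
  have he's (i) : SmoothFieldAt (dualModel m n) (e' i) p := smoothFieldAt_extend (e i)
  have he'p (i) : e' i p = e i := by simp [e']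
  let B (l i : Fin (m + n)) : ℝ :=
    dirDeriv (dualModel m n) (fun q => dirDeriv (dualModel m n) R q (e' i q)) p (e l)
  -- `B` is the Hessian of `R`. It is symmetric since the bracket term in the commutator formula is
  -- a first derivative of `R`, which vanishes at `p`.
  have hB (l i) : B l i = B i l := by
    have := dirDeriv_mlieBracket hR (he's l) (he's i)
    rw [hR0, he'p, he'p] at this
    simp only [B]
    linarith
  let P (i l : Fin (m + n)) : ℝ := poisson A.bivector (f i) (f l) p
  -- Since `{R, fᵢ} = -X_{fᵢ}(R)`, the criticality of `R` at `p` allows the derivatives along `eᵢ`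
  -- and `X_{fᵢ}` to be exchanged. The components of `X_{fᵢ}` are the brackets `P i l`.
  have h1 (i) : dirDeriv (dualModel m n) (poisson A.bivector R (f i)) p (e i)
      = -∑ l, P i l * B l i := by
    have h2 : poisson A.bivector R (f i) = fun q =>
        -dirDeriv (dualModel m n) R q (hamiltonianField A.bivector (f i) q) :=
      funext fun q => A.poisson_eq_neg_dirDeriv R (f i) q
    have h3 := dirDeriv_mlieBracket hR (A.smooth (f i) p (hf i)) (he's i)
    rw [hR0, he'p] at h3
    rw [h2, dirDeriv_neg, neg_inj, ← sub_eq_zero.mp h3.symm,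
      vec_eq_sum_dual (finrank_dualModel m n) he (hamiltonianField A.bivector (f i) p),
      dirDeriv_vec_sum]
    simp_rw [dirDeriv_vec_smul]
    rfl
  simp_rw [h1, Finset.sum_neg_distrib]
  -- A skew matrix is contracted with a symmetric one.
  have h4 : ∑ i, ∑ l, P i l * B l i = -∑ i, ∑ l, P i l * B l i := by
    conv_lhs => rw [Finset.sum_comm]
    rw [← Finset.sum_neg_distrib]
    refine Finset.sum_congr rfl fun i _ => ?_
    rw [← Finset.sum_neg_distrib]
    refine Finset.sum_congr rfl fun l _ => ?_
    rw [hB i l, show P l i = -P i l from A.poisson_skew _ _ _]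
    ring
  linarith

/-- The divergence of `X_H` at `p` with respect to `k df₁ ∧ … ∧ df_d`, multiplied by `k(p)`; here `e`
is the basis dual to the differentials `dfᵢ` at `p`. -/
def scaledDiv (f : Fin (m + n) → DualTotal n E → ℝ) (k : DualTotal n E → ℝ) (p : DualTotal n E)
    (e : Fin (m + n) → TangentSpace (dualModel m n) p) (H : DualTotal n E → ℝ) : ℝ :=
  poisson A.bivector H k p
    + k p * ∑ i, dirDeriv (dualModel m n) (poisson A.bivector H (f i)) p (e i)

variable {A} in
lemma hasLieDerivAt_hamiltonianField {p : DualTotal n E} {f : Fin (m + n) → DualTotal n E → ℝ}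
    (hf : ∀ i, ContMDiffAt (dualModel m n) 𝓘(ℝ, ℝ) ∞ (f i) p)
    {e : Fin (m + n) → TangentSpace (dualModel m n) p}
    (he : ∀ i k, dirDeriv (dualModel m n) (f i) p (e k) = if i = k then 1 else 0)
    {k : DualTotal n E → ℝ} (hk : ContMDiffAt (dualModel m n) 𝓘(ℝ, ℝ) ∞ k p)
    {H : DualTotal n E → ℝ} (hH : ContMDiffAt (dualModel m n) 𝓘(ℝ, ℝ) ∞ H p)
    {θ : ∀ q : DualTotal n E, TangentSpace (dualModel m n) q [⋀^Fin (m + n)]→ₗ[ℝ] ℝ}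
    (hθ : ∀ᶠ q in 𝓝 p, θ q = k q • wedgeDiff (dualModel m n) f q) :
    HasLieDerivAt (dualModel m n) (hamiltonianField A.bivector H) θ p
      (A.scaledDiv f k p e H • wedgeDiff (dualModel m n) f p) :=
  hasLieDerivAt_of_eq_smul_wedgeDiff (A.smooth H p hH) hf (hk.mdifferentiableAt (by simp)) hθ
    (A := fun i l => dirDeriv (dualModel m n) (poisson A.bivector H (f i)) p (e l))
    fun i v => dirDeriv_eq_sum_dual (finrank_dualModel m n) he _ v

/-- The divergence of `X_H` at `p` depends linearly on the differential of `H` at `p`. -/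
lemma scaledDiv_eq_sum {p : DualTotal n E} {f : Fin (m + n) → DualTotal n E → ℝ}
    (hf : ∀ i, ContMDiffAt (dualModel m n) 𝓘(ℝ, ℝ) ∞ (f i) p)
    {e : Fin (m + n) → TangentSpace (dualModel m n) p}
    (he : ∀ i k, dirDeriv (dualModel m n) (f i) p (e k) = if i = k then 1 else 0)
    (k : DualTotal n E → ℝ)
    {H : DualTotal n E → ℝ} (hH : ContMDiffAt (dualModel m n) 𝓘(ℝ, ℝ) ∞ H p) :
    A.scaledDiv f k p e H
      = ∑ l, dirDeriv (dualModel m n) H p (e l) * A.scaledDiv f k p e (f l) := by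
  set c : Fin (m + n) → ℝ := fun l => dirDeriv (dualModel m n) H p (e l) with hc
  -- Subtracting the first-order part of `H` leaves a function critical at `p`, whose divergence
  -- vanishes. The rest is linearity of the divergence over constant coefficients.
  let R : DualTotal n E → ℝ := fun q => H q + ∑ l, (-c l) * f l q
  have hmd : ∀ᶠ q in 𝓝 p, MDifferentiableAt (dualModel m n) 𝓘(ℝ, ℝ) H q ∧
      ∀ l, MDifferentiableAt (dualModel m n) 𝓘(ℝ, ℝ) (f l) q :=
    (eventually_mdifferentiableAt hH).and
      (Filter.eventually_all.mpr fun l => eventually_mdifferentiableAt (hf l))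
  have hRd : ∀ᶠ q in 𝓝 p, ∀ v, dirDeriv (dualModel m n) R q v
      = dirDeriv (dualModel m n) H q v - ∑ l, c l * dirDeriv (dualModel m n) (f l) q v := by
    filter_upwards [hmd] with q hq v
    rw [dirDeriv_add_sum_const_mul _ _ hq.1 fun l _ => hq.2 l, sub_eq_add_neg,
      ← Finset.sum_neg_distrib]
    simp_rw [neg_mul]
  have hRs : ContMDiffAt (dualModel m n) 𝓘(ℝ, ℝ) ∞ R p :=
    hH.add (ContMDiffAt.sum fun l _ => contMDiffAt_const.mul (hf l))
  have hR0 (v) : dirDeriv (dualModel m n) R p v = 0 := by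
    rw [hRd.self_of_nhds, dirDeriv_eq_sum_dual (finrank_dualModel m n) he H v, sub_self]
  have h0 := A.divergence_eq_zero_of_critical hf he hRs hR0
  have h1 (i) : dirDeriv (dualModel m n) (poisson A.bivector R (f i)) p (e i)
      = dirDeriv (dualModel m n) (poisson A.bivector H (f i)) p (e i)
        + ∑ l, (-c l) * dirDeriv (dualModel m n) (poisson A.bivector (f l) (f i)) p (e i) := by
    have hp1 {g : DualTotal n E → ℝ} (hg : ContMDiffAt (dualModel m n) 𝓘(ℝ, ℝ) ∞ g p) :
        MDifferentiableAt (dualModel m n) 𝓘(ℝ, ℝ) (poisson A.bivector g (f i)) p :=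
      (A.contMDiffAt_poisson hg (hf i)).mdifferentiableAt (by simp)
    have h2 : poisson A.bivector R (f i) =ᶠ[𝓝 p] fun q => poisson A.bivector H (f i) q
        + ∑ l, (-c l) * poisson A.bivector (f l) (f i) q := by
      filter_upwards [hRd] with q hq
      simp only [poisson_eq_neg_dirDeriv, hq]
      rw [neg_sub, sub_eq_neg_add]
      congr 1
      exact Finset.sum_congr rfl fun l _ => by ring
    rw [dirDeriv_congr h2, dirDeriv_add_sum_const_mul _ _ (hp1 hH) fun l _ => hp1 (hf l)]
  have h3 : ∑ i, dirDeriv (dualModel m n) (poisson A.bivector H (f i)) p (e i)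
      = ∑ l, c l * ∑ i, dirDeriv (dualModel m n) (poisson A.bivector (f l) (f i)) p (e i) := by
    simp_rw [h1, Finset.sum_add_distrib, neg_mul, Finset.sum_neg_distrib] at h0
    rw [← sub_eq_add_neg, sub_eq_zero] at h0
    rw [h0, Finset.sum_comm]
    simp_rw [Finset.mul_sum]
  have h4 : poisson A.bivector H k p = ∑ l, c l * poisson A.bivector (f l) k p := by
    simp_rw [poisson_eq_neg_dirDeriv]
    rw [dirDeriv_eq_sum_dual (finrank_dualModel m n) he H, ← Finset.sum_neg_distrib]
    exact Finset.sum_congr rfl fun l _ => by simp only [hc]; ring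
  rw [scaledDiv, h3, h4]
  simp_rw [scaledDiv, mul_add, Finset.sum_add_distrib, Finset.mul_sum]
  congr 1
  exact Finset.sum_congr rfl fun l _ => Finset.sum_congr rfl fun i _ => by ring

/-! #### The anchor and the bracket -/

/-- The anchor is defined through the zero covector; `linear_basic` moves the evaluation to an
arbitrary `ξ`. -/
lemma dirDeriv_anchor {X : ∀ x, E x} {f : M → ℝ} {y : M} (hX : SmoothSectionAt m n X y)
    (hf : ContMDiffAt (𝓡 m) 𝓘(ℝ, ℝ) ∞ f y) (ξ : DualBundle E y) :
    dirDeriv (𝓡 m) f y (A.anchor X y)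
      = poisson A.bivector (iota n X) (basic n f) ⟨y, ξ⟩ := by
  rw [A.linear_basic X f y hX hf ξ 0]
  exact (dirDeriv_basic (p := (⟨y, 0⟩ : DualTotal n E)) (hf.mdifferentiableAt (by simp)) _).symm

/-- The anchor field is a composite of smooth maps: the zero section, the Hamiltonian field of
`ι(X)`, and the tangent map of the projection. -/
lemma smoothFieldAt_anchor {X : ∀ x, E x} {y : M} (hX : SmoothSectionAt m n X y) :
    SmoothFieldAt (𝓡 m) (A.anchor X) y := by
  have h1 : ContMDiff (dualModel m n).tangent (𝓡 m).tangent ∞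
      (tangentMap (dualModel m n) (𝓡 m) fun p : DualTotal n E => p.1) :=
    contMDiff_dualProj.contMDiff_tangentMap le_rfl
  have h2 : ContMDiffAt (dualModel m n) (dualModel m n).tangent ∞
      (fun q => (⟨q, hamiltonianField A.bivector (iota n X) q⟩ :
        TangentBundle (dualModel m n) (DualTotal n E))) (⟨y, 0⟩ : DualTotal n E) :=
    A.smooth (iota n X) _ (contMDiffAt_iota hX)
  have h3 : ContMDiffAt (𝓡 m) (dualModel m n) ∞
      (fun y => (⟨y, 0⟩ : DualTotal n E)) y :=
    (Bundle.contMDiff_zeroSection ℝ (DualBundle E)).contMDiffAt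
  exact h1.contMDiffAt.comp y (h2.comp y h3)

lemma exists_hasBracketAt {X Y : ∀ x, E x} {y : M} (hX : SmoothSectionAt m n X y)
    (hY : SmoothSectionAt m n Y y) : ∃ w, A.HasBracketAt X Y y w := by
  obtain ⟨U, x, Z, hA, hy⟩ := exists_adaptedFrame m n E y
  obtain ⟨η, -, -, hη⟩ := exists_dual_frame (hA.frame_indep y hy)
  exact exists_fibre_eq (A.linear_linear X Y y hX hY) hη

lemma HasNablaAt.unique {A : SkewAlgebroid m n E} {X : ∀ x, E x} {Y : Fin n → ∀ x, E x}
    {μ : ∀ y : M, TangentSpace (𝓡 m) y [⋀^Fin m]→ₗ[ℝ] ℝ} {x : M} {τ τ' : LFiber m n E x}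
    (h : A.HasNablaAt X Y μ x τ) (h' : A.HasNablaAt X Y μ x τ') : τ = τ' := by
  obtain ⟨w, ν, hw, hν, rfl⟩ := h
  obtain ⟨w', ν', hw', hν', rfl⟩ := h'
  have h1 : w = w' := funext fun i => eq_of_forall_dual n fun ξ => (hw i ξ).trans (hw' i ξ).symm
  rw [h1, hν.unique hν']

end SkewAlgebroid

end Divergence

/-! ### The divergence in adapted coordinates and its relation to `∇`. -/

section LocalFormula

variable {m n : ℕ} {M : Type*} [TopologicalSpace M] [ChartedSpace (EuclideanSpace ℝ (Fin m)) M]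
  {E : M → Type*} [∀ x, AddCommGroup (E x)] [∀ x, Module ℝ (E x)]
  [TopologicalSpace (TotalSpace (Fib n) E)] [∀ x, TopologicalSpace (E x)]
  [FiberBundle (Fib n) E] [VectorBundle ℝ (Fib n) E]
  [IsManifold (𝓡 m) ∞ M] [ContMDiffVectorBundle ∞ (Fib n) E (𝓡 m)]
  (A : SkewAlgebroid m n E)

lemma eventually_proj_mem {U : Set M} (hU : IsOpen U) {p : DualTotal n E} (hp : p.1 ∈ U) :
    ∀ᶠ q in 𝓝 p, q.1 ∈ U :=
  (FiberBundle.continuous_proj (DualFib n) (DualBundle E)).continuousAt.eventually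
    (hU.mem_nhds hp)

namespace SkewAlgebroid

variable {U : Set M} {x : Fin m → M → ℝ} {Y : Fin n → ∀ y, E y}

/-- Brackets of basic functions vanish, and `{x^b, ι(Yᵢ)}` is constant along fibres, so its vertical
derivative is zero. -/
lemma scaledDiv_basic (hA : AdaptedFrame U x Y) {p : DualTotal n E} (hp : p.1 ∈ U) {h : M → ℝ}
    (hh : ContMDiffAt (𝓡 m) 𝓘(ℝ, ℝ) ∞ h p.1) (u : Fin m → TangentSpace (dualModel m n) p)
    (η : Fin n → DualBundle E p.1) (b : Fin m) :
    A.scaledDiv (adapted x Y) (basic n h) p (Fin.append u fun i => vlift p (η i))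
      (basic n (x b)) = 0 := by
  rw [scaledDiv, A.basic_basic (x b) h p.1 (hA.coord_smooth b _ hp) hh p.2, zero_add,
    Fin.sum_univ_add]
  simp only [adapted_castAdd, adapted_natAdd, Fin.append_left, Fin.append_right]
  have h1 (c : Fin m) : dirDeriv (dualModel m n)
      (poisson A.bivector (basic n (x b)) (basic n (x c))) p (u c) = 0 := by
    rw [← dirDeriv_const (I := dualModel m n) 0 p (u c)]
    apply dirDeriv_congr
    filter_upwards [eventually_proj_mem hA.isOpen hp] with q hq
    exact A.basic_basic (x b) (x c) q.1 (hA.coord_smooth b _ hq) (hA.coord_smooth c _ hq) q.2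
  have h2 (i : Fin n) : dirDeriv (dualModel m n)
      (poisson A.bivector (basic n (x b)) (iota n (Y i))) p (vlift p (η i)) = 0 := by
    refine dirDeriv_vlift_of_const ((A.contMDiffAt_poisson
      (contMDiffAt_basic (hA.coord_smooth b _ hp))
      (contMDiffAt_iota (hA.frame_smooth i _ hp))).mdifferentiableAt (by simp)) (fun ξ => ?_) _
    rw [A.poisson_skew, A.poisson_skew _ _ p]
    exact congrArg Neg.neg
      (A.linear_basic (Y i) (x b) p.1 (hA.frame_smooth i _ hp) (hA.coord_smooth b _ hp) ξ p.2)
  simp [h1, h2]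

/-- The trace splits. The base directions give the divergence of `ρ(X)`. In the fibre directions the
linear function `{ι(X), ι(Yᵢ)}` is its own vertical derivative, which gives the trace of the bracket
with `X`. -/
lemma scaledDiv_iota (hA : AdaptedFrame U x Y) {p : DualTotal n E} (hp : p.1 ∈ U) {h : M → ℝ}
    (hh : ContMDiffAt (𝓡 m) 𝓘(ℝ, ℝ) ∞ h p.1) {u : Fin m → TangentSpace (dualModel m n) p}
    {D : Fin m → TangentSpace (𝓡 m) p.1} (hu : ∀ b, projT p (u b) = D b)
    (η : Fin n → DualBundle E p.1) {X : ∀ y, E y} (hX : ∀ y ∈ U, SmoothSectionAt m n X y)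
    {w : Fin n → E p.1} (hw : ∀ i, A.HasBracketAt X (Y i) p.1 (w i)) :
    A.scaledDiv (adapted x Y) (basic n h) p (Fin.append u fun i => vlift p (η i)) (iota n X)
      = dirDeriv (𝓡 m) h p.1 (A.anchor X p.1)
        + h p.1 * (∑ b, dirDeriv (𝓡 m) (fun y => dirDeriv (𝓡 m) (x b) y (A.anchor X y)) p.1 (D b)
          + ∑ i, (η i (w i) : ℝ)) := by
  rw [scaledDiv, A.dirDeriv_anchor (hX _ hp) hh p.2, Fin.sum_univ_add]
  simp only [adapted_castAdd, adapted_natAdd, Fin.append_left, Fin.append_right]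
  have h1 (b : Fin m) : dirDeriv (dualModel m n)
      (poisson A.bivector (iota n X) (basic n (x b))) p (u b)
        = dirDeriv (𝓡 m) (fun y => dirDeriv (𝓡 m) (x b) y (A.anchor X y)) p.1 (D b) := by
    rw [← hu, ← dirDeriv_basic ((contMDiffAt_dirDeriv (hA.coord_smooth b _ hp)
      (A.smoothFieldAt_anchor (hX _ hp))).mdifferentiableAt (by simp))]
    apply dirDeriv_congr
    filter_upwards [eventually_proj_mem hA.isOpen hp] with q hq
    exact (A.dirDeriv_anchor (hX _ hq) (hA.coord_smooth b _ hq) q.2).symm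
  have h2 (i : Fin n) : dirDeriv (dualModel m n)
      (poisson A.bivector (iota n X) (iota n (Y i))) p (vlift p (η i)) = η i (w i) := by
    rw [dirDeriv_vlift_of_isLinearMap ((A.contMDiffAt_poisson
      (contMDiffAt_iota (hX _ hp)) (contMDiffAt_iota
        (hA.frame_smooth i _ hp))).mdifferentiableAt (by simp))
      (A.linear_linear X (Y i) p.1 (hX _ hp) (hA.frame_smooth i _ hp)), hw]
  simp_rw [h1, h2]
  rfl

/-- `∇_X` and the divergence of the Hamiltonian vector field of `ι(X)` have the same coefficient. -/
theorem exists_nabla_coeff (hA : AdaptedFrame U x Y) {h : M → ℝ}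
    (hh : ∀ y ∈ U, ContMDiffAt (𝓡 m) 𝓘(ℝ, ℝ) ∞ h y) (hh0 : ∀ y ∈ U, h y ≠ 0)
    {μ : ∀ y : M, TangentSpace (𝓡 m) y [⋀^Fin m]→ₗ[ℝ] ℝ}
    (hμ : ∀ y ∈ U, μ y = h y • wedgeDiff (𝓡 m) x y)
    {X : ∀ y, E y} (hX : ∀ y ∈ U, SmoothSectionAt m n X y) {y : M} (hy : y ∈ U) :
    ∃ c : ℝ, A.HasNablaAt X Y μ y (c • wedgeTensor (fun i => Y i y) (μ y)) ∧
      ∀ ξ : DualBundle E y, HasLieDerivAt (dualModel m n)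
        (hamiltonianField A.bivector (iota n X))
        (fun q => basic n h q • wedgeDiff (dualModel m n) (adapted x Y) q) ⟨y, ξ⟩
        (c • h y • wedgeDiff (dualModel m n) (adapted x Y) ⟨y, ξ⟩) := by
  obtain ⟨η, hη, hηv, -⟩ := exists_dual_frame (hA.frame_indep y hy)
  obtain ⟨D, hD⟩ := exists_dual_of_wedgeDiff_ne_zero (hA.coord_indep y hy)
  choose w hw using fun i => A.exists_hasBracketAt (hX y hy) (hA.frame_smooth i y hy)
  have hμev : ∀ᶠ z in 𝓝 y, μ z = h z • wedgeDiff (𝓡 m) x z := by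
    filter_upwards [hA.isOpen.mem_nhds hy] with z hz
    exact hμ z hz
  have hν := hasLieDerivAt_of_eq_smul_wedgeDiff (A.smoothFieldAt_anchor (hX y hy))
    (fun b => hA.coord_smooth b y hy) ((hh y hy).mdifferentiableAt (by simp)) hμev
    (A := fun b c => dirDeriv (𝓡 m) (fun z => dirDeriv (𝓡 m) (x b) z (A.anchor X z)) y (D c))
    fun b v => dirDeriv_eq_sum_dual (by simp) hD _ v
  set S := ∑ b, dirDeriv (𝓡 m) (fun z => dirDeriv (𝓡 m) (x b) z (A.anchor X z)) y (D b) with hS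
  set T := ∑ i, (η i (w i) : ℝ) with hT
  set r := dirDeriv (𝓡 m) h y (A.anchor X y) with hr
  -- The numerator is the scaled divergence, which carries a factor `h`; the quotient is the
  -- divergence itself and does not involve `ξ`.
  refine ⟨(r + h y * (S + T)) / h y, ⟨w, _, hw, hν, ?_⟩, fun ξ => ?_⟩
  · rw [sum_wedgeTensor_update hηv, ← hT, hμ y hy, wedgeTensor_smul, wedgeTensor_smul, smul_smul,
      smul_smul, ← add_smul]
    congr 1
    field_simp [hh0 y hy]
    ring
  · choose u hu hu' using fun b => exists_horizontal (p := ⟨y, ξ⟩)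
      (fun i => hA.frame_smooth i y hy) hη (D b)
    have he := adapted_dual (p := ⟨y, ξ⟩) (fun b => hA.coord_smooth b y hy)
      (fun i => hA.frame_smooth i y hy) hD hη hu hu'
    have h1 := hasLieDerivAt_hamiltonianField (A := A) (p := ⟨y, ξ⟩)
      (fun k => hA.contMDiffAt_adapted hy k) he (contMDiffAt_basic (hh y hy))
      (contMDiffAt_iota (hX y hy)) (Filter.Eventually.of_forall fun q => rfl)
    rw [A.scaledDiv_iota hA (p := ⟨y, ξ⟩) hy (hh y hy) hu η hX hw] at h1
    rw [smul_smul, div_mul_cancel₀ _ (hh0 y hy)]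
    exact h1

/-- The divergence of `X_H` is obtained by differentiating `H` in the direction of the vertical lift
of the modular form. -/
theorem hasLieDerivAt_of_frame (hA : AdaptedFrame U x Y) {h : M → ℝ}
    (hh : ∀ y ∈ U, ContMDiffAt (𝓡 m) 𝓘(ℝ, ℝ) ∞ h y)
    {p : DualTotal n E} (hp : p.1 ∈ U) {c : Fin n → ℝ}
    (hc : ∀ i, HasLieDerivAt (dualModel m n) (hamiltonianField A.bivector (iota n (Y i)))
      (fun q => basic n h q • wedgeDiff (dualModel m n) (adapted x Y) q) p
      (c i • h p.1 • wedgeDiff (dualModel m n) (adapted x Y) p))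
    {η : Fin n → DualBundle E p.1}
    (hη : ∀ i j, (η i (Y j p.1) : ℝ) = if i = j then 1 else 0)
    {H : DualTotal n E → ℝ} (hH : ContMDiffAt (dualModel m n) 𝓘(ℝ, ℝ) ∞ H p) :
    HasLieDerivAt (dualModel m n) (hamiltonianField A.bivector H)
      (fun q => basic n h q • wedgeDiff (dualModel m n) (adapted x Y) q) p
      ((∑ i, c i * dirDeriv (dualModel m n) H p (vlift p (η i))) •
        h p.1 • wedgeDiff (dualModel m n) (adapted x Y) p) := by
  obtain ⟨D, hD⟩ := exists_dual_of_wedgeDiff_ne_zero (hA.coord_indep p.1 hp)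
  have hx b := hA.coord_smooth b p.1 hp
  have hY i := hA.frame_smooth i p.1 hp
  choose u hu hu' using fun b => exists_horizontal hY hη (D b)
  have he := adapted_dual hx hY hD hη hu hu'
  have hf k := hA.contMDiffAt_adapted hp k
  have hw0 := wedgeDiff_adapted_ne_zero hx (hA.coord_indep _ hp) hY (hA.frame_indep _ hp)
  have hL {G : DualTotal n E → ℝ} (hG : ContMDiffAt (dualModel m n) 𝓘(ℝ, ℝ) ∞ G p) :=
    hasLieDerivAt_hamiltonianField (A := A) hf he (contMDiffAt_basic (hh _ hp)) hG
      (θ := fun q => basic n h q • wedgeDiff (dualModel m n) (adapted x Y) q)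
      (Filter.Eventually.of_forall fun q => rfl)
  have h1 (i : Fin n) : A.scaledDiv (adapted x Y) (basic n h) p
      (Fin.append u fun i => vlift p (η i)) (iota n (Y i)) = c i * h p.1 := by
    have := (hL (contMDiffAt_iota (hY i))).unique (hc i)
    rw [smul_smul] at this
    exact eq_of_smul_eq_smul_of_ne_zero hw0 this
  have h2 := hL hH
  -- Of the adapted coordinates only the linear ones contribute, and their dual vectors are the
  -- vertical lifts of the `ηᵢ`.
  rw [A.scaledDiv_eq_sum hf he _ hH, Fin.sum_univ_add] at h2
  simp only [adapted_castAdd, adapted_natAdd, Fin.append_left, Fin.append_right, h1,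
    A.scaledDiv_basic hA hp (hh _ hp) u η, mul_zero, Finset.sum_const_zero, zero_add] at h2
  have h3 : (∑ i, c i * dirDeriv (dualModel m n) H p (vlift p (η i))) * h p.1
      = ∑ i, dirDeriv (dualModel m n) H p (vlift p (η i)) * (c i * h p.1) := by
    rw [Finset.sum_mul]
    exact Finset.sum_congr rfl fun i _ => by ring
  rw [smul_smul, h3]
  exact h2

end SkewAlgebroid

end LocalFormula

/-! ### The Euler field and homogeneous densities. -/

section Euler

variable {m n : ℕ} {M : Type*} [TopologicalSpace M] [ChartedSpace (EuclideanSpace ℝ (Fin m)) M]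
  {E : M → Type*} [∀ x, AddCommGroup (E x)] [∀ x, Module ℝ (E x)]
  [TopologicalSpace (TotalSpace (Fib n) E)] [∀ x, TopologicalSpace (E x)]
  [FiberBundle (Fib n) E] [VectorBundle ℝ (Fib n) E]
  [IsManifold (𝓡 m) ∞ M] [ContMDiffVectorBundle ∞ (Fib n) E (𝓡 m)]

variable (m n E) in
/-- Multiplication by scalars on the dual bundle is smooth. -/
lemma contMDiff_fibreSmul :
    ContMDiff (𝓘(ℝ, ℝ).prod (dualModel m n)) (dualModel m n) ∞
      (fun z : ℝ × DualTotal n E => (⟨z.2.1, z.1 • z.2.2⟩ : DualTotal n E)) := by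
  rintro ⟨t, p⟩
  rw [contMDiffAt_totalSpace]
  refine ⟨(contMDiff_dualProj.comp contMDiff_snd).contMDiffAt, ?_⟩
  let e := trivializationAt (DualFib n) (DualBundle E) p.1
  have h1 : ContMDiffAt (𝓘(ℝ, ℝ).prod (dualModel m n)) 𝓘(ℝ, DualFib n) ∞
      (fun z : ℝ × DualTotal n E => z.1 • (e z.2).2) (t, p) := by
    have h2 : ContMDiffAt (dualModel m n) (dualModel m n) ∞ (fun q : DualTotal n E => q) p :=
      contMDiffAt_id
    have h3 := (contMDiffAt_totalSpace.mp h2).2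
    exact contMDiffAt_fst.smul
      (ContMDiffAt.comp (g := fun q : DualTotal n E => (e q).2) (t, p) h3 contMDiffAt_snd)
  refine h1.congr_of_eventuallyEq ?_
  have h4 : ∀ᶠ z : ℝ × DualTotal n E in 𝓝 (t, p), z.2.1 ∈ e.baseSet :=
    continuousAt_snd.eventually (eventually_proj_mem e.open_baseSet
      (FiberBundle.mem_baseSet_trivializationAt' p.1))
  filter_upwards [h4] with z hz
  exact (e.linear ℝ hz).map_smul z.1 z.2.2

/-- The Euler field is the image of the smooth field `(∂_t, 0)` along `t = 1` under the tangent map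
of scalar multiplication. -/
lemma smoothFieldAt_eulerField (p : DualTotal n E) :
    SmoothFieldAt (dualModel m n) (eulerField m n E) p := by
  have h1 := (contMDiff_fibreSmul m n E).contMDiff_tangentMap (m := ∞) le_rfl
  have h2 : ContMDiff (dualModel m n) (𝓘(ℝ, ℝ).prod (dualModel m n)).tangent ∞
      (fun q : DualTotal n E => (equivTangentBundleProd 𝓘(ℝ, ℝ) ℝ (dualModel m n)
        (DualTotal n E)).symm (⟨1, (1 : ℝ)⟩, ⟨q, 0⟩)) :=
    contMDiff_equivTangentBundleProd_symm.comp
      (contMDiff_const.prodMk (Bundle.contMDiff_zeroSection ℝ _))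
  have h3 := (h1.comp h2).contMDiffAt (x := p)
  refine h3.congr_of_eventuallyEq (Filter.Eventually.of_forall fun q => ?_)
  have hq : (⟨q.1, (1 : ℝ) • q.2⟩ : DualTotal n E) = q := by simp
  have h4 := mfderiv_comp_apply (I := 𝓘(ℝ, ℝ)) (I' := 𝓘(ℝ, ℝ).prod (dualModel m n))
    (I'' := dualModel m n) (x := (1 : ℝ)) (f := fun t : ℝ => (t, q))
    (g := fun z : ℝ × DualTotal n E => (⟨z.2.1, z.1 • z.2.2⟩ : DualTotal n E))
    (((contMDiff_fibreSmul m n E).contMDiffAt).mdifferentiableAt (by simp))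
    ((contMDiff_id.prodMk contMDiff_const).contMDiffAt (n := ∞).mdifferentiableAt (by simp)) (1 : ℝ)
  rw [mfderiv_prod_left] at h4
  -- The tangent map lands over `1 • q`, which equals `q` but not definitionally, so the base point
  -- has to be transported.
  have h5 : (⟨q, eulerField m n E q⟩ : TangentBundle (dualModel m n) (DualTotal n E))
      = ⟨⟨q.1, (1 : ℝ) • q.2⟩, eulerField m n E q⟩ :=
    congrArg (fun z : DualTotal n E =>
      (⟨z, (eulerField m n E q : EuclideanSpace ℝ (Fin m) × DualFib n)⟩ :
        TangentBundle (dualModel m n) (DualTotal n E))) hq.symm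
  exact h5.trans <| congrArg (fun v : EuclideanSpace ℝ (Fin m) × DualFib n =>
    (⟨⟨q.1, (1 : ℝ) • q.2⟩, v⟩ : TangentBundle (dualModel m n) (DualTotal n E))) h4

lemma dirDeriv_eulerField_basic {f : M → ℝ} {p : DualTotal n E}
    (hf : ContMDiffAt (𝓡 m) 𝓘(ℝ, ℝ) ∞ f p.1) :
    dirDeriv (dualModel m n) (basic n f) p (eulerField m n E p) = 0 := by
  rw [dirDeriv_eulerField ((contMDiffAt_basic hf).mdifferentiableAt (by simp))]
  exact deriv_const 1 (f p.1)

lemma dirDeriv_eulerField_iota {Y : ∀ x, E x} {p : DualTotal n E}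
    (hY : SmoothSectionAt m n Y p.1) :
    dirDeriv (dualModel m n) (iota n Y) p (eulerField m n E p) = iota n Y p := by
  rw [dirDeriv_eulerField ((contMDiffAt_iota hY).mdifferentiableAt (by simp))]
  have h : HasDerivAt (fun t : ℝ => t * iota n Y p) (1 * iota n Y p) 1 :=
    (hasDerivAt_id 1).mul_const _
  rw [one_mul] at h
  exact h.deriv

variable {U : Set M} {x : Fin m → M → ℝ} {Y : Fin n → ∀ y, E y}

lemma hasLieDerivAt_eulerField (hA : AdaptedFrame U x Y) {p : DualTotal n E} (hp : p.1 ∈ U)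
    {k : DualTotal n E → ℝ} (hk : ContMDiffAt (dualModel m n) 𝓘(ℝ, ℝ) ∞ k p)
    {θ : ∀ q : DualTotal n E, TangentSpace (dualModel m n) q [⋀^Fin (m + n)]→ₗ[ℝ] ℝ}
    (hθ : ∀ᶠ q in 𝓝 p, θ q = k q • wedgeDiff (dualModel m n) (adapted x Y) q) :
    HasLieDerivAt (dualModel m n) (eulerField m n E) θ p
      ((dirDeriv (dualModel m n) k p (eulerField m n E p) + k p * n) •
        wedgeDiff (dualModel m n) (adapted x Y) p) := by
  -- The Euler field kills basic functions and fixes linear ones, so its Jacobian is diagonal with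
  -- entries `0` and `1` and trace `n`.
  let δ : Fin (m + n) → ℝ := Fin.append (fun _ : Fin m => 0) fun _ : Fin n => 1
  have hδ : ∑ i, Matrix.diagonal δ i i = n := by
    simp [Fin.sum_univ_add, δ]
  rw [← hδ]
  refine hasLieDerivAt_of_eq_smul_wedgeDiff (smoothFieldAt_eulerField p)
    (hA.contMDiffAt_adapted hp) (hk.mdifferentiableAt (by simp)) hθ fun i v => ?_
  have h1 : ∑ l, Matrix.diagonal δ i l * dirDeriv (dualModel m n) (adapted x Y l) p v
      = δ i * dirDeriv (dualModel m n) (adapted x Y i) p v := by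
    rw [Finset.sum_eq_single i]
    · simp
    · intro l _ hl
      rw [Matrix.diagonal_apply_ne' _ hl, zero_mul]
    · simp
  rw [h1]
  refine Fin.addCases (fun b => ?_) (fun j => ?_) i
  · simp only [adapted_castAdd, δ, Fin.append_left, zero_mul]
    rw [← dirDeriv_const (I := dualModel m n) 0 p v]
    apply dirDeriv_congr
    filter_upwards [eventually_proj_mem hA.isOpen hp] with q hq
    exact dirDeriv_eulerField_basic (hA.coord_smooth b _ hq)
  · simp only [adapted_natAdd, δ, Fin.append_right, one_mul]
    apply dirDeriv_congr
    filter_upwards [eventually_proj_mem hA.isOpen hp] with q hq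
    exact dirDeriv_eulerField_iota (hA.frame_smooth j _ hq)

lemma toAbs_smul_eq_iff {W : Type*} [AddCommGroup W] [Module ℝ W] {w : W} (hw : w ≠ 0) {a b : ℝ} :
    toAbs (a • w) = toAbs (b • w) ↔ a ^ 2 = b ^ 2 := by
  rw [toAbs_eq_iff, sq_eq_sq_iff_eq_or_eq_neg, ← neg_smul]
  exact or_congr (smul_left_injective ℝ hw).eq_iff (smul_left_injective ℝ hw).eq_iff

/-- Near each point a density on `E*` is represented by `k dx¹ ∧ … ∧ dι(Yₙ)`. -/
lemma Density.exists_coeff (Ω : DualDensity m n E) (hA : AdaptedFrame U x Y) {p : DualTotal n E}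
    (hp : p.1 ∈ U) :
    ∃ (W : Set (DualTotal n E)) (k : DualTotal n E → ℝ), IsOpen W ∧ p ∈ W ∧ (∀ q ∈ W, q.1 ∈ U) ∧
      (∀ q ∈ W, ContMDiffAt (dualModel m n) 𝓘(ℝ, ℝ) ∞ k q) ∧
        ∀ q ∈ W, toAbs (k q • wedgeDiff (dualModel m n) (adapted x Y) q) = Ω.val q := by
  obtain ⟨W, hW, hpW, θ, hθ, hΩ⟩ := Ω.locally_smooth p
  have hopen : IsOpen {q : DualTotal n E | q.1 ∈ U} :=
    hA.isOpen.preimage (FiberBundle.continuous_proj (DualFib n) (DualBundle E))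
  obtain ⟨k, hk, hkθ⟩ := exists_eq_smul_wedgeDiff (I := dualModel m n) (f := adapted x Y)
    (finrank_dualModel m n)
    (hW.inter hopen) (fun i q hq => hA.contMDiffAt_adapted hq.2 i) (fun q hq =>
      wedgeDiff_adapted_ne_zero (fun b => hA.coord_smooth b _ hq.2) (hA.coord_indep _ hq.2)
        (fun i => hA.frame_smooth i _ hq.2) (hA.frame_indep _ hq.2))
    (fun q hq => hθ q hq.1)
  exact ⟨_, k, hW.inter hopen, ⟨hpW, hp⟩, fun q hq => hq.2, hk, fun q hq => by
    rw [← hkθ q hq, hΩ q hq.1]⟩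

/-- A homogeneous density on `E*` is constant along the fibres. -/
lemma toAbs_eq_of_isHomogeneous {Ω : DualDensity m n E} (hΩ : IsHomogeneous Ω)
    (hA : AdaptedFrame U x Y) {y : M} (hy : y ∈ U) {h : ℝ}
    (h0 : toAbs (h • wedgeDiff (dualModel m n) (adapted x Y) (⟨y, 0⟩ : DualTotal n E))
      = Ω.val ⟨y, 0⟩) (ξ : DualBundle E y) :
    toAbs (h • wedgeDiff (dualModel m n) (adapted x Y) (⟨y, ξ⟩ : DualTotal n E))
      = Ω.val ⟨y, ξ⟩ := by
  have hw {q : DualTotal n E} (hq : q.1 ∈ U) :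
      wedgeDiff (dualModel m n) (adapted x Y) q ≠ 0 :=
    wedgeDiff_adapted_ne_zero (fun b => hA.coord_smooth b _ hq) (hA.coord_indep _ hq)
        (fun i => hA.frame_smooth i _ hq) (hA.frame_indep _ hq)
  have hex (q : DualTotal n E) : ∃ c : ℝ, q.1 ∈ U →
      toAbs (c • wedgeDiff (dualModel m n) (adapted x Y) q) = Ω.val q := by
    by_cases hq : q.1 ∈ U
    · obtain ⟨W, k, -, hqW, -, -, hk⟩ := Ω.exists_coeff hA hq
      exact ⟨k q, fun _ => hk q hqW⟩
    · exact ⟨0, fun h => absurd h hq⟩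
  choose c hc using hex
  -- The coefficients `c` are chosen point by point with arbitrary signs. Their square is
  -- insensitive to the sign, hence locally the square of a smooth coefficient.
  let K : DualTotal n E → ℝ := fun q => c q ^ 2
  have hK {q : DualTotal n E} (hq : q.1 ∈ U) :
      MDifferentiableAt (dualModel m n) 𝓘(ℝ, ℝ) K q ∧
        dirDeriv (dualModel m n) K q (eulerField m n E q) = 0 := by
    obtain ⟨W, k, hW, hqW, hWU, hks, hk⟩ := Ω.exists_coeff hA hq
    have hkq : MDifferentiableAt (dualModel m n) 𝓘(ℝ, ℝ) k q :=
      (hks q hqW).mdifferentiableAt (by simp)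
    have hev : K =ᶠ[𝓝 q] fun z => k z * k z := by
      filter_upwards [hW.mem_nhds hqW] with z hz
      have := (toAbs_smul_eq_iff (hw (hWU z hz))).mp ((hc z (hWU z hz)).trans (hk z hz).symm)
      simp only [K]
      rw [this, sq]
    refine ⟨(hkq.mul hkq).congr_of_eventuallyEq hev, ?_⟩
    have h1 := hΩ W (fun z => k z • wedgeDiff (dualModel m n) (adapted x Y) z) hW
      (smoothFormOn_smul_wedgeDiff (fun i z hz => hA.contMDiffAt_adapted (hWU z hz) i) hks)
      hk q hqW
    have h2 := hasLieDerivAt_eulerField hA hq (hks q hqW)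
      (Filter.Eventually.of_forall fun z => rfl)
    have h3 := h1.unique h2
    rw [smul_smul] at h3
    have h4 := eq_of_smul_eq_smul_of_ne_zero (hw hq) h3
    -- Homogeneity of degree `n` is already accounted for by the `n` linear coordinates, so nothing
    -- is left for the coefficient.
    have h5 : dirDeriv (dualModel m n) k q (eulerField m n E q) = 0 := by linarith
    rw [dirDeriv_congr hev, dirDeriv_mul hkq hkq, h5]
    ring
  let g : ℝ → ℝ := fun t => K ⟨y, t • ξ⟩
  have hg : Differentiable ℝ g := by
    intro t
    have h1 := contMDiff_fibreLine (m := m) (n := n) y 0 ξ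
    simp only [zero_add] at h1
    have h2 := MDifferentiableAt.comp (I := 𝓘(ℝ, ℝ)) (I' := dualModel m n) (I'' := 𝓘(ℝ, ℝ))
      (g := K) (f := fun t : ℝ => (⟨y, t • ξ⟩ : DualTotal n E)) t (hK (q := ⟨y, t • ξ⟩) hy).1
      (h1.contMDiffAt.mdifferentiableAt (by simp))
    exact mdifferentiableAt_iff_differentiableAt.mp h2
  -- The Euler derivative of `K` at `tξ` is `t g'(t)`, which gives no information at `t = 0`. The
  -- mean value theorem on `[0, 1]` needs only interior points.
  have hg' (t : ℝ) (ht : t ≠ 0) : deriv g t = 0 := by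
    have h1 := (hK (q := ⟨y, t • ξ⟩) hy).2
    rw [dirDeriv_eulerField (hK (q := ⟨y, t • ξ⟩) hy).1] at h1
    have h2 : (fun s : ℝ => K ⟨y, s • t • ξ⟩) = fun s : ℝ => g (t * s) := by
      funext s
      simp only [g, smul_smul, mul_comm]
    have h3 : HasDerivAt (fun s : ℝ => g (t * s)) (deriv g t * t) 1 := by
      have h4 : HasDerivAt g (deriv g t) (t * 1) := by
        rw [mul_one]; exact (hg t).hasDerivAt
      have h5 : HasDerivAt (fun s : ℝ => t * s) t 1 := by
        simpa using (hasDerivAt_id (1 : ℝ)).const_mul t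
      exact h4.comp 1 h5
    simp only at h1
    rw [h2, h3.deriv] at h1
    exact (mul_eq_zero.mp h1).resolve_right ht
  obtain ⟨t, ht, ht'⟩ := exists_deriv_eq_slope g zero_lt_one hg.continuous.continuousOn
    hg.differentiableOn
  rw [hg' t ht.1.ne'] at ht'
  have h6 : g 1 = g 0 := by
    have : g 1 - g 0 = 0 := by simpa using ht'.symm
    linarith
  simp only [g, K, one_smul, zero_smul] at h6
  rw [← hc ⟨y, ξ⟩ hy, toAbs_smul_eq_iff (hw hy), h6, ← toAbs_smul_eq_iff (hw (q := ⟨y, 0⟩) hy),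
    h0, hc ⟨y, 0⟩ hy]

end Euler

/-! ### Existence and smoothness of bundle metrics. -/

section Metric

/-- A finite-dimensional space carries a scalar product. -/
lemma exists_scalarProduct (F : Type*) [NormedAddCommGroup F] [NormedSpace ℝ F]
    [FiniteDimensional ℝ F] :
    ∃ B : F →L[ℝ] F →L[ℝ] ℝ, (∀ v w, B v w = B w v) ∧ ∀ v, v ≠ 0 → 0 < B v v := by
  let b := Module.finBasis ℝ F
  let l : Fin (Module.finrank ℝ F) → F →L[ℝ] ℝ := fun i => (b.coord i).toContinuousLinearMap
  have hB (v w : F) : (∑ i, (l i).smulRight (l i)) v w = ∑ i, l i v * l i w := by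
    simp [sum_apply]
  refine ⟨∑ i, (l i).smulRight (l i), fun v w => ?_, fun v hv => ?_⟩
  · rw [hB, hB]
    exact Finset.sum_congr rfl fun i _ => mul_comm _ _
  · rw [hB]
    have h : ∃ i, l i v ≠ 0 := by
      by_contra! h
      exact hv (b.forall_coord_eq_zero_iff.mp h)
    obtain ⟨i, hi⟩ := h
    exact Finset.sum_pos' (fun j _ => mul_self_nonneg _) ⟨i, Finset.mem_univ i, mul_self_pos.mpr hi⟩

/-- The unit ball of a scalar product on a finite-dimensional space is bounded. -/
lemma isVonNBounded_unitBall {F : Type*} [NormedAddCommGroup F] [NormedSpace ℝ F]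
    [FiniteDimensional ℝ F] {B : F →L[ℝ] F →L[ℝ] ℝ} (hB : ∀ v, v ≠ 0 → 0 < B v v) :
    Bornology.IsVonNBounded ℝ {v : F | B v v < 1} := by
  rw [NormedSpace.isVonNBounded_iff']
  have : ProperSpace F := FiniteDimensional.proper ℝ F
  have hc : Continuous fun v : F => B v v := by fun_prop
  rcases subsingleton_or_nontrivial F with hF | hF
  · exact ⟨0, fun v _ => by rw [Subsingleton.elim v 0, norm_zero]⟩
  obtain ⟨u, hu, hmin⟩ := (isCompact_sphere (0 : F) 1).exists_isMinOn
    (NormedSpace.sphere_nonempty.mpr zero_le_one) hc.continuousOn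
  have hu1 : ‖u‖ = 1 := by simpa using hu
  have hu0 : 0 < B u u := hB u (by rintro rfl; simp at hu1)
  -- With `B u u` the minimum on the unit sphere, `B u u * ‖v‖ ^ 2 < 1`. The bound avoids a square
  -- root: a larger `‖v‖` would exceed both `1` and `1 / B u u`.
  refine ⟨1 / B u u + 1, fun v hv => ?_⟩
  rcases eq_or_ne v 0 with rfl | hv0
  · rw [norm_zero]; positivity
  have hn : 0 < ‖v‖ := norm_pos_iff.mpr hv0
  have h1 : B u u ≤ B (‖v‖⁻¹ • v) (‖v‖⁻¹ • v) := hmin (by simp [norm_smul, hn.ne'])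
  have h2 : B (‖v‖⁻¹ • v) (‖v‖⁻¹ • v) = ‖v‖⁻¹ * (‖v‖⁻¹ * B v v) := by simp
  have hv1 : B v v < 1 := hv
  have h3 : B u u * ‖v‖ ^ 2 < 1 := by
    rw [h2] at h1
    calc B u u * ‖v‖ ^ 2 ≤ ‖v‖⁻¹ * (‖v‖⁻¹ * B v v) * ‖v‖ ^ 2 := by gcongr
      _ = B v v := by field_simp
      _ < 1 := hv1
  by_contra! h4
  have h5 : 1 / B u u ≤ 1 / B u u * ‖v‖ := by
    have : 1 ≤ ‖v‖ := by
      have : 0 < 1 / B u u := by positivity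
      linarith
    exact le_mul_of_one_le_right (by positivity) this
  have h6 : 1 / B u u < ‖v‖ := by linarith
  have h7 : 1 < B u u * ‖v‖ := by rwa [div_lt_iff₀' hu0] at h6
  have h8 : 1 ≤ ‖v‖ := by
    have : 0 < 1 / B u u := by positivity
    linarith
  nlinarith [mul_le_mul_of_nonneg_left h8 (by positivity : 0 ≤ B u u * ‖v‖)]

variable {m : ℕ} {M : Type*} [TopologicalSpace M] [ChartedSpace (EuclideanSpace ℝ (Fin m)) M]
  [IsManifold (𝓡 m) ∞ M]

set_option synthInstance.maxHeartbeats 200000 in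
/-- A smooth vector bundle over a σ-compact Hausdorff manifold carries a smooth metric. -/
lemma nonempty_contMDiffRiemannianMetric [T2Space M] [SigmaCompactSpace M]
    (F : Type*) [NormedAddCommGroup F] [NormedSpace ℝ F] [FiniteDimensional ℝ F]
    (V : M → Type*) [∀ x, AddCommGroup (V x)] [∀ x, Module ℝ (V x)]
    [∀ x, TopologicalSpace (V x)] [TopologicalSpace (TotalSpace F V)]
    [FiberBundle F V] [VectorBundle ℝ F V] [ContMDiffVectorBundle ∞ F V (𝓡 m)] :
    Nonempty (ContMDiffRiemannianMetric (𝓡 m) ∞ F V) := by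
  obtain ⟨B, hBs, hBp⟩ := exists_scalarProduct F
  -- Symmetric positive definite forms are a convex condition on each fibre, so local solutions glue
  -- by a partition of unity.
  obtain ⟨g, hg⟩ := exists_contMDiffSection_forall_mem_convex_of_local (𝓡 m) (n := ⊤)
    (F_fiber := F →L[ℝ] F →L[ℝ] ℝ) (fun x => V x →L[ℝ] V x →L[ℝ] ℝ)
    (fun x => {b | (∀ v w, (b v w : ℝ) = b w v) ∧ ∀ v, v ≠ 0 → (0 : ℝ) < b v v})
    (by
      rintro x b ⟨hb, hb'⟩ c ⟨hc, hc'⟩ s t hs ht hst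
      refine ⟨fun v w => ?_, fun v hv => ?_⟩
      · change s * (b v w : ℝ) + t * (c v w : ℝ) = s * (b w v : ℝ) + t * (c w v : ℝ)
        rw [hb v w, hc v w]
      · change 0 < s * (b v v : ℝ) + t * (c v v : ℝ)
        have h1 := hb' v hv
        have h2 := hc' v hv
        rcases hs.eq_or_lt with rfl | hs
        · rw [zero_add] at hst
          subst hst
          simpa using h2
        · positivity)
    (fun x₀ => by
      let e := trivializationAt F V x₀
      -- The local solution is the pull-back of `B` under a trivialization; in the induced
      -- coordinates it is constant.
      let s : ∀ x, V x →L[ℝ] V x →L[ℝ] ℝ := fun x =>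
        ((e.continuousLinearMapAt ℝ x).precomp ℝ).comp (B.comp (e.continuousLinearMapAt ℝ x))
      have hs (x : M) (v w : V x) :
          s x v w = B (e.continuousLinearMapAt ℝ x v) (e.continuousLinearMapAt ℝ x w) := rfl
      refine ⟨e.baseSet, e.open_baseSet.mem_nhds (FiberBundle.mem_baseSet_trivializationAt' x₀),
        s, ?_, fun x hx => ⟨fun v w => ?_, fun v hv => ?_⟩⟩
      · let e' := trivializationAt (F →L[ℝ] F →L[ℝ] ℝ) (fun x => V x →L[ℝ] V x →L[ℝ] ℝ) x₀
        refine (e'.contMDiffOn_section_iff e.open_baseSet ?_).mpr ?_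
        · intro x hx
          exact ⟨hx, hx, mem_univ _⟩
        · refine (contMDiffOn_const (c := B)).congr fun x hx => ?_
          ext v w
          have h1 := inCoordinates_apply_eq₂ (F₁ := F) (E₁ := V) (F₂ := F) (E₂ := V) (F₃ := ℝ)
            (E₃ := Bundle.Trivial M ℝ) (x₀ := x₀) (ϕ := s x) (v := v) (w := w) hx hx (mem_univ _)
          refine h1.trans ?_
          rw [Trivialization.linearMapAt_apply]
          refine (if_pos (mem_univ _)).trans ?_
          change s x (e.symm x v) (e.symm x w) = B v w
          rw [hs, ← e.symmL_apply (R := ℝ) hx, ← e.symmL_apply (R := ℝ) hx,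
            e.continuousLinearMapAt_symmL hx, e.continuousLinearMapAt_symmL hx]
      · rw [hs, hs, hBs]
      · rw [hs]
        refine hBp _ fun h0 => hv ?_
        rw [← e.symmL_continuousLinearMapAt (R := ℝ) hx v, h0, map_zero])
  refine ⟨⟨fun x => g x, fun x => (hg x).1, fun x => (hg x).2, fun x => ?_, g.contMDiff⟩⟩
  -- The remaining condition is boundedness of the unit ball of `g x`. The fibre has only a
  -- topology, so the bound is obtained in the normed model fibre and carried back.
  let L := (trivializationAt F V x).continuousLinearEquivAt ℝ x
    (FiberBundle.mem_baseSet_trivializationAt' x)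
  have h := isVonNBounded_unitBall 
    (B := ((L.symm : F →L[ℝ] V x).precomp ℝ).comp ((g x).comp (L.symm : F →L[ℝ] V x)))
    (fun v hv => (hg x).2 (L.symm v) (by simpa using hv))
  refine Bornology.IsVonNBounded.subset ?_ (h.image (L.symm : F →L[ℝ] V x))
  intro v hv
  refine ⟨L v, ?_, L.symm_apply_apply v⟩
  have hv1 : g x v v < 1 := hv
  change g x (L.symm (L v)) (L.symm (L v)) < 1
  rwa [L.symm_apply_apply]

set_option synthInstance.maxHeartbeats 200000 in
lemma contMDiff_metric_apply_self {F : Type*} [NormedAddCommGroup F] [NormedSpace ℝ F]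
    {V : M → Type*} [∀ x, AddCommGroup (V x)] [∀ x, Module ℝ (V x)]
    [∀ x, TopologicalSpace (V x)] [TopologicalSpace (TotalSpace F V)]
    [FiberBundle F V] [VectorBundle ℝ F V] [ContMDiffVectorBundle ∞ F V (𝓡 m)]
    (g : ContMDiffRiemannianMetric (𝓡 m) ∞ F V) :
    ContMDiff ((𝓡 m).prod 𝓘(ℝ, F)) 𝓘(ℝ, ℝ) ∞
      (fun p : TotalSpace F V => g.inner p.1 p.2 p.2) := by
  intro p
  have hg : ContMDiffAt ((𝓡 m).prod 𝓘(ℝ, F)) ((𝓡 m).prod 𝓘(ℝ, F →L[ℝ] F →L[ℝ] ℝ)) ∞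
      (fun q : TotalSpace F V => TotalSpace.mk' (F →L[ℝ] F →L[ℝ] ℝ)
        (E := fun x => V x →L[ℝ] V x →L[ℝ] Bundle.Trivial M ℝ x) q.1 (g.inner q.1)) p :=
    ContMDiffAt.comp p g.contMDiff.contMDiffAt (Bundle.contMDiff_proj V).contMDiffAt
  have h2 : ContMDiffAt ((𝓡 m).prod 𝓘(ℝ, F)) ((𝓡 m).prod 𝓘(ℝ, F)) ∞
      (fun q : TotalSpace F V => TotalSpace.mk' F (E := V) q.1 q.2) p := contMDiffAt_id
  exact (contMDiffAt_totalSpace.mp (ContMDiffAt.clm_bundle_apply₂ (F₁ := F) (F₂ := F) (F₃ := ℝ)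
    (E₁ := V) (E₂ := V) (E₃ := Bundle.Trivial M ℝ) (b := fun q : TotalSpace F V => q.1)
    (ψ := fun q => g.inner q.1) (v := fun q => q.2) (w := fun q => q.2) hg h2 h2)).2

end Metric

/-! ### Rescaling a form by a function. -/

section LieDerivProduct

variable {V : Type*} [NormedAddCommGroup V] [NormedSpace ℝ V] {H : Type*} [TopologicalSpace H]
  {I : ModelWithCorners ℝ V H} {N : Type*} [TopologicalSpace N] [ChartedSpace H N]
  [IsManifold I ∞ N] {d : ℕ}

lemma HasLieDerivAt.fun_smul {X : ∀ q : N, TangentSpace I q} {p : N}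
    {θ : ∀ q : N, TangentSpace I q [⋀^Fin d]→ₗ[ℝ] ℝ} {U : Set N} (hp : p ∈ U)
    (hθ : SmoothFormOn I θ U) {a : N → ℝ} (ha : MDifferentiableAt I 𝓘(ℝ, ℝ) a p)
    {ν : TangentSpace I p [⋀^Fin d]→ₗ[ℝ] ℝ} (h : HasLieDerivAt I X θ p ν) :
    HasLieDerivAt I X (fun q => a q • θ q) p (dirDeriv I a p (X p) • θ p + a p • ν) := by
  intro v hv
  have h1 : dirDeriv I (fun q => (a q • θ q) fun i => v i q) p (X p)
      = dirDeriv I a p (X p) * θ p (fun i => v i p)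
        + a p * dirDeriv I (fun q => θ q fun i => v i q) p (X p) := by
    have := dirDeriv_mul ha ((hθ p hp v hv).mdifferentiableAt (by simp)) (X p)
    refine this.trans ?_
    ring
  rw [h1]
  simp only [AlternatingMap.add_apply, AlternatingMap.smul_apply, smul_eq_mul, ← Finset.mul_sum]
  rw [h v hv]
  ring

lemma dirDeriv_exp_neg {f : N → ℝ} {p : N} (hf : MDifferentiableAt I 𝓘(ℝ, ℝ) f p)
    (v : TangentSpace I p) :
    dirDeriv I (fun q => Real.exp (-f q)) p v = -Real.exp (-f p) * dirDeriv I f p v := by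
  have hd : HasDerivAt (fun t : ℝ => Real.exp (-t)) (-Real.exp (-f p)) (f p) := by
    simpa using (hasDerivAt_neg (f p)).exp
  have h := mfderiv_comp_apply (I := I) (I' := 𝓘(ℝ, ℝ)) (I'' := 𝓘(ℝ, ℝ)) p
    (g := fun t : ℝ => Real.exp (-t)) hd.differentiableAt.mdifferentiableAt hf v
  rw [mfderiv_eq_fderiv, hd.hasFDerivAt.fderiv] at h
  refine h.trans ?_
  rw [mul_comm]
  rfl

end LieDerivProduct

/-! ### Passage between sections of `|L^E|` and densities on `E*`. -/

section Densities

variable {m n : ℕ} {M : Type*} [TopologicalSpace M] [ChartedSpace (EuclideanSpace ℝ (Fin m)) M]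
  {E : M → Type*} [∀ x, AddCommGroup (E x)] [∀ x, Module ℝ (E x)]
  [TopologicalSpace (TotalSpace (Fib n) E)] [∀ x, TopologicalSpace (E x)]
  [FiberBundle (Fib n) E] [VectorBundle ℝ (Fib n) E]
  [IsManifold (𝓡 m) ∞ M] [ContMDiffVectorBundle ∞ (Fib n) E (𝓡 m)]

lemma AdaptedFrame.wedgeDiff_ne_zero {U : Set M} {x : Fin m → M → ℝ} {Y : Fin n → ∀ y, E y}
    (hA : AdaptedFrame U x Y) {p : DualTotal n E} (hp : p.1 ∈ U) :
    wedgeDiff (dualModel m n) (adapted x Y) p ≠ 0 :=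
  wedgeDiff_adapted_ne_zero (fun b => hA.coord_smooth b _ hp) (hA.coord_indep _ hp)
    (fun i => hA.frame_smooth i _ hp) (hA.frame_indep _ hp)

lemma AdaptedFrame.match_adapted {U : Set M} {x : Fin m → M → ℝ} {Y : Fin n → ∀ y, E y}
    (hA : AdaptedFrame U x Y) {p : DualTotal n E} (hp : p.1 ∈ U) (c : ℝ) :
    Match p (wedgeTensor (fun i => Y i p.1) (c • wedgeDiff (𝓡 m) x p.1))
      (c • wedgeDiff (dualModel m n) (adapted x Y) p) :=
  SkewAlgebroids.match_adapted (fun b => hA.coord_smooth b _ hp)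
    (fun i => hA.frame_smooth i _ hp) c

/-- Near each point a nowhere-vanishing local section `Y₁ ∧ … ∧ Yₙ ⊗ μ` of `L^E` can be written as
`h Y₁ ∧ … ∧ Yₙ ⊗ dx¹ ∧ … ∧ dx^m`. -/
lemma exists_adaptedFrame_of_section {U : Set M} (hU : IsOpen U) {Y : Fin n → ∀ y, E y}
    (hY : ∀ i, ∀ y ∈ U, SmoothSectionAt m n (Y i) y)
    {μ : ∀ y : M, TangentSpace (𝓡 m) y [⋀^Fin m]→ₗ[ℝ] ℝ} (hμ : SmoothFormOn (𝓡 m) μ U)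
    (h0 : ∀ y ∈ U, wedgeTensor (fun i => Y i y) (μ y) ≠ 0) {x₀ : M} (hx₀ : x₀ ∈ U) :
    ∃ (U' : Set M) (x : Fin m → M → ℝ) (h : M → ℝ), U' ⊆ U ∧ x₀ ∈ U' ∧ AdaptedFrame U' x Y ∧
      (∀ y ∈ U', ContMDiffAt (𝓡 m) 𝓘(ℝ, ℝ) ∞ h y) ∧ (∀ y ∈ U', h y ≠ 0) ∧
        ∀ y ∈ U', μ y = h y • wedgeDiff (𝓡 m) x y := by
  obtain ⟨W, x, hW, hxW, hx, hx'⟩ := exists_coordinates (m := m) x₀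
  obtain ⟨h, hh, hμh⟩ := exists_eq_smul_wedgeDiff (I := 𝓡 m) (f := x) (by simp) (hU.inter hW)
    (fun b y hy => hx b y hy.2) (fun y hy => hx' y hy.2) (fun y hy => hμ y hy.1)
  refine ⟨U ∩ W, x, h, inter_subset_left, ⟨hx₀, hxW⟩, ⟨hU.inter hW, fun b y hy => hx b y hy.2,
    fun y hy => hx' y hy.2, fun i y hy => hY i y hy.1,
    fun y hy => linearIndependent_of_wedgeTensor_ne_zero (h0 y hy.1)⟩, hh, fun y hy hhy => ?_, hμh⟩
  refine ne_zero_of_wedgeTensor_ne_zero (h0 y hy.1) ?_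
  rw [hμh y hy, hhy, zero_smul]

lemma AbsSection.wedgeTensor_ne_zero (σ : AbsSection m n E) {y : M} {Y : Fin n → E y}
    {μ : TangentSpace (𝓡 m) y [⋀^Fin m]→ₗ[ℝ] ℝ} (h : toAbs (wedgeTensor Y μ) = σ.val y) :
    wedgeTensor Y μ ≠ 0 := fun h0 => σ.ne_zero y (by rw [← h, h0])

/-- A nowhere-vanishing section of `|L^E|` and a nowhere-vanishing function on `M` determine a
homogeneous density on `E*`. -/
lemma exists_density_of_absSection (σ : AbsSection m n E) {a : M → ℝ}
    (ha : ContMDiff (𝓡 m) 𝓘(ℝ, ℝ) ∞ a) (ha0 : ∀ y, a y ≠ 0) :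
    ∃ Ω : DualDensity m n E, IsHomogeneous Ω ∧
      ∀ (U : Set M) (x : Fin m → M → ℝ) (Y : Fin n → ∀ y, E y) (h : M → ℝ), AdaptedFrame U x Y →
        ∀ p : DualTotal n E, p.1 ∈ U →
          toAbs (wedgeTensor (fun i => Y i p.1) (h p.1 • wedgeDiff (𝓡 m) x p.1)) = σ.val p.1 →
            toAbs (a p.1 • h p.1 • wedgeDiff (dualModel m n) (adapted x Y) p) = Ω.val p := by
  -- The representatives are chosen without any continuity; their signs disappear in `toAbs`, and
  -- smoothness is checked on local adapted representatives in `hloc`.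
  choose s hs using fun y => exists_toAbs_eq (σ.val y)
  choose θ hθ using fun p : DualTotal n E => exists_match_form p (a p.1 • s p.1)
  have hval (U : Set M) (x : Fin m → M → ℝ) (Y : Fin n → ∀ y, E y) (h : M → ℝ)
      (hA : AdaptedFrame U x Y) (p : DualTotal n E) (hp : p.1 ∈ U)
      (hσ : toAbs (wedgeTensor (fun i => Y i p.1) (h p.1 • wedgeDiff (𝓡 m) x p.1)) = σ.val p.1) :
      toAbs (a p.1 • h p.1 • wedgeDiff (dualModel m n) (adapted x Y) p) = toAbs (θ p) := by
    refine (Match.toAbs_eq ((hA.match_adapted hp (h p.1)).smul (a p.1)) (hθ p)).mp ?_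
    rw [← hs, toAbs_eq_iff] at hσ
    rw [toAbs_eq_iff]
    exact hσ.imp (fun h => by rw [h]) (fun h => by rw [h]; module)
  have hloc (p : DualTotal n E) : ∃ (U : Set M) (x : Fin m → M → ℝ) (Y : Fin n → ∀ y, E y)
      (h : M → ℝ), AdaptedFrame U x Y ∧ p.1 ∈ U ∧
        (∀ y ∈ U, ContMDiffAt (𝓡 m) 𝓘(ℝ, ℝ) ∞ h y) ∧
        ∀ q : DualTotal n E, q.1 ∈ U →
          toAbs (basic n (fun y => a y * h y) q • wedgeDiff (dualModel m n) (adapted x Y) q)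
            = toAbs (θ q) := by
    obtain ⟨U, hU, hpU, Y, μ, hY, hμ, hσ⟩ := σ.locally_smooth p.1
    obtain ⟨U', x, h, hU', hpU', hA, hh, -, hμh⟩ := exists_adaptedFrame_of_section hU hY hμ
      (fun y hy => σ.wedgeTensor_ne_zero (hσ y hy)) hpU
    refine ⟨U', x, Y, h, hA, hpU', hh, fun q hq => ?_⟩
    rw [← hval U' x Y h hA q hq (by rw [← hμh _ hq, hσ _ (hU' hq)]), smul_smul]
    rfl
  have hpre {U : Set M} (hU : IsOpen U) : IsOpen {q : DualTotal n E | q.1 ∈ U} :=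
    hU.preimage (FiberBundle.continuous_proj (DualFib n) (DualBundle E))
  let Ω : DualDensity m n E :=
    { val := fun p => toAbs (θ p)
      ne_zero := fun p h0 => by
        have h1 : a p.1 • s p.1 = 0 := (hθ p).eq_zero_iff.mpr (toAbs_eq_zero_iff.mp h0)
        refine σ.ne_zero p.1 ?_
        rw [← hs, (smul_eq_zero.mp h1).resolve_left (ha0 _)]
      locally_smooth := fun p => by
        obtain ⟨U, x, Y, h, hA, hp, hh, hq⟩ := hloc p
        exact ⟨_, hpre hA.isOpen, hp, _, smoothFormOn_smul_wedgeDiff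
          (fun i q hq => hA.contMDiffAt_adapted hq i)
          (fun q hq => contMDiffAt_basic (ha.contMDiffAt.mul (hh _ hq))), hq⟩ }
  refine ⟨Ω, Density.lieEq_of_local fun p => ?_, hval⟩
  obtain ⟨U, x, Y, h, hA, hp, hh, hq⟩ := hloc p
  refine ⟨_, _, hpre hA.isOpen, hp, smoothFormOn_smul_wedgeDiff
    (fun i q hq => hA.contMDiffAt_adapted hq i)
    (fun q hq => contMDiffAt_basic (ha.contMDiffAt.mul (hh _ hq))), hq, ?_⟩
  have hk := ha.contMDiffAt.mul (hh _ hp)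
  have h1 := hasLieDerivAt_eulerField hA hp (contMDiffAt_basic hk)
    (Filter.Eventually.of_forall fun z => rfl)
  -- The coefficient is basic, so only the factor `n` from the fibre coordinates remains.
  rw [dirDeriv_eulerField_basic hk, zero_add, ← smul_smul, smul_comm] at h1
  exact h1

/-- A density on `E*` determines a nowhere-vanishing section of `|L^E|` by restriction to the zero
section. -/
lemma exists_absSection_of_density (Ω : DualDensity m n E) :
    ∃ σ : AbsSection m n E, ∀ (U : Set M) (x : Fin m → M → ℝ) (Y : Fin n → ∀ y, E y) (c : ℝ),
      AdaptedFrame U x Y → ∀ y ∈ U,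
        (toAbs (wedgeTensor (fun i => Y i y) (c • wedgeDiff (𝓡 m) x y)) = σ.val y ↔
          toAbs (c • wedgeDiff (dualModel m n) (adapted x Y) (⟨y, 0⟩ : DualTotal n E))
            = Ω.val ⟨y, 0⟩) := by
  choose θ hθ using fun y : M => exists_toAbs_eq (Ω.val ⟨y, 0⟩)
  choose s hs using fun y : M => exists_match_section (⟨y, 0⟩ : DualTotal n E) (θ y)
  have hval (U : Set M) (x : Fin m → M → ℝ) (Y : Fin n → ∀ y, E y) (c : ℝ)
      (hA : AdaptedFrame U x Y) (y : M) (hy : y ∈ U) :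
      toAbs (wedgeTensor (fun i => Y i y) (c • wedgeDiff (𝓡 m) x y)) = toAbs (s y) ↔
          toAbs (c • wedgeDiff (dualModel m n) (adapted x Y) (⟨y, 0⟩ : DualTotal n E))
            = Ω.val ⟨y, 0⟩ := by
    rw [← hθ]
    exact Match.toAbs_eq (hA.match_adapted (p := ⟨y, 0⟩) hy c) (hs y)
  refine ⟨⟨fun y => toAbs (s y), fun y h0 => ?_, fun y => ?_⟩, hval⟩
  · refine Ω.ne_zero ⟨y, 0⟩ ?_
    rw [← hθ, (hs y).eq_zero_iff.mp (toAbs_eq_zero_iff.mp h0)]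
  · obtain ⟨U, x, Y, hA, hy⟩ := exists_adaptedFrame m n E y
    obtain ⟨W, k, hW, hyW, hWU, hks, hk⟩ := Ω.exists_coeff hA (p := ⟨y, 0⟩) hy
    have hz : ContMDiff (𝓡 m) (dualModel m n) ∞ (fun z : M => (⟨z, 0⟩ : DualTotal n E)) :=
      Bundle.contMDiff_zeroSection ℝ (DualBundle E)
    refine ⟨(fun z : M => (⟨z, 0⟩ : DualTotal n E)) ⁻¹' W, hW.preimage hz.continuous, hyW, Y,
      fun z => k ⟨z, 0⟩ • wedgeDiff (𝓡 m) x z,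
      fun i z hz => hA.frame_smooth i z (hWU _ hz), smoothFormOn_smul_wedgeDiff
        (fun b z hz => hA.coord_smooth b z (hWU _ hz))
        (fun z hzW => ContMDiffAt.comp z (hks _ hzW) hz.contMDiffAt), fun z hz => ?_⟩
    exact (hval U x Y _ hA z (hWU _ hz)).mpr (hk _ hz)

end Densities

/-! ### The two main implications. -/

section Unimodularity

variable {m n : ℕ} {M : Type*} [TopologicalSpace M] [ChartedSpace (EuclideanSpace ℝ (Fin m)) M]
  {E : M → Type*} [∀ x, AddCommGroup (E x)] [∀ x, Module ℝ (E x)]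
  [TopologicalSpace (TotalSpace (Fib n) E)] [∀ x, TopologicalSpace (E x)]
  [FiberBundle (Fib n) E] [VectorBundle ℝ (Fib n) E]
  [IsManifold (𝓡 m) ∞ M] [ContMDiffVectorBundle ∞ (Fib n) E (𝓡 m)]

lemma IsMechanical.contMDiff {H : DualTotal n E → ℝ} (hH : IsMechanical m H) :
    ContMDiff (dualModel m n) 𝓘(ℝ, ℝ) ∞ H := by
  obtain ⟨g, V, hV, hH⟩ := hH
  rw [funext hH]
  exact (contMDiff_const.mul (contMDiff_metric_apply_self g)).add fun p =>
    contMDiffAt_basic hV.contMDiffAt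

/-- On the line `ξ + tη` the potential is constant and the kinetic energy is quadratic in `t`, with
linear coefficient `g(ξ, η)`. -/
lemma dirDeriv_vlift_mechanical {H : DualTotal n E → ℝ}
    {g : ContMDiffRiemannianMetric (𝓡 m) ∞ (DualFib n) (DualBundle E)} {V : M → ℝ}
    (hV : ContMDiff (𝓡 m) 𝓘(ℝ, ℝ) ∞ V)
    (hH : ∀ p : DualTotal n E, H p = (1 / 2 : ℝ) * g.inner p.1 p.2 p.2 + V p.1)
    (p : DualTotal n E) (η : DualBundle E p.1) :
    dirDeriv (dualModel m n) H p (vlift p η) = g.inner p.1 p.2 η := by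
  have hs : ContMDiff (dualModel m n) 𝓘(ℝ, ℝ) ∞ H := IsMechanical.contMDiff ⟨g, V, hV, hH⟩
  rw [dirDeriv_vlift (hs.contMDiffAt.mdifferentiableAt (by simp))]
  have h1 : (fun t : ℝ => H ⟨p.1, p.2 + t • η⟩) = fun t : ℝ =>
      H p + t * g.inner p.1 p.2 η + t ^ 2 * ((1 / 2 : ℝ) * g.inner p.1 η η) := by
    funext t
    have h2 : g.inner p.1 (p.2 + t • η) (p.2 + t • η) = g.inner p.1 p.2 p.2
        + 2 * (t * g.inner p.1 p.2 η) + t ^ 2 * g.inner p.1 η η := by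
      rw [map_add, map_smul, map_add, map_smul]
      change g.inner p.1 p.2 p.2 + t * g.inner p.1 η p.2
        + t * (g.inner p.1 p.2 η + t * g.inner p.1 η η) = _
      rw [g.symm p.1 η p.2]
      ring
    rw [hH, hH, h2]
    ring
  have h3 : HasDerivAt (fun t : ℝ => H p + t * g.inner p.1 p.2 η
      + t ^ 2 * ((1 / 2 : ℝ) * g.inner p.1 η η)) (g.inner p.1 p.2 η) 0 := by
    have h4 := (((hasDerivAt_id (0 : ℝ)).mul_const (g.inner p.1 p.2 η)).const_add (H p)).add
      ((hasDerivAt_pow 2 (0 : ℝ)).mul_const ((1 / 2 : ℝ) * g.inner p.1 η η))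
    refine h4.congr_deriv ?_
    simp
  rw [h1, h3.deriv]

variable (A : SkewAlgebroid m n E)

theorem exists_invariant_density_of_isUnimodular (hA : A.IsUnimodular) :
    ∃ Ω : DualDensity m n E, IsHomogeneous Ω ∧
      ∀ H : DualTotal n E → ℝ, ContMDiff (dualModel m n) 𝓘(ℝ, ℝ) ∞ H →
        Ω.IsInvariant (hamiltonianField A.bivector H) := by
  obtain ⟨σ, φ, hφ, h0⟩ := hA
  obtain ⟨f, hf, hφf⟩ : φ ∈ A.exactForms := (Submodule.Quotient.mk_eq_zero _).mp h0
  -- If `φ = d_Π f`, then `ρ(X)(exp(-f)) = -exp(-f) ⟨X, φ⟩`, which is what cancels the divergence of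
  -- the field of `ι(X)`.
  have ha : ContMDiff (𝓡 m) 𝓘(ℝ, ℝ) ∞ fun y => Real.exp (-f y) :=
    Real.contDiff_exp.contMDiff.comp hf.neg
  obtain ⟨Ω, hΩ, hval⟩ := exists_density_of_absSection σ ha fun y => (Real.exp_pos _).ne'
  refine ⟨Ω, hΩ, fun H hH => Density.lieEq_of_local fun p => ?_⟩
  obtain ⟨U, hU, hpU, Y, μ, hY, hμ, hσ⟩ := σ.locally_smooth p.1
  obtain ⟨U', x, h, hU', hp, hF, hh, hh0, hμh⟩ := exists_adaptedFrame_of_section hU hY hμ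
    (fun y hy => σ.wedgeTensor_ne_zero (hσ y hy)) hpU
  let a : M → ℝ := fun y => Real.exp (-f y)
  have hah (y) (hy : y ∈ U') : ContMDiffAt (𝓡 m) 𝓘(ℝ, ℝ) ∞ (fun z => a z * h z) y :=
    ha.contMDiffAt.mul (hh y hy)
  have hpre : IsOpen {q : DualTotal n E | q.1 ∈ U'} :=
    hF.isOpen.preimage (FiberBundle.continuous_proj (DualFib n) (DualBundle E))
  refine ⟨{q | q.1 ∈ U'}, fun q => basic n (fun y => a y * h y) q •
    wedgeDiff (dualModel m n) (adapted x Y) q, hpre, hp, smoothFormOn_smul_wedgeDiff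
    (fun i q hq => hF.contMDiffAt_adapted hq i) (fun q hq => contMDiffAt_basic (hah _ hq)),
    fun q hq => ?_, ?_⟩
  · rw [← hval U' x Y h hF q hq (by rw [← hμh _ hq, hσ _ (hU' hq)]), smul_smul]
    rfl
  have hθ : SmoothFormOn (dualModel m n)
      (fun q => basic n h q • wedgeDiff (dualModel m n) (adapted x Y) q) {q | q.1 ∈ U'} :=
    smoothFormOn_smul_wedgeDiff (fun i q hq => hF.contMDiffAt_adapted hq i)
      (fun q hq => contMDiffAt_basic (hh _ hq))
  -- By `hasLieDerivAt_of_frame` it suffices to have zero divergence for the linear functions of the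
  -- frame.
  have hframe (i : Fin n) : HasLieDerivAt (dualModel m n)
      (hamiltonianField A.bivector (iota n (Y i)))
      (fun q => basic n (fun y => a y * h y) q • wedgeDiff (dualModel m n) (adapted x Y) q) p
      ((0 : ℝ) • (a p.1 * h p.1) • wedgeDiff (dualModel m n) (adapted x Y) p) := by
    have hYs := hF.frame_smooth i p.1 hp
    obtain ⟨c, hc, hL⟩ := A.exists_nabla_coeff hF hh hh0 hμh (hF.frame_smooth i) hp
    have h1 := hc.unique (hφ U Y μ hU hY hμ hσ (Y i) (hY i) p.1 hpU)
    have hne := σ.wedgeTensor_ne_zero (hσ _ hpU)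
    have h2 : c = (φ p.1 (Y i p.1) : ℝ) :=
      eq_of_smul_eq_smul_of_ne_zero (W := LFiber m n E p.1) hne h1
    have h3 := (hL p.2).fun_smul (p := p) hp hθ
      ((contMDiffAt_basic ha.contMDiffAt).mdifferentiableAt (by simp))
    have h4 : dirDeriv (dualModel m n) (basic n a) p
        (hamiltonianField A.bivector (iota n (Y i)) p) = -a p.1 * c := by
      have h5 := A.dirDeriv_anchor hYs ha.contMDiffAt p.2
      refine h5.symm.trans ?_
      rw [dirDeriv_exp_neg (hf.contMDiffAt.mdifferentiableAt (by simp)), ← hφf p.1 (Y i) hYs, h2]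
    have h6 : (0 : ℝ) • (a p.1 * h p.1) • wedgeDiff (dualModel m n) (adapted x Y) p
        = dirDeriv (dualModel m n) (basic n a) p
          (hamiltonianField A.bivector (iota n (Y i)) p) •
            basic n h p • wedgeDiff (dualModel m n) (adapted x Y) p
          + basic n a p • c • h p.1 • wedgeDiff (dualModel m n) (adapted x Y) p := by
      rw [h4]
      simp only [basic]
      module
    rw [h6]
    simp only [basic, smul_smul] at h3 ⊢
    exact h3
  obtain ⟨η, hη, -⟩ := exists_dual_frame (hF.frame_indep p.1 hp)
  have h7 := A.hasLieDerivAt_of_frame hF hah hp hframe hη hH.contMDiffAt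
  simp only [zero_mul, Finset.sum_const_zero] at h7
  exact h7

theorem isUnimodular_of_invariant_density {Ω : DualDensity m n E} (hΩ : IsHomogeneous Ω)
    {H : DualTotal n E → ℝ} (hH : IsMechanical m H)
    (hinv : Ω.IsInvariant (hamiltonianField A.bivector H)) : A.IsUnimodular := by
  have hHs := hH.contMDiff
  obtain ⟨g, V, hV, hHg⟩ := hH
  obtain ⟨σ, hσ⟩ := exists_absSection_of_density Ω
  -- For the section induced by the invariant density the modular form itself vanishes, not only its
  -- class.
  refine ⟨σ, 0, fun U Y μ hU hY hμ hrep X hX y hyU => ?_, map_zero _⟩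
  obtain ⟨U', x, h, hU', hy, hF, hh, hh0, hμh⟩ := exists_adaptedFrame_of_section hU hY hμ
    (fun z hz => σ.wedgeTensor_ne_zero (hrep z hz)) hyU
  have hΩU (q : DualTotal n E) (hq : q.1 ∈ U') :
      toAbs (basic n h q • wedgeDiff (dualModel m n) (adapted x Y) q) = Ω.val q := by
    refine toAbs_eq_of_isHomogeneous hΩ hF hq ((hσ U' x Y _ hF q.1 hq).mp ?_) q.2
    rw [basic, ← hμh _ hq, hrep _ (hU' hq)]
  have hpre : IsOpen {q : DualTotal n E | q.1 ∈ U'} :=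
    hF.isOpen.preimage (FiberBundle.continuous_proj (DualFib n) (DualBundle E))
  obtain ⟨η, hη, hv, -⟩ := exists_dual_frame (hF.frame_indep y hy)
  choose c hc hL using fun i => A.exists_nabla_coeff hF hh hh0 hμh (hF.frame_smooth i) hy
  have hcg (ξ : DualBundle E y) : ∑ i, c i * g.inner y ξ (η i) = 0 := by
    have h1 := A.hasLieDerivAt_of_frame hF hh (p := ⟨y, ξ⟩) hy (fun i => hL i ξ) hη
      hHs.contMDiffAt
    have h2 := hinv {q | q.1 ∈ U'} _ hpre (smoothFormOn_smul_wedgeDiff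
      (fun i q hq => hF.contMDiffAt_adapted hq i) (fun q hq => contMDiffAt_basic (hh _ hq)))
      hΩU ⟨y, ξ⟩ hy
    have h3 := h1.unique h2
    have h4 : basic n h (⟨y, ξ⟩ : DualTotal n E) = h y := rfl
    rw [h4] at h3
    have h5 := eq_of_smul_eq_smul_of_ne_zero
      (smul_ne_zero (hh0 y hy) (hF.wedgeDiff_ne_zero (p := ⟨y, ξ⟩) hy)) h3
    simp_rw [dirDeriv_vlift_mechanical hV hHg] at h5
    exact h5
  -- This sum is the modular form at `y`. By `hcg` it is `g`-orthogonal to every `ξ`, in particular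
  -- to itself.
  have hsum : ∑ i, c i • η i = 0 := by
    by_contra hne
    have h1 := g.pos y _ hne
    have h2 := hcg (∑ i, c i • η i)
    have h3 : g.inner y (∑ i, c i • η i) (∑ i, c i • η i)
        = ∑ i, c i * g.inner y (∑ i, c i • η i) (η i) := by
      rw [map_sum (g.inner y (∑ i, c i • η i))]
      exact Finset.sum_congr rfl fun i _ => map_smul _ _ _
    rw [h3, h2] at h1
    exact lt_irrefl _ h1
  have hXU' : ∀ z ∈ U', SmoothSectionAt m n X z := fun z hz => hX z (hU' hz)
  -- For arbitrary `X`, the divergence formula applied to `ι(X)` identifies the coefficient `d` of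
  -- `∇_X` with `∑ cᵢ ηᵢ(X)`, the value on `X` of the form just shown to vanish.
  obtain ⟨d, hd, hLd⟩ := A.exists_nabla_coeff hF hh hh0 hμh hXU' hy
  have h1 := A.hasLieDerivAt_of_frame hF hh (p := ⟨y, 0⟩) hy (fun i => hL i 0) hη
    (contMDiffAt_iota (hXU' y hy))
  have h2 := eq_of_smul_eq_smul_of_ne_zero
    (smul_ne_zero (hh0 y hy) (hF.wedgeDiff_ne_zero (p := ⟨y, 0⟩) hy)) ((hLd 0).unique h1)
  have h3 : ∑ i, c i * (η i (X y) : ℝ) = 0 := by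
    have h4 := congrArg (fun ξ : DualBundle E y => (ξ (X y) : ℝ)) hsum
    simp only [sum_apply] at h4
    exact h4
  simp_rw [dirDeriv_vlift_iota (p := (⟨y, 0⟩ : DualTotal n E)) (hXU' y hy)] at h2
  rw [h2.trans h3] at hd
  exact hd

end Unimodularity

end SkewAlgebroids

end

open SkewAlgebroids in
theorem mainTheorem1 {m n : ℕ} {M : Type*} [TopologicalSpace M]
    [ChartedSpace (EuclideanSpace ℝ (Fin m)) M] [IsManifold (𝓡 m) ∞ M]
    [T2Space M] [SigmaCompactSpace M]
    (E : M → Type*) [∀ x, AddCommGroup (E x)] [∀ x, Module ℝ (E x)]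
    [TopologicalSpace (TotalSpace (Fib n) E)] [∀ x, TopologicalSpace (E x)]
    [FiberBundle (Fib n) E] [VectorBundle ℝ (Fib n) E]
    [ContMDiffVectorBundle ∞ (Fib n) E (𝓡 m)]
    (A : SkewAlgebroid m n E) :
    List.TFAE [
      A.IsUnimodular,
      ∃ Ω : DualDensity m n E, IsHomogeneous Ω ∧
        ∀ H : DualTotal n E → ℝ, ContMDiff (dualModel m n) 𝓘(ℝ, ℝ) ∞ H →
          Ω.IsInvariant (hamiltonianField A.bivector H),
      ∃ Ω : DualDensity m n E, IsHomogeneous Ω ∧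
        ∃ H : DualTotal n E → ℝ, IsMechanical m H ∧
          Ω.IsInvariant (hamiltonianField A.bivector H)] := by
  tfae_have 1 → 2 := exists_invariant_density_of_isUnimodular A
  tfae_have 2 → 3 := by
    rintro ⟨Ω, hΩ, hinv⟩
    -- Only here do the Hausdorff property and σ-compactness of `M` enter.
    obtain ⟨g⟩ := nonempty_contMDiffRiemannianMetric (m := m) (DualFib n) (DualBundle E)
    have hH : IsMechanical m fun p : DualTotal n E => (1 / 2 : ℝ) * g.inner p.1 p.2 p.2 + 0 :=
      ⟨g, fun _ => 0, contMDiff_const, fun _ => rfl⟩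
    exact ⟨Ω, hΩ, _, hH, hinv _ hH.contMDiff⟩
  tfae_have 3 → 1 := by
    rintro ⟨Ω, hΩ, H, hH, hinv⟩
    exact isUnimodular_of_invariant_density A hΩ hH hinv
  tfae_finish
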